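/- Let $Z>0$, $0<\sigma<1$, $0<h<1$, $0<T_{ign}<1$, $\delta>0$, and let $F:\mathbb R\to\mathbb R$ be a smoothed Arrhenius rate with ignition cut-off: $F(T)=0$ for $T\le T_{ign}$, $F(T)=\exp\!\big(Z\,\frac{T-h}{\sigma+(1-\sigma)T}\big)$ for $T\ge T_{ign}+2\delta$, and $F$ is nondecreasing on $[T_{ign},T_{ign}+2\delta]$ and smooth on $(-\infty,T_{ign}+2\delta]$ (one-sidedly at the right end point, where $F$ may have a corner). Suppose that the system $$u_t=u_{xx}+yF(w),\qquad y_t=-yF(w),\qquad w=hu+(1-h)(1-y),$$ has a front with speed $c$, i.e. there are $\hat u\in C^2(\mathbb R)$, $\hat y\in C^1(\mathbb R)$, functions of $\xi=x-ct$, such that, with $\hat w=h\hat u+(1-h)(1-\hat y)$, $$\hat u''+c\hat u'+\hat yF(\hat w)=0,\qquad c\hat y'-\hat yF(\hat w)=0,$$ $(\hat u,\hat y)\to(1,0)$ as $\xi\to-\infty$ and $(\hat u,\hat y)\to(0,1)$ as $\xi\to+\infty$. Let $$\mathcal L\begin{pmatrix}p\\q\end{pmatrix}=\begin{pmatrix}p''+cp'+F'(\hat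 w)\,\hat y\,(hp-(1-h)q)+F(\hat w)q\\ cq'-F'(\hat w)\,\hat y\,(hp-(1-h)q)-F(\hat w)q\end{pmatrix}$$ be the linearization about the front in the moving frame. Let $E_0$ be $H^1(\mathbb R;\mathbb C)$ or the space $BUC(\mathbb R;\mathbb C)$ of bounded uniformly continuous functions, let $E_\alpha=\{u: e^{\alpha\xi}u\in E_0\}$ with norm $\|u\|_\alpha=\|e^{\alpha\xi}u\|_{E_0}$, and regard $\mathcal L$ as an unbounded operator on $E_\alpha^2$ with its maximal domain: all $(p,q)\in E_\alpha^2$ with $p\in C^1$, $p'$ and $q$ locally absolutely continuous, and $\mathcal L(p,q)\in E_\alpha^2$ (equality almost everywhere). The essential spectrum is the spectrum without the isolated eigenvalues of finite algebraic multiplicity (finite rank of the Riesz projection). If $0<\alpha<c/2$, then there exists $\nu>0$ such that, for both choices of $E_0$, the essential spectrum of $\mathcal L$ on $E_\alpha^2$ is contained in the half-plane $\{\operatorname{Re}\lambda\le-\nu\}$. -/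

import Mathlib

open MeasureTheory Filter Topology

noncomputable section

namespace CombustionFront

/-! ### The reaction rate and the travelling front -/

/-- The Arrhenius law `exp (Z (T - h) / (σ + (1 - σ) T))`. -/
def arrhenius (Z σ h T : ℝ) : ℝ :=
  Real.exp (Z * ((T - h) / (σ + (1 - σ) * T)))

/-- `F` is a smoothed Arrhenius reaction rate with ignition cut-off: it vanishes up to the ignition
temperature `Tign`, is given by the Arrhenius law from `Tign + 2 δ` on, and is monotone in between.
It is smooth up to `Tign + 2 δ` inclusive, hence continuous and piecewise smooth on the line; both a
globally smooth `F` and the concrete choice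
`F T = arrhenius (Tign + 2 δ) * H_δ (T - Tign - δ)` on `[Tign, Tign + 2 δ]`, with `H_δ` a smooth
monotone approximation of the Heaviside function (which has a corner at `Tign + 2 δ`), are
instances. -/
structure IsSmoothedArrhenius (Z σ h Tign δ : ℝ) (F : ℝ → ℝ) : Prop where
  eq_zero : ∀ T, T ≤ Tign → F T = 0
  eq_arrhenius : ∀ T, Tign + 2 * δ ≤ T → F T = arrhenius Z σ h T
  monotone : MonotoneOn F (Set.Icc Tign (Tign + 2 * δ))
  smooth : ContDiffOn ℝ (⊤ : ℕ∞) F (Set.Iic (Tign + 2 * δ))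

/-- The temperature `w = h u + (1 - h) (1 - y)`. -/
def temperature (h : ℝ) (u y : ℝ → ℝ) (ξ : ℝ) : ℝ :=
  h * u ξ + (1 - h) * (1 - y ξ)

/-- `(u, y)` is a front of speed `c` of the system
`u_t = u_xx + y F(w)`, `y_t = - y F(w)`, `w = h u + (1 - h) (1 - y)`, as a function of
`ξ = x - c t`, connecting `(1, 0)` at `-∞` to `(0, 1)` at `+∞`. -/
structure IsFront (F : ℝ → ℝ) (h c : ℝ) (u y : ℝ → ℝ) : Prop where
  contDiff_u : ContDiff ℝ 2 u
  contDiff_y : ContDiff ℝ 1 y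
  eq_u : ∀ ξ, deriv (deriv u) ξ + c * deriv u ξ + y ξ * F (temperature h u y ξ) = 0
  eq_y : ∀ ξ, c * deriv y ξ - y ξ * F (temperature h u y ξ) = 0
  u_atBot : Tendsto u atBot (𝓝 1)
  y_atBot : Tendsto y atBot (𝓝 0)
  u_atTop : Tendsto u atTop (𝓝 0)
  y_atTop : Tendsto y atTop (𝓝 1)

/-! ### The function spaces -/

/-- Local absolute continuity on the line: the function is the integral of its (almost everywhere
defined) derivative. -/
def LocAC (u : ℝ → ℂ) : Prop :=
  LocallyIntegrable (deriv u) volume ∧ ∀ a b : ℝ, ∫ x in a..b, deriv u x = u b - u a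

theorem LocAC.ae_hasDerivAt {u : ℝ → ℂ} (hu : LocAC u) :
    ∀ᵐ x, HasDerivAt u (deriv u x) x := by
  filter_upwards [_root_.LocallyIntegrable.ae_hasDerivAt_integral hu.1] with x hx
  have h := (hx 0).add_const (u 0)
  refine h.congr_of_eventuallyEq (Eventually.of_forall fun y => ?_)
  simp [hu.2 0 y]

theorem LocAC.intervalIntegrable {u : ℝ → ℂ} (hu : LocAC u) (a b : ℝ) :
    IntervalIntegrable (deriv u) volume a b :=
  intervalIntegrable_iff.mpr <|
    (hu.1.integrableOn_isCompact isCompact_uIcc).mono_set Set.uIoc_subset_uIcc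

theorem LocAC.continuous {u : ℝ → ℂ} (hu : LocAC u) : Continuous u := by
  have h := intervalIntegral.continuous_primitive (μ := volume)
    (fun a b => hu.intervalIntegrable a b) 0
  have h2 : u = fun b => (∫ x in (0 : ℝ)..b, deriv u x) + u 0 := by
    funext b; simp [hu.2 0 b]
  rw [h2]
  exact h.add continuous_const

theorem LocAC.ae_deriv_add {u v : ℝ → ℂ} (hu : LocAC u) (hv : LocAC v) :
    deriv (u + v) =ᵐ[volume] deriv u + deriv v := by
  filter_upwards [hu.ae_hasDerivAt, hv.ae_hasDerivAt] with x h1 h2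
  exact (h1.add h2).deriv

theorem LocAC.ae_deriv_smul {u : ℝ → ℂ} (a : ℂ) (hu : LocAC u) :
    deriv (a • u) =ᵐ[volume] a • deriv u := by
  filter_upwards [hu.ae_hasDerivAt] with x h1
  exact (h1.const_smul a).deriv

theorem LocAC.add {u v : ℝ → ℂ} (hu : LocAC u) (hv : LocAC v) : LocAC (u + v) := by
  have he := hu.ae_deriv_add hv
  refine ⟨(hu.1.add hv.1).congr he.symm, fun a b => ?_⟩
  rw [intervalIntegral.integral_congr_ae (he.mono fun x hx _ => hx)]
  simp only [Pi.add_apply]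
  rw [intervalIntegral.integral_add (hu.intervalIntegrable a b) (hv.intervalIntegrable a b),
    hu.2, hv.2]
  ring

theorem LocAC.smul {u : ℝ → ℂ} (a : ℂ) (hu : LocAC u) : LocAC (a • u) := by
  have he := hu.ae_deriv_smul a
  refine ⟨(hu.1.smul a).congr he.symm, fun s t => ?_⟩
  rw [intervalIntegral.integral_congr_ae (he.mono fun x hx _ => hx)]
  simp only [Pi.smul_apply, smul_eq_mul]
  rw [intervalIntegral.integral_const_mul, hu.2]
  ring

theorem LocAC.zero : LocAC (0 : ℝ → ℂ) := by
  have : deriv (0 : ℝ → ℂ) = 0 := by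
    funext x; exact deriv_const x (0 : ℂ)
  refine ⟨?_, fun a b => ?_⟩ <;> rw [this]
  · exact locallyIntegrable_zero
  · simp

/-- The Sobolev space `H¹(ℝ; ℂ)`, each class being represented by its continuous member:
locally absolutely continuous functions that are square integrable with their derivative. -/
def h1Submodule : Submodule ℂ (ℝ → ℂ) where
  carrier := {u | LocAC u ∧ MemLp u 2 volume ∧ MemLp (deriv u) 2 volume}
  add_mem' := by
    rintro u v ⟨hu, hu2, hu3⟩ ⟨hv, hv2, hv3⟩
    exact ⟨hu.add hv, hu2.add hv2, (hu3.add hv3).ae_eq (hu.ae_deriv_add hv).symm⟩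
  zero_mem' := by
    refine ⟨LocAC.zero, MemLp.zero, ?_⟩
    have : deriv (0 : ℝ → ℂ) = 0 := by
      funext x; exact deriv_const x (0 : ℂ)
    rw [this]
    exact MemLp.zero
  smul_mem' := by
    rintro a u ⟨hu, hu2, hu3⟩
    exact ⟨hu.smul a, hu2.const_smul a, (hu3.const_smul a).ae_eq (hu.ae_deriv_smul a).symm⟩

/-- The space `BUC(ℝ; ℂ)` of bounded uniformly continuous functions. -/
def bucSubmodule : Submodule ℂ (ℝ → ℂ) where
  carrier := {u | UniformContinuous u ∧ ∃ C : ℝ, ∀ x, ‖u x‖ ≤ C}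
  add_mem' := by
    rintro u v ⟨hu, C, hC⟩ ⟨hv, D, hD⟩
    exact ⟨hu.add hv, C + D, fun x => (norm_add_le _ _).trans (add_le_add (hC x) (hD x))⟩
  zero_mem' := ⟨uniformContinuous_const, 0, fun x => by simp⟩
  smul_mem' := by
    rintro a u ⟨hu, C, hC⟩
    refine ⟨hu.const_smul a, ‖a‖ * C, fun x => ?_⟩
    rw [Pi.smul_apply, norm_smul]
    exact mul_le_mul_of_nonneg_left (hC x) (norm_nonneg a)

/-- Multiplication by the weight `e^{α ξ}`. -/
def weight (α : ℝ) : (ℝ → ℂ) →ₗ[ℂ] (ℝ → ℂ) where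
  toFun u := fun ξ => (Real.exp (α * ξ) : ℂ) * u ξ
  map_add' u v := by funext ξ; simp [mul_add]
  map_smul' a u := by funext ξ; simp [mul_left_comm]

theorem weight_injective (α : ℝ) : Function.Injective (weight α) := by
  intro u v huv
  funext ξ
  have h := congrFun huv ξ
  have hne : (Real.exp (α * ξ) : ℂ) ≠ 0 := by exact_mod_cast (Real.exp_pos _).ne'
  exact mul_left_cancel₀ hne h

theorem continuous_of_weight {α : ℝ} {u : ℝ → ℂ} (hu : Continuous (weight α u)) :
    Continuous u := by
  have h : u = weight (-α) (weight α u) := by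
    funext ξ
    simp [weight, ← mul_assoc, ← Complex.exp_add]
  rw [h]
  have : Continuous fun ξ : ℝ => (Real.exp (-α * ξ) : ℂ) := by fun_prop
  exact this.mul hu

/-- The weighted space over `H¹`: all `u` with `e^{α ξ} u ∈ H¹`. -/
def H1 (α : ℝ) : Type := h1Submodule.comap (weight α)

instance (α : ℝ) : AddCommGroup (H1 α) :=
  inferInstanceAs (AddCommGroup (h1Submodule.comap (weight α)))

instance (α : ℝ) : Module ℂ (H1 α) :=
  inferInstanceAs (Module ℂ (h1Submodule.comap (weight α)))

/-- The elements of the weighted space `H1 α` as functions. -/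
def H1.toFun (α : ℝ) : H1 α →ₗ[ℂ] (ℝ → ℂ) :=
  (h1Submodule.comap (weight α)).subtype

theorem H1.toFun_injective (α : ℝ) : Function.Injective (H1.toFun α) :=
  Subtype.coe_injective

theorem H1.weight_mem {α : ℝ} (u : H1 α) : weight α (H1.toFun α u) ∈ h1Submodule := u.2

theorem H1.continuous {α : ℝ} (u : H1 α) : Continuous (H1.toFun α u) :=
  continuous_of_weight (H1.weight_mem u).1.continuous

/-- `u ↦ (e^{α ξ} u, (e^{α ξ} u)')`, with values in `L² ⊕ L²`. -/
def H1.jet (α : ℝ) :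
    H1 α →ₗ[ℂ] WithLp 2 (Lp ℂ 2 (volume : Measure ℝ) × Lp ℂ 2 (volume : Measure ℝ)) where
  toFun u := WithLp.toLp 2 ((H1.weight_mem u).2.1.toLp _, (H1.weight_mem u).2.2.toLp _)
  map_add' u v := by
    rw [← WithLp.toLp_add]
    congr 1
    refine Prod.ext ?_ ?_
    · rw [Prod.fst_add, ← MemLp.toLp_add]
      refine MemLp.toLp_congr (H1.weight_mem (u + v)).2.1 _ ?_
      rw [map_add, map_add]
    · rw [Prod.snd_add, ← MemLp.toLp_add]
      refine MemLp.toLp_congr (H1.weight_mem (u + v)).2.2 _ ?_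
      rw [map_add, map_add]
      exact (H1.weight_mem u).1.ae_deriv_add (H1.weight_mem v).1
  map_smul' a u := by
    rw [RingHom.id_apply, ← WithLp.toLp_smul]
    congr 1
    refine Prod.ext ?_ ?_
    · rw [Prod.smul_fst, ← MemLp.toLp_const_smul]
      refine MemLp.toLp_congr (H1.weight_mem (a • u)).2.1 _ ?_
      rw [map_smul, map_smul]
    · rw [Prod.smul_snd, ← MemLp.toLp_const_smul]
      refine MemLp.toLp_congr (H1.weight_mem (a • u)).2.2 _ ?_
      rw [map_smul, map_smul]
      exact (H1.weight_mem u).1.ae_deriv_smul a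

theorem H1.jet_injective (α : ℝ) : Function.Injective (H1.jet α) := by
  intro u v huv
  have h1 : (H1.weight_mem u).2.1.toLp _ = (H1.weight_mem v).2.1.toLp _ :=
    congrArg (fun z => (WithLp.ofLp z).1) huv
  rw [MemLp.toLp_eq_toLp_iff] at h1
  exact H1.toFun_injective α <| weight_injective α <|
    ((H1.weight_mem u).1.continuous.ae_eq_iff_eq volume (H1.weight_mem v).1.continuous).1 h1

/-- `‖u‖² = ‖e^{α ξ} u‖²_{L²} + ‖(e^{α ξ} u)'‖²_{L²}`. -/
instance (α : ℝ) : NormedAddCommGroup (H1 α) :=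
  NormedAddCommGroup.induced (H1 α) _ (H1.jet α) (H1.jet_injective α)

instance (α : ℝ) : NormedSpace ℂ (H1 α) :=
  NormedSpace.induced ℂ (H1 α) _ (H1.jet α)

/-- The weighted space over `BUC`: all `u` with `e^{α ξ} u ∈ BUC`. -/
def BUC (α : ℝ) : Type := bucSubmodule.comap (weight α)

instance (α : ℝ) : AddCommGroup (BUC α) :=
  inferInstanceAs (AddCommGroup (bucSubmodule.comap (weight α)))

instance (α : ℝ) : Module ℂ (BUC α) :=
  inferInstanceAs (Module ℂ (bucSubmodule.comap (weight α)))

/-- The elements of the weighted space `BUC α` as functions. -/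
def BUC.toFun (α : ℝ) : BUC α →ₗ[ℂ] (ℝ → ℂ) :=
  (bucSubmodule.comap (weight α)).subtype

theorem BUC.toFun_injective (α : ℝ) : Function.Injective (BUC.toFun α) :=
  Subtype.coe_injective

theorem BUC.weight_mem {α : ℝ} (u : BUC α) : weight α (BUC.toFun α u) ∈ bucSubmodule := u.2

theorem BUC.continuous {α : ℝ} (u : BUC α) : Continuous (BUC.toFun α u) :=
  continuous_of_weight (BUC.weight_mem u).1.continuous

/-- `u ↦ e^{α ξ} u`, with values in the bounded continuous functions. -/
def BUC.weighted (α : ℝ) : BUC α →ₗ[ℂ] BoundedContinuousFunction ℝ ℂ where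
  toFun u := BoundedContinuousFunction.ofNormedAddCommGroup (weight α (BUC.toFun α u))
    (BUC.weight_mem u).1.continuous (BUC.weight_mem u).2.choose (BUC.weight_mem u).2.choose_spec
  map_add' u v := by ext ξ; simp
  map_smul' a u := by ext ξ; simp

theorem BUC.weighted_injective (α : ℝ) : Function.Injective (BUC.weighted α) := by
  intro u v huv
  refine BUC.toFun_injective α (weight_injective α (funext fun ξ => ?_))
  exact DFunLike.congr_fun huv ξ

/-- `‖u‖ = sup |e^{α ξ} u|`. -/
instance (α : ℝ) : NormedAddCommGroup (BUC α) :=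
  NormedAddCommGroup.induced (BUC α) _ (BUC.weighted α) (BUC.weighted_injective α)

instance (α : ℝ) : NormedSpace ℂ (BUC α) :=
  NormedSpace.induced ℂ (BUC α) _ (BUC.weighted α)

/-! ### The linearization about the front -/

/-- The graph of the linearization about the front `(u, y)`, with its maximal domain, in the square
of a space `X` of functions (`ι` reads an element of `X` as a function): the pairs
`((p, q), (f, g))` such that, almost everywhere,
`f = p'' + c p' + F'(w) y (h p - (1 - h) q) + F(w) q` and
`g = c q' - F'(w) y (h p - (1 - h) q) - F(w) q`. -/
def linearizationGraph {X : Type} [AddCommGroup X] [Module ℂ X] (ι : X →ₗ[ℂ] (ℝ → ℂ))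
    (F : ℝ → ℝ) (h c : ℝ) (u y : ℝ → ℝ) : Submodule ℂ ((X × X) × (X × X)) where
  carrier := {z |
    Differentiable ℝ (ι z.1.1) ∧ LocAC (deriv (ι z.1.1)) ∧ LocAC (ι z.1.2) ∧
    (∀ᵐ ξ : ℝ, ι z.2.1 ξ = deriv (deriv (ι z.1.1)) ξ + (c : ℂ) * deriv (ι z.1.1) ξ
      + ((deriv F (temperature h u y ξ) * y ξ : ℝ) : ℂ)
          * ((h : ℂ) * ι z.1.1 ξ - (1 - (h : ℂ)) * ι z.1.2 ξ)
      + (F (temperature h u y ξ) : ℂ) * ι z.1.2 ξ) ∧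
    (∀ᵐ ξ : ℝ, ι z.2.2 ξ = (c : ℂ) * deriv (ι z.1.2) ξ
      - ((deriv F (temperature h u y ξ) * y ξ : ℝ) : ℂ)
          * ((h : ℂ) * ι z.1.1 ξ - (1 - (h : ℂ)) * ι z.1.2 ξ)
      - (F (temperature h u y ξ) : ℂ) * ι z.1.2 ξ)}
  add_mem' := by
    rintro ⟨⟨p, q⟩, ⟨f, g⟩⟩ ⟨⟨p', q'⟩, ⟨f', g'⟩⟩ ⟨h1, h2, h3, h4, h5⟩ ⟨k1, k2, k3, k4, k5⟩
    simp only [Prod.mk_add_mk, Set.mem_ofPred_eq, map_add] at *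
    have e1 : deriv (ι p + ι p') = deriv (ι p) + deriv (ι p') := by
      funext ξ; exact deriv_add (h1 ξ) (k1 ξ)
    refine ⟨h1.add k1, e1 ▸ h2.add k2, h3.add k3, ?_, ?_⟩
    · rw [e1]
      filter_upwards [h2.ae_deriv_add k2, h4, k4] with ξ a1 a2 a3
      simp only [Pi.add_apply] at *
      rw [a1, a2, a3]; ring
    · filter_upwards [h3.ae_deriv_add k3, h5, k5] with ξ a1 a2 a3
      simp only [Pi.add_apply] at *
      rw [a1, a2, a3]; ring
  zero_mem' := by
    have e : deriv (0 : ℝ → ℂ) = 0 := by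
      funext x; exact deriv_const x (0 : ℂ)
    simp only [Set.mem_ofPred_eq, Prod.fst_zero, Prod.snd_zero, map_zero, e]
    exact ⟨differentiable_const 0, LocAC.zero, LocAC.zero, by simp, by simp⟩
  smul_mem' := by
    rintro a ⟨⟨p, q⟩, ⟨f, g⟩⟩ ⟨h1, h2, h3, h4, h5⟩
    simp only [Prod.smul_mk, Set.mem_ofPred_eq, map_smul] at *
    have e1 : deriv (a • ι p) = a • deriv (ι p) := by
      funext ξ; exact deriv_const_smul a (h1 ξ)
    refine ⟨h1.const_smul a, e1 ▸ h2.smul a, h3.smul a, ?_, ?_⟩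
    · rw [e1]
      filter_upwards [h2.ae_deriv_smul a, h4] with ξ a1 a2
      simp only [Pi.smul_apply, smul_eq_mul] at *
      rw [a1, a2]; ring
    · filter_upwards [h3.ae_deriv_smul a, h5] with ξ a1 a2
      simp only [Pi.smul_apply, smul_eq_mul] at *
      rw [a1, a2]; ring

/-- The linearized operator `𝓛` as an unbounded operator in `X × X`. -/
def linearization {X : Type} [AddCommGroup X] [Module ℂ X] (ι : X →ₗ[ℂ] (ℝ → ℂ))
    (F : ℝ → ℝ) (h c : ℝ) (u y : ℝ → ℝ) : (X × X) →ₗ.[ℂ] (X × X) :=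
  (linearizationGraph ι F h c u y).toLinearPMap

/-- In a space of continuous functions the value of `𝓛` is determined by its argument, so the graph
of `linearization` is `linearizationGraph`. -/
theorem linearization_graph {X : Type} [AddCommGroup X] [Module ℂ X] (ι : X →ₗ[ℂ] (ℝ → ℂ))
    (hι : Function.Injective ι) (hc : ∀ x, Continuous (ι x))
    (F : ℝ → ℝ) (h c : ℝ) (u y : ℝ → ℝ) :
    (linearization ι F h c u y).graph = linearizationGraph ι F h c u y := by
  refine Submodule.toLinearPMap_graph_eq _ ?_
  rintro ⟨⟨p, q⟩, ⟨f, g⟩⟩ ⟨-, -, -, h4, h5⟩ h0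
  obtain ⟨rfl, rfl⟩ : p = 0 ∧ q = 0 := by simpa using h0
  have e : deriv (0 : ℝ → ℂ) = 0 := by
    funext x; exact deriv_const x (0 : ℂ)
  simp only [map_zero, e] at h4 h5
  have hf : ι f = 0 := ((hc f).ae_eq_iff_eq (μ := volume) continuous_zero).1
    (h4.mono fun ξ hξ => by simpa using hξ)
  have hg : ι g = 0 := ((hc g).ae_eq_iff_eq (μ := volume) continuous_zero).1
    (h5.mono fun ξ hξ => by simpa using hξ)
  exact Prod.ext (hι (by simpa using hf)) (hι (by simpa using hg))

/-- The linearized operator on the square of the weighted space over `H¹`. -/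
def linearizationH1 (α : ℝ) (F : ℝ → ℝ) (h c : ℝ) (u y : ℝ → ℝ) :
    (H1 α × H1 α) →ₗ.[ℂ] (H1 α × H1 α) :=
  linearization (H1.toFun α) F h c u y

/-- The linearized operator on the square of the weighted space over `BUC`. -/
def linearizationBUC (α : ℝ) (F : ℝ → ℝ) (h c : ℝ) (u y : ℝ → ℝ) :
    (BUC α × BUC α) →ₗ.[ℂ] (BUC α × BUC α) :=
  linearization (BUC.toFun α) F h c u y

theorem linearizationH1_graph (α : ℝ) (F : ℝ → ℝ) (h c : ℝ) (u y : ℝ → ℝ) :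
    (linearizationH1 α F h c u y).graph = linearizationGraph (H1.toFun α) F h c u y :=
  linearization_graph _ (H1.toFun_injective α) H1.continuous F h c u y

theorem linearizationBUC_graph (α : ℝ) (F : ℝ → ℝ) (h c : ℝ) (u y : ℝ → ℝ) :
    (linearizationBUC α F h c u y).graph = linearizationGraph (BUC.toFun α) F h c u y :=
  linearization_graph _ (BUC.toFun_injective α) BUC.continuous F h c u y

/-! ### Spectrum and essential spectrum of an unbounded operator -/

section Spectrum

variable {E : Type*} [NormedAddCommGroup E] [NormedSpace ℂ E]

/-- `R` is a bounded two-sided inverse of `z - A : D(A) → E`. -/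
def IsResolventAt (A : E →ₗ.[ℂ] E) (z : ℂ) (R : E →L[ℂ] E) : Prop :=
  (∀ x : E, ∃ hx : R x ∈ A.domain, z • R x - A ⟨R x, hx⟩ = x) ∧
  ∀ x : A.domain, R (z • (x : E) - A x) = x

/-- The resolvent set of an unbounded operator. -/
def resolventSet (A : E →ₗ.[ℂ] E) : Set ℂ :=
  {z | ∃ R : E →L[ℂ] E, IsResolventAt A z R}

/-- The spectrum of an unbounded operator. -/
def spectrum (A : E →ₗ.[ℂ] E) : Set ℂ :=
  (resolventSet A)ᶜ

open Classical in
/-- The resolvent `(z - A)⁻¹`, set to zero outside the resolvent set. -/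
def resolvent (A : E →ₗ.[ℂ] E) (z : ℂ) : E →L[ℂ] E :=
  if hz : ∃ R : E →L[ℂ] E, IsResolventAt A z R then hz.choose else 0

/-- `(2πi)⁻¹ ∮ (z - A)⁻¹ dz` over the circle of centre `z₀` and radius `r`. -/
def rieszProjection (A : E →ₗ.[ℂ] E) (z₀ : ℂ) (r : ℝ) : E →L[ℂ] E :=
  (2 * Real.pi * Complex.I : ℂ)⁻¹ • ∮ z in C(z₀, r), resolvent A z

/-- `z₀` is an eigenvalue of `A`, isolated in the spectrum, of finite algebraic multiplicity (the
rank of its Riesz projection). -/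
def IsDiscreteEigenvalue (A : E →ₗ.[ℂ] E) (z₀ : ℂ) : Prop :=
  (∃ x : A.domain, (x : E) ≠ 0 ∧ A x = z₀ • (x : E)) ∧
  ∃ r : ℝ, 0 < r ∧ (∀ z : ℂ, z ≠ z₀ → dist z z₀ ≤ r → z ∈ resolventSet A) ∧
    FiniteDimensional ℂ (LinearMap.range (rieszProjection A z₀ r).toLinearMap)

/-- The essential spectrum: what remains of the spectrum without the isolated eigenvalues of finite
multiplicity. -/
def essentialSpectrum (A : E →ₗ.[ℂ] E) : Set ℂ :=
  {z | z ∈ spectrum A ∧ ¬ IsDiscreteEigenvalue A z}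

end Spectrum

end CombustionFront

end

/-!
Multiplication by `e^{α ξ}` turns `𝓛` into the operator
`(P'' + (c - 2 α) P' - α (c - α) P + a (h P - (1 - h) Q) + b Q,
c Q' - c α Q - a (h P - (1 - h) Q) - b Q)` on unweighted spaces, with `a = F'(w) y` and
`b = F(w) ≥ 0`. Without `a` the system is triangular, and factoring its second-order part into
first-order equations solves it with bounds for all `λ` with `Re λ > - α (c - α)`. The coefficient
`a` vanishes at both ends, because `y → 0` behind the front and `F'(w) → 0` ahead of it, so
multiplication by `a` is relatively compact. Hence `λ - 𝓛` is invertible up to finite rank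
throughout this half-plane, and it is injective for one real `λ`. By analytic Fredholm theory the
spectrum there consists of isolated eigenvalues of finite algebraic multiplicity.

The system is solved in `L²`, respectively in `L^∞`. The operators on the weighted spaces over `H¹`
and `BUC` are parts of the operators obtained there, and inherit their resolvents.
-/

noncomputable section

namespace CombustionFront

/-! ### Finitely meromorphic operator families -/

section FiniteRank

variable {X Y : Type*} [NormedAddCommGroup X] [NormedSpace ℂ X]
  [NormedAddCommGroup Y] [NormedSpace ℂ Y]

variable (X Y) in
/-- The space of bounded operators of finite rank. -/
def finiteRank : Submodule ℂ (X →L[ℂ] Y) where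
  carrier := {T | FiniteDimensional ℂ (LinearMap.range T.toLinearMap)}
  add_mem' {S T} (_ : FiniteDimensional ℂ _) (_ : FiniteDimensional ℂ _) :=
    Submodule.finiteDimensional_of_le (LinearMap.range_add_le S.toLinearMap T.toLinearMap)
  zero_mem' := by
    change FiniteDimensional ℂ (LinearMap.range (0 : X →ₗ[ℂ] Y))
    rw [LinearMap.range_zero]
    infer_instance
  smul_mem' a T (_ : FiniteDimensional ℂ _) :=
    Submodule.finiteDimensional_of_le (LinearMap.range_smul_le_range T.toLinearMap a)

theorem mem_finiteRank {T : X →L[ℂ] Y} :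
    T ∈ finiteRank X Y ↔ FiniteDimensional ℂ (LinearMap.range T.toLinearMap) := Iff.rfl

theorem smulRight_mem_finiteRank (ψ : X →L[ℂ] ℂ) (v : Y) : ψ.smulRight v ∈ finiteRank X Y := by
  refine mem_finiteRank.2 (Submodule.finiteDimensional_of_le (S₂ := ℂ ∙ v) ?_)
  rintro _ ⟨x, rfl⟩
  exact Submodule.smul_mem _ _ (Submodule.mem_span_singleton_self v)

theorem mem_finiteRank_of_comp_eq {X' Y' : Type*} [NormedAddCommGroup X'] [NormedSpace ℂ X']
    [NormedAddCommGroup Y'] [NormedSpace ℂ Y'] {I : X →ₗ[ℂ] X'} {J : Y →ₗ[ℂ] Y'}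
    (hJ : Function.Injective J) {S : X →L[ℂ] Y} {T : X' →L[ℂ] Y'}
    (hST : ∀ x, J (S x) = T (I x)) (hT : T ∈ finiteRank X' Y') : S ∈ finiteRank X Y := by
  have : FiniteDimensional ℂ (LinearMap.range T.toLinearMap) := mem_finiteRank.1 hT
  refine mem_finiteRank.2 (Module.Finite.of_injective
    ((J ∘ₗ (LinearMap.range S.toLinearMap).subtype).codRestrict
      (LinearMap.range T.toLinearMap) ?_) fun a b hab => ?_)
  · rintro ⟨_, x, rfl⟩
    exact ⟨I x, (hST x).symm⟩
  · exact Subtype.ext (hJ (congrArg Subtype.val hab))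

theorem circleIntegral_comp_comm [CompleteSpace X] [CompleteSpace Y] (L : X →L[ℂ] Y)
    {f : ℂ → X} {z₀ : ℂ} {r : ℝ} (hf : CircleIntegrable f z₀ r) :
    ∮ z in C(z₀, r), L (f z) = L (∮ z in C(z₀, r), f z) := by
  simp only [circleIntegral, ← map_smul]
  exact L.intervalIntegral_comp_comm hf.out

theorem continuousOn_inv_sub_pow {z₀ : ℂ} {r : ℝ} (hr : 0 < r) (k : ℕ) :
    ContinuousOn (fun z : ℂ => ((z - z₀) ^ k)⁻¹) (Metric.sphere z₀ r) :=
  ContinuousOn.inv₀ (by fun_prop) fun _ hz =>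
    pow_ne_zero _ (sub_ne_zero.2 (Metric.ne_of_mem_sphere hz hr.ne'))

theorem differentiableOn_smulRight {U : Set ℂ} {ψ : ℂ → X →L[ℂ] ℂ} {φ : ℂ → Y}
    (hψ : DifferentiableOn ℂ ψ U) (hφ : DifferentiableOn ℂ φ U) :
    DifferentiableOn ℂ (fun z => (ψ z).smulRight (φ z)) U := by
  change DifferentiableOn ℂ (fun z => ContinuousLinearMap.smulRightL ℂ X Y (ψ z) (φ z)) U
  fun_prop

theorem inv_pow_smul_smulRight_eq_add_dslope (ψ : X →L[ℂ] ℂ) (φ : ℂ → Y) {z z₀ : ℂ}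
    (hz : z ≠ z₀) (k : ℕ) :
    ((z - z₀) ^ (k + 1))⁻¹ • ψ.smulRight (φ z) =
      (((z - z₀) ^ (k + 1))⁻¹ • ψ).smulRight (φ z₀) +
        ((z - z₀) ^ k)⁻¹ • ψ.smulRight (dslope φ z₀ z) := by
  have hφ : φ z = φ z₀ + (z - z₀) • dslope φ z₀ z := by
    rw [sub_smul_dslope, add_sub_cancel]
  have hz' : z - z₀ ≠ 0 := sub_ne_zero.2 hz
  ext x
  simp only [smul_apply, ContinuousLinearMap.smulRight_apply, add_apply]
  rw [hφ, smul_add, smul_add]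
  simp only [smul_smul, smul_eq_mul]
  congr 2
  rw [pow_succ]
  field_simp

theorem circleIntegral_eq_zero_of_differentiableOn {f : ℂ → Y} {U : Set ℂ} {z₀ : ℂ} {r : ℝ}
    (hr : 0 < r) (hU : Metric.closedBall z₀ r ⊆ U) (hf : DifferentiableOn ℂ f U) :
    ∮ z in C(z₀, r), f z = 0 :=
  (hf.diffContOnCl_ball hU).circleIntegral_eq_zero hr.le

theorem circleIntegrable_inv_pow_smul_smulRight {U : Set ℂ} {z₀ : ℂ} {r : ℝ} (hr : 0 < r)
    (hU : Metric.closedBall z₀ r ⊆ U) {ψ : ℂ → X →L[ℂ] ℂ} (hψ : DifferentiableOn ℂ ψ U)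
    {φ : ℂ → Y} (hφ : DifferentiableOn ℂ φ U) (k : ℕ) :
    CircleIntegrable (fun z => ((z - z₀) ^ k)⁻¹ • (ψ z).smulRight (φ z)) z₀ r :=
  ((continuousOn_inv_sub_pow hr k).smul ((differentiableOn_smulRight hψ hφ).continuousOn.mono
    (Metric.sphere_subset_closedBall.trans hU))).circleIntegrable hr.le

/-- The operator family `R` is meromorphic at `z₀` and the principal part of its Laurent expansion
has coefficients of finite rank. -/
def IsFinitelyMeromorphicAt (R : ℂ → X →L[ℂ] Y) (z₀ : ℂ) : Prop :=
  ∃ (n k : ℕ) (A : ℂ → X →L[ℂ] Y) (ψ : Fin n → ℂ → X →L[ℂ] ℂ) (φ : Fin n → ℂ → Y),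
    AnalyticAt ℂ A z₀ ∧ (∀ i, AnalyticAt ℂ (ψ i) z₀) ∧ (∀ i, AnalyticAt ℂ (φ i) z₀) ∧
    ∀ᶠ z in 𝓝[≠] z₀, R z = A z + ∑ i, ((z - z₀) ^ k)⁻¹ • (ψ i z).smulRight (φ i z)

theorem isFinitelyMeromorphicAt_add_inv_smul_sum {z₀ : ℂ} {n : ℕ} {A : ℂ → X →L[ℂ] Y} {d : ℂ → ℂ}
    {ψ : Fin n → ℂ → X →L[ℂ] ℂ} {φ : Fin n → ℂ → Y} (hA : AnalyticAt ℂ A z₀)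
    (hd : AnalyticAt ℂ d z₀) (hd₀ : ¬ ∀ᶠ z in 𝓝 z₀, d z = 0) (hψ : ∀ i, AnalyticAt ℂ (ψ i) z₀)
    (hφ : ∀ i, AnalyticAt ℂ (φ i) z₀) :
    IsFinitelyMeromorphicAt (fun z => A z + (d z)⁻¹ • ∑ i, (ψ i z).smulRight (φ i z)) z₀ := by
  obtain ⟨k, g, hg, hg₀, hdg⟩ := hd.exists_eventuallyEq_pow_smul_nonzero_iff.2 hd₀
  refine ⟨n, k, A, fun i z => (g z)⁻¹ • ψ i z, φ, hA, fun i => (hg.inv hg₀).smul (hψ i), hφ, ?_⟩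
  filter_upwards [nhdsWithin_le_nhds hdg] with z hz
  rw [hz, Finset.smul_sum]
  refine congrArg _ (Finset.sum_congr rfl fun i _ => ?_)
  ext x
  simp [mul_assoc, mul_left_comm, smul_smul]

variable [CompleteSpace Y]

/-- Each step of the induction splits off the value of `φ` at the centre, which contributes an
operator of rank one, and lowers the order of the pole. -/
theorem circleIntegral_inv_pow_smul_smulRight_mem_finiteRank {U : Set ℂ} (hU : IsOpen U)
    {z₀ : ℂ} {r : ℝ} (hr : 0 < r) (hrU : Metric.closedBall z₀ r ⊆ U) {ψ : ℂ → X →L[ℂ] ℂ}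
    (hψ : DifferentiableOn ℂ ψ U) {φ : ℂ → Y} (hφ : DifferentiableOn ℂ φ U) (k : ℕ) :
    (∮ z in C(z₀, r), ((z - z₀) ^ k)⁻¹ • (ψ z).smulRight (φ z)) ∈ finiteRank X Y := by
  induction k generalizing φ with
  | zero =>
    simp only [pow_zero, inv_one, one_smul]
    rw [circleIntegral_eq_zero_of_differentiableOn hr hrU (differentiableOn_smulRight hψ hφ)]
    exact zero_mem _
  | succ k ih =>
    have hslope : DifferentiableOn ℂ (dslope φ z₀) U := (Complex.differentiableOn_dslope
      (hU.mem_nhds (hrU (Metric.mem_closedBall_self hr.le)))).2 hφ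
    have hψcont : ContinuousOn (fun z => ((z - z₀) ^ (k + 1))⁻¹ • ψ z) (Metric.sphere z₀ r) :=
      (continuousOn_inv_sub_pow hr _).smul
        (hψ.continuousOn.mono (Metric.sphere_subset_closedBall.trans hrU))
    let L : (X →L[ℂ] ℂ) →L[ℂ] X →L[ℂ] Y := (ContinuousLinearMap.smulRightL ℂ X Y).flip (φ z₀)
    have hsplit : (∮ z in C(z₀, r), ((z - z₀) ^ (k + 1))⁻¹ • (ψ z).smulRight (φ z)) =
        (∮ z in C(z₀, r), ((z - z₀) ^ (k + 1))⁻¹ • ψ z).smulRight (φ z₀) +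
        ∮ z in C(z₀, r), ((z - z₀) ^ k)⁻¹ • (ψ z).smulRight (dslope φ z₀ z) := by
      change _ = L _ + _
      rw [← circleIntegral_comp_comm L (hψcont.circleIntegrable hr.le),
        ← circleIntegral.integral_add (f := fun z => L (((z - z₀) ^ (k + 1))⁻¹ • ψ z))
          ((L.continuous.comp_continuousOn hψcont).circleIntegrable hr.le)
          (circleIntegrable_inv_pow_smul_smulRight hr hrU hψ hslope k)]
      exact circleIntegral.integral_congr hr.le fun z hz =>
        inv_pow_smul_smulRight_eq_add_dslope _ _ (Metric.ne_of_mem_sphere hz hr.ne') k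
    rw [hsplit]
    exact add_mem (smulRight_mem_finiteRank _ _) (ih hslope)

theorem IsFinitelyMeromorphicAt.eventually_circleIntegral_mem_finiteRank
    {R : ℂ → X →L[ℂ] Y} {z₀ : ℂ} (hR : IsFinitelyMeromorphicAt R z₀) :
    ∀ᶠ r in 𝓝[>] (0 : ℝ), ContinuousOn R (Metric.sphere z₀ r) ∧
      (∮ z in C(z₀, r), R z) ∈ finiteRank X Y := by
  obtain ⟨n, k, A, ψ, φ, hA, hψ, hφ, hR⟩ := hR
  obtain ⟨ε, hε, hball⟩ := Metric.eventually_nhds_iff_ball.1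
    ((hA.eventually_analyticAt.and ((eventually_all.2 fun i => (hψ i).eventually_analyticAt).and
      (eventually_all.2 fun i => (hφ i).eventually_analyticAt))).and
      (eventually_nhdsWithin_iff.1 hR))
  have hA : DifferentiableOn ℂ A (Metric.ball z₀ ε) := fun z hz =>
    (hball z hz).1.1.differentiableAt.differentiableWithinAt
  have hψ : ∀ i, DifferentiableOn ℂ (ψ i) (Metric.ball z₀ ε) := fun i z hz =>
    ((hball z hz).1.2.1 i).differentiableAt.differentiableWithinAt
  have hφ : ∀ i, DifferentiableOn ℂ (φ i) (Metric.ball z₀ ε) := fun i z hz =>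
    ((hball z hz).1.2.2 i).differentiableAt.differentiableWithinAt
  filter_upwards [Ioo_mem_nhdsGT hε] with r ⟨hr, hrε⟩
  have hrU : Metric.closedBall z₀ r ⊆ Metric.ball z₀ ε := Metric.closedBall_subset_ball hrε
  have hsphere := Metric.sphere_subset_closedBall.trans hrU
  have hR : Set.EqOn R (fun z => A z + ∑ i, ((z - z₀) ^ k)⁻¹ • (ψ i z).smulRight (φ i z))
      (Metric.sphere z₀ r) := fun z hz =>
    (hball z (hsphere hz)).2 (Metric.ne_of_mem_sphere hz hr.ne')
  have hpole : ContinuousOn (fun z => ∑ i, ((z - z₀) ^ k)⁻¹ • (ψ i z).smulRight (φ i z))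
      (Metric.sphere z₀ r) := continuousOn_finsetSum _ fun i _ =>
    (continuousOn_inv_sub_pow hr k).smul
      ((differentiableOn_smulRight (hψ i) (hφ i)).continuousOn.mono hsphere)
  have hA' := hA.continuousOn.mono hsphere
  refine ⟨(hA'.add hpole).congr hR, ?_⟩
  rw [circleIntegral.integral_congr hr.le hR, circleIntegral.integral_add
    (hA'.circleIntegrable hr.le) (hpole.circleIntegrable hr.le),
    circleIntegral_eq_zero_of_differentiableOn hr hrU hA, zero_add,
    circleIntegral.integral_fun_sum fun i _ =>
      circleIntegrable_inv_pow_smul_smulRight hr hrU (hψ i) (hφ i) k]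
  exact sum_mem fun i _ => circleIntegral_inv_pow_smul_smulRight_mem_finiteRank Metric.isOpen_ball
    hr hrU (hψ i) (hφ i) k

end FiniteRank

/-! ### Analytic Fredholm theory for operators with local parametrices -/

section Graph

variable {Y : Type*} [NormedAddCommGroup Y] [NormedSpace ℂ Y] {Γ : Submodule ℂ (Y × Y)} {z : ℂ}

/-- `R` is a bounded two-sided inverse of `z - A`, where `A` is the operator with graph `Γ`. -/
def IsGraphResolvent (Γ : Submodule ℂ (Y × Y)) (z : ℂ) (R : Y →L[ℂ] Y) : Prop :=
  (∀ y, (R y, z • R y - y) ∈ Γ) ∧ ∀ x f, (x, f) ∈ Γ → R (z • x - f) = x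

/-- The resolvent set of the operator with graph `Γ`. -/
def graphResolventSet (Γ : Submodule ℂ (Y × Y)) : Set ℂ :=
  {z | ∃ R, IsGraphResolvent Γ z R}

theorem IsGraphResolvent.eq_zero_of_mem {R : Y →L[ℂ] Y} (hR : IsGraphResolvent Γ z R) {x : Y}
    (hx : (x, z • x) ∈ Γ) : x = 0 := by
  simpa using (hR.2 _ _ hx).symm

theorem isGraphResolvent_of_forall_mem {R : Y →L[ℂ] Y} (hR : ∀ y, (R y, z • R y - y) ∈ Γ)
    (hker : ∀ x, (x, z • x) ∈ Γ → x = 0) : IsGraphResolvent Γ z R := by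
  refine ⟨hR, fun x f hxf => (sub_eq_zero.1 (hker _ ?_)).symm⟩
  have hsub := Γ.sub_mem hxf (hR (z • x - f))
  rwa [Prod.mk_sub_mk, show f - (z • R (z • x - f) - (z • x - f)) = z • (x - R (z • x - f)) by
    rw [smul_sub]; abel] at hsub

variable {ι : Type*} [Fintype ι]

/-- `W` is a right inverse of `z - A` modulo the finite rank operator `∑ i, π i ⊗ e i`, and a
bijection onto the domain of `A`, where `A` is the operator with graph `Γ`. -/
structure IsParametrix (Γ : Submodule ℂ (Y × Y)) (z : ℂ) (W : Y →L[ℂ] Y)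
    (π : ι → Y →L[ℂ] ℂ) (e : ι → Y) : Prop where
  mem : ∀ y, (W y, z • W y - y + ∑ i, π i y • e i) ∈ Γ
  surj : ∀ x f, (x, f) ∈ Γ → ∃ y, W y = x
  inj : Function.Injective W

/-- The Weinstein–Aronszajn matrix of the finite rank perturbation `1 - ∑ i, π i ⊗ e i` of the
identity. -/
def weinsteinAronszajn [DecidableEq ι] (π : ι → Y →L[ℂ] ℂ) (e : ι → Y) : Matrix ι ι ℂ :=
  1 - Matrix.of fun i j => π i (e j)

theorem weinsteinAronszajn_mulVec [DecidableEq ι] (π : ι → Y →L[ℂ] ℂ) (e : ι → Y) (v : ι → ℂ)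
    (i : ι) :
    (weinsteinAronszajn π e).mulVec v i = v i - π i (∑ j, v j • e j) := by
  rw [weinsteinAronszajn, Matrix.sub_mulVec, Matrix.one_mulVec]
  simp [Matrix.mulVec, dotProduct, mul_comm]

section Parametrix

variable {W : Y →L[ℂ] Y} {π : ι → Y →L[ℂ] ℂ} {e : ι → Y}

theorem IsParametrix.exists_ne_zero_of_det_eq_zero [DecidableEq ι] (h : IsParametrix Γ z W π e)
    (hdet : (weinsteinAronszajn π e).det = 0) : ∃ x, x ≠ 0 ∧ (x, z • x) ∈ Γ := by
  obtain ⟨v, hv, hMv⟩ := Matrix.exists_mulVec_eq_zero_iff.2 hdet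
  have hπ : ∀ i, π i (∑ j, v j • e j) = v i := fun i => by
    have := weinsteinAronszajn_mulVec π e v i
    rw [hMv] at this
    exact (sub_eq_zero.1 this.symm).symm
  refine ⟨W (∑ j, v j • e j), fun h0 => hv ?_, ?_⟩
  · have hsum : ∑ j, v j • e j = 0 := h.inj (by simpa using h0)
    exact funext fun i => by simpa [hsum] using (hπ i).symm
  · simpa [hπ] using h.mem (∑ j, v j • e j)

theorem IsParametrix.eq_zero_of_det_ne_zero [DecidableEq ι] (hΓ : ∀ f, ((0 : Y), f) ∈ Γ → f = 0)
    (h : IsParametrix Γ z W π e) (hdet : (weinsteinAronszajn π e).det ≠ 0) {x : Y}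
    (hx : (x, z • x) ∈ Γ) : x = 0 := by
  obtain ⟨y, rfl⟩ := h.surj _ _ hx
  have hy : y = ∑ i, π i y • e i := by
    refine sub_eq_zero.1 (hΓ _ ?_)
    have hsub := Γ.sub_mem hx (h.mem y)
    rwa [Prod.mk_sub_mk, sub_self, sub_add, sub_sub_cancel] at hsub
  have hMv : (weinsteinAronszajn π e).mulVec (fun i => π i y) = 0 := by
    funext i
    rw [weinsteinAronszajn_mulVec, ← hy, sub_self, Pi.zero_apply]
  have hπ : (fun i => π i y) = 0 := by
    by_contra hne
    exact hdet (Matrix.exists_mulVec_eq_zero_iff.1 ⟨_, hne, hMv⟩)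
  rw [hy, Finset.sum_eq_zero fun i _ => by rw [show π i y = 0 from congrFun hπ i, zero_smul],
    map_zero]

/-- The resolvent is Cramer's rule for the Weinstein–Aronszajn matrix. -/
theorem IsParametrix.isGraphResolvent [DecidableEq ι] (hΓ : ∀ f, ((0 : Y), f) ∈ Γ → f = 0)
    (h : IsParametrix Γ z W π e) (hdet : (weinsteinAronszajn π e).det ≠ 0) :
    IsGraphResolvent Γ z (W + (weinsteinAronszajn π e).det⁻¹ •
      ∑ i, (∑ j, (weinsteinAronszajn π e).adjugate i j • π j).smulRight (W (e i))) := by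
  refine isGraphResolvent_of_forall_mem (fun y => ?_) fun x => h.eq_zero_of_det_ne_zero hΓ hdet
  set M := weinsteinAronszajn π e
  set v : ι → ℂ := M.det⁻¹ • M.adjugate.mulVec (fun j => π j y) with hv
  have hMv : M.mulVec v = fun j => π j y := by
    rw [hv, Matrix.mulVec_smul, Matrix.mulVec_mulVec, Matrix.mul_adjugate, Matrix.smul_mulVec,
      Matrix.one_mulVec, smul_smul, inv_mul_cancel₀ hdet, one_smul]
  have hRy : (W + M.det⁻¹ • ∑ i, (∑ j, M.adjugate i j • π j).smulRight (W (e i))) y =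
      W (y + ∑ i, v i • e i) := by
    simp only [hv, add_apply, smul_apply, sum_apply, ContinuousLinearMap.smulRight_apply, map_add,
      map_sum, map_smul, Matrix.mulVec, dotProduct, Pi.smul_apply, smul_eq_mul, Finset.smul_sum,
      smul_smul]
  have hπ : ∀ i, π i (y + ∑ j, v j • e j) = v i := fun i => by
    have := weinsteinAronszajn_mulVec π e v i
    rw [hMv] at this
    rw [map_add]
    linear_combination this
  have hmem := h.mem (y + ∑ i, v i • e i)
  simp only [hπ] at hmem
  rwa [hRy, ← add_sub_add_right_eq_sub _ _ (∑ i, v i • e i), add_sub_right_comm]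

theorem IsParametrix.mem_graphResolventSet (hΓ : ∀ f, ((0 : Y), f) ∈ Γ → f = 0)
    (h : IsParametrix Γ z W π e) (hker : ∀ x, (x, z • x) ∈ Γ → x = 0) :
    z ∈ graphResolventSet Γ := by
  classical
  refine ⟨_, h.isGraphResolvent hΓ fun hdet => ?_⟩
  obtain ⟨x, hx, hxΓ⟩ := h.exists_ne_zero_of_det_eq_zero hdet
  exact hx (hker x hxΓ)

theorem IsParametrix.perturb {z₀ : ℂ} (h : IsParametrix Γ z₀ W π e)
    (hunit : IsUnit (1 + (z - z₀) • W)) :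
    IsParametrix Γ z (W ∘L Ring.inverse (1 + (z - z₀) • W))
      (fun i => π i ∘L Ring.inverse (1 + (z - z₀) • W)) e := by
  set B := Ring.inverse (1 + (z - z₀) • W)
  have hright : ∀ y, B y + (z - z₀) • W (B y) = y := fun y => by
    simpa using congrArg (fun T : Y →L[ℂ] Y => T y) (Ring.mul_inverse_cancel _ hunit)
  have hleft : ∀ y, B (y + (z - z₀) • W y) = y := fun y => by
    simpa using congrArg (fun T : Y →L[ℂ] Y => T y) (Ring.inverse_mul_cancel _ hunit)
  refine ⟨fun y => ?_, fun x f hxf => ?_, h.inj.comp fun y y' hyy' => ?_⟩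
  · have hmem := h.mem (B y)
    rwa [show z₀ • W (B y) - B y = z • W (B y) - y by
      nth_rewrite 4 [← hright y]
      rw [sub_smul]; abel] at hmem
  · obtain ⟨y, rfl⟩ := h.surj x f hxf
    exact ⟨y + (z - z₀) • W y, congrArg W (hleft y)⟩
  · rw [← hright y, ← hright y', show B y = B y' from hyy']

end Parametrix

theorem analyticAt_det [DecidableEq ι] {M : ℂ → Matrix ι ι ℂ} {z₀ : ℂ}
    (hM : ∀ i j, AnalyticAt ℂ (fun z => M z i j) z₀) : AnalyticAt ℂ (fun z => (M z).det) z₀ := by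
  simp only [Matrix.det_apply']
  exact Finset.analyticAt_fun_sum _ fun σ _ =>
    analyticAt_const.mul (Finset.analyticAt_fun_prod _ fun i _ => hM _ _)

theorem analyticAt_adjugate [DecidableEq ι] {M : ℂ → Matrix ι ι ℂ} {z₀ : ℂ}
    (hM : ∀ i j, AnalyticAt ℂ (fun z => M z i j) z₀) (i j : ι) :
    AnalyticAt ℂ (fun z => (M z).adjugate i j) z₀ := by
  simp only [Matrix.adjugate_apply]
  refine analyticAt_det fun k l => ?_
  by_cases hk : k = j
  · subst hk
    simpa using analyticAt_const
  · simpa [Matrix.updateRow_ne hk] using hM k l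

section Local

variable [CompleteSpace Y]

theorem eventually_isUnit_one_add_smul (W : Y →L[ℂ] Y) (z₀ : ℂ) :
    ∀ᶠ z in 𝓝 z₀, IsUnit (1 + (z - z₀) • W) := by
  have hcont : Continuous fun z : ℂ => 1 + (z - z₀) • W := by fun_prop
  exact hcont.tendsto z₀ (Units.isOpen.mem_nhds (by simp))

theorem analyticAt_inverse_one_add_smul (W : Y →L[ℂ] Y) (z₀ : ℂ) :
    AnalyticAt ℂ (fun z => Ring.inverse (1 + (z - z₀) • W)) z₀ := by
  have hW : AnalyticAt ℂ (fun z : ℂ => 1 + (z - z₀) • W) z₀ := by fun_prop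
  refine AnalyticAt.fun_comp (g := Ring.inverse) ?_ hW
  simpa using analyticAt_inverse (𝕜 := ℂ) (1 : (Y →L[ℂ] Y)ˣ)

/-- By the Weinstein–Aronszajn formula the points without a resolvent are locally the zeros of an
analytic determinant. -/
theorem IsParametrix.eventually_notMem_or_isFinitelyMeromorphicAt
    (hΓ : ∀ f, ((0 : Y), f) ∈ Γ → f = 0) {z₀ : ℂ} {n : ℕ} {W : Y →L[ℂ] Y}
    {π : Fin n → Y →L[ℂ] ℂ} {e : Fin n → Y} (h : IsParametrix Γ z₀ W π e) :
    (∀ᶠ z in 𝓝 z₀, z ∉ graphResolventSet Γ) ∨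
      ∃ R, IsFinitelyMeromorphicAt R z₀ ∧ ∀ᶠ z in 𝓝[≠] z₀, IsGraphResolvent Γ z (R z) := by
  set B : ℂ → Y →L[ℂ] Y := fun z => Ring.inverse (1 + (z - z₀) • W)
  have hB : AnalyticAt ℂ B z₀ := analyticAt_inverse_one_add_smul W z₀
  have hpar : ∀ᶠ z in 𝓝 z₀, IsParametrix Γ z (W ∘L B z) (fun i => π i ∘L B z) e :=
    (eventually_isUnit_one_add_smul W z₀).mono fun z hz => h.perturb hz
  have hBe : ∀ y, AnalyticAt ℂ (fun z => B z y) z₀ := fun y =>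
    (ContinuousLinearMap.apply ℂ Y y).analyticAt _ |>.fun_comp hB
  set M : ℂ → Matrix (Fin n) (Fin n) ℂ := fun z => weinsteinAronszajn (fun i => π i ∘L B z) e
  have hM : ∀ i j, AnalyticAt ℂ (fun z => M z i j) z₀ := fun i j =>
    analyticAt_const.sub ((π i).analyticAt _ |>.fun_comp (hBe _))
  have hD : AnalyticAt ℂ (fun z => (M z).det) z₀ := analyticAt_det hM
  by_cases hD0 : ∀ᶠ z in 𝓝 z₀, (M z).det = 0
  · left
    filter_upwards [hD0, hpar] with z hz hpar
    rintro ⟨R, hR⟩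
    obtain ⟨x, hx, hxΓ⟩ := hpar.exists_ne_zero_of_det_eq_zero hz
    exact hx (hR.eq_zero_of_mem hxΓ)
  right
  refine ⟨fun z => W ∘L B z + (M z).det⁻¹ • ∑ i,
    (∑ j, (M z).adjugate i j • (π j ∘L B z)).smulRight (W (B z (e i))), ?_, ?_⟩
  · refine isFinitelyMeromorphicAt_add_inv_smul_sum
      ((ContinuousLinearMap.compL ℂ Y Y Y W).analyticAt _ |>.fun_comp hB) hD hD0
      (fun i => Finset.analyticAt_fun_sum _ fun j _ => (analyticAt_adjugate hM i j).smul ?_)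
      fun i => W.analyticAt _ |>.fun_comp (hBe _)
    exact (ContinuousLinearMap.compL ℂ Y Y ℂ (π j)).analyticAt _ |>.fun_comp hB
  · filter_upwards [nhdsWithin_le_nhds hpar,
      hD.eventually_eq_zero_or_eventually_ne_zero.resolve_left hD0] with z hpar hdet
    exact hpar.isGraphResolvent hΓ hdet

end Local

/-- The set of points near which `S` fills a punctured neighbourhood is open, and so is the set of
points near which `S` is empty. -/
theorem eventually_nhdsNE_mem_of_dichotomy {X : Type*} [TopologicalSpace X]
    [T1Space X] [∀ x : X, (𝓝[≠] x).NeBot] {Ω S : Set X} (hΩ : IsPreconnected Ω)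
    (hdich : ∀ x ∈ Ω, (∀ᶠ y in 𝓝 x, y ∉ S) ∨ ∀ᶠ y in 𝓝[≠] x, y ∈ S)
    (hne : (Ω ∩ S).Nonempty) {x : X} (hx : x ∈ Ω) : ∀ᶠ y in 𝓝[≠] x, y ∈ S := by
  set U : Set X := {x | ∀ᶠ y in 𝓝[≠] x, y ∈ S}
  set V : Set X := {x | ∀ᶠ y in 𝓝 x, y ∉ S}
  have hV : IsOpen V := isOpen_setOfPred_eventually_nhds
  have hU : IsOpen U := by
    refine isOpen_iff_mem_nhds.2 fun x hx => ?_
    have hev := eventually_nhdsWithin_iff.1 (eventually_nhdsNE_eventually_nhds_iff.2 hx)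
    filter_upwards [hev] with y hy
    by_cases hyx : y = x
    · exact hyx ▸ hx
    · exact (hy hyx).filter_mono nhdsWithin_le_nhds
  obtain ⟨x₁, hx₁, hx₁S⟩ := hne
  have hx₁U : x₁ ∈ U := (hdich x₁ hx₁).resolve_left fun h => h.self_of_nhds hx₁S
  refine (hdich x hx).resolve_left fun hxV => ?_
  obtain ⟨y, -, hyU : ∀ᶠ w in 𝓝[≠] y, w ∈ S, hyV : ∀ᶠ w in 𝓝 y, w ∉ S⟩ :=
    hΩ U V hU hV (fun y hy => (hdich y hy).symm) ⟨x₁, hx₁, hx₁U⟩ ⟨x, hx, hxV⟩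
  obtain ⟨w, hwS, hwV⟩ := (hyU.and (hyV.filter_mono nhdsWithin_le_nhds)).exists
  exact hwV hwS

theorem exists_isFinitelyMeromorphicAt_isGraphResolvent [CompleteSpace Y]
    (hΓ : ∀ f, ((0 : Y), f) ∈ Γ → f = 0) {Ω : Set ℂ} (hΩ : IsPreconnected Ω)
    (hpar : ∀ z₀ ∈ Ω, ∃ (n : ℕ) (W : Y →L[ℂ] Y) (π : Fin n → Y →L[ℂ] ℂ) (e : Fin n → Y),
      IsParametrix Γ z₀ W π e)
    (hne : (Ω ∩ graphResolventSet Γ).Nonempty) {z₀ : ℂ} (hz₀ : z₀ ∈ Ω) :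
    ∃ R, IsFinitelyMeromorphicAt R z₀ ∧ ∀ᶠ z in 𝓝[≠] z₀, IsGraphResolvent Γ z (R z) := by
  have hdich : ∀ z₁ ∈ Ω, (∀ᶠ z in 𝓝 z₁, z ∉ graphResolventSet Γ) ∨
      ∃ R, IsFinitelyMeromorphicAt R z₁ ∧ ∀ᶠ z in 𝓝[≠] z₁, IsGraphResolvent Γ z (R z) := by
    intro z₁ hz₁
    obtain ⟨n, W, π, e, h⟩ := hpar z₁ hz₁
    exact h.eventually_notMem_or_isFinitelyMeromorphicAt hΓ
  refine (hdich z₀ hz₀).resolve_left fun hnot => ?_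
  have hmem := eventually_nhdsNE_mem_of_dichotomy hΩ (fun z₁ hz₁ => (hdich z₁ hz₁).imp_right
    fun ⟨R, _, hR⟩ => hR.mono fun z hz => ⟨R z, hz⟩) hne hz₀
  obtain ⟨z, hz, hz'⟩ := (hmem.and (hnot.filter_mono nhdsWithin_le_nhds)).exists
  exact hz' hz

end Graph

section Perturbation

variable {Y : Type*} [NormedAddCommGroup Y] [NormedSpace ℂ Y] {Γ Γ₀ : Submodule ℂ (Y × Y)} {z : ℂ}

theorem exists_isGraphResolvent_of_norm_le {C : ℝ} (hex : ∀ y, ∃ x, (x, z • x - y) ∈ Γ)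
    (hle : ∀ x y, (x, z • x - y) ∈ Γ → ‖x‖ ≤ C * ‖y‖) : ∃ S, IsGraphResolvent Γ z S := by
  choose S hS using hex
  have hsub : ∀ x x' y y', (x, z • x - y) ∈ Γ → (x', z • x' - y') ∈ Γ →
      ‖x - x'‖ ≤ C * ‖y - y'‖ := fun x x' y y' h h' =>
    hle _ _ (by simpa only [Prod.mk_sub_mk, smul_sub, sub_sub_sub_comm] using Γ.sub_mem h h')
  have huniq : ∀ x y, (x, z • x - y) ∈ Γ → S y = x := fun x y h => by
    simpa [sub_eq_zero] using hsub _ _ _ _ (hS y) h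
  let S' : Y →ₗ[ℂ] Y :=
    { toFun := S
      map_add' := fun a b => huniq _ _ (by
        simpa only [Prod.mk_add_mk, smul_add, sub_add_sub_comm] using Γ.add_mem (hS a) (hS b))
      map_smul' := fun t a => huniq _ _ (by
        simpa only [Prod.smul_mk, smul_sub, smul_comm t z, RingHom.id_apply]
          using Γ.smul_mem t (hS a)) }
  exact ⟨S'.mkContinuous C fun y => hle _ _ (hS y), hS, fun x f hxf =>
    huniq _ _ (by rwa [sub_sub_cancel])⟩

/-- If the perturbation `N` of `A₀` is close to the finite rank operator `F` relative to `A₀`, then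
`z - A₀ - N` is inverted up to finite rank by `S (1 - (N - F) S)⁻¹`, where `S = (z - A₀)⁻¹`. -/
theorem IsGraphResolvent.exists_isParametrix [CompleteSpace Y] {ι : Type*} [Fintype ι]
    {S N : Y →L[ℂ] Y} {π : ι → Y →L[ℂ] ℂ} {e : ι → Y} (hS : IsGraphResolvent Γ₀ z S)
    (hΓ₀ : ∀ f, ((0 : Y), f) ∈ Γ₀ → f = 0) (hΓ : ∀ x f, (x, f) ∈ Γ ↔ (x, f - N x) ∈ Γ₀)
    (hlt : ‖(N - ∑ i, (π i).smulRight (e i)) ∘L S‖ < 1) :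
    ∃ W π', IsParametrix Γ z W π' e := by
  set K := (N - ∑ i, (π i).smulRight (e i)) ∘L S with hK
  obtain ⟨L, hKL, hLK⟩ : ∃ L : Y →L[ℂ] Y, (∀ y, L y - K (L y) = y) ∧ ∀ y, L (y - K y) = y := by
    have hu : IsUnit (1 - K) := isUnit_one_sub_of_norm_lt_one hlt
    exact ⟨Ring.inverse (1 - K),
      fun y => congrArg (fun T : Y →L[ℂ] Y => T y) (Ring.mul_inverse_cancel _ hu),
      fun y => congrArg (fun T : Y →L[ℂ] Y => T y) (Ring.inverse_mul_cancel _ hu)⟩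
  refine ⟨S ∘L L, fun i => π i ∘L S ∘L L, fun y => ?_, fun x f hxf => ?_, ?_⟩
  · have hy : z • S (L y) - y + ∑ i, π i (S (L y)) • e i - N (S (L y)) = z • S (L y) - L y := by
      have hKy : K (L y) = N (S (L y)) - ∑ i, π i (S (L y)) • e i := by simp [hK]
      calc _ = z • S (L y) - (y + K (L y)) := by rw [hKy]; abel
        _ = z • S (L y) - L y := by rw [← sub_eq_iff_eq_add.1 (hKL y)]
    exact (hΓ _ _).2 (hy ▸ hS.1 (L y))
  · exact ⟨_, (congrArg S (hLK _)).trans (hS.2 _ _ ((hΓ x f).1 hxf))⟩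
  · refine (injective_iff_map_eq_zero _).2 fun y hy => ?_
    have hmem := hS.1 (L y)
    rw [show S (L y) = 0 from hy, smul_zero, zero_sub] at hmem
    have hLy : L y = 0 := neg_eq_zero.1 (hΓ₀ _ hmem)
    rw [← hKL y, hLy, map_zero, sub_zero]

end Perturbation

section Part

variable {E Y : Type*} [NormedAddCommGroup E] [NormedSpace ℂ E]
  [NormedAddCommGroup Y] [NormedSpace ℂ Y]
  {A : E →ₗ.[ℂ] E} {Γ : Submodule ℂ (Y × Y)} {J : E →L[ℂ] Y} {z : ℂ}

theorem IsResolventAt.unique {R S : E →L[ℂ] E} (hR : IsResolventAt A z R)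
    (hS : IsResolventAt A z S) : R = S := by
  ext x
  obtain ⟨hx, hRx⟩ := hR.1 x
  have := hS.2 ⟨R x, hx⟩
  rwa [hRx, eq_comm] at this

theorem IsResolventAt.resolvent_eq {R : E →L[ℂ] E} (hR : IsResolventAt A z R) :
    resolvent A z = R := by
  have hz : ∃ R : E →L[ℂ] E, IsResolventAt A z R := ⟨R, hR⟩
  rw [resolvent, dif_pos hz]
  exact hz.choose_spec.unique hR

theorem IsResolventAt.comp_one_add {w : ℂ} {R S : E →L[ℂ] E} (hR : IsResolventAt A z R)
    (hS : IsResolventAt A w S) : R ∘L (1 + (z - w) • S) = S := by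
  ext x
  obtain ⟨hx, hSx⟩ := hS.1 x
  have hRS := hR.2 ⟨S x, hx⟩
  rw [show z • S x - A ⟨S x, hx⟩ = x + (z - w) • S x by
    nth_rewrite 3 [← hSx]
    rw [sub_smul]; abel] at hRS
  exact hRS

theorem continuousOn_resolvent [CompleteSpace E] (A : E →ₗ.[ℂ] E) :
    ContinuousOn (resolvent A) (resolventSet A) := by
  rintro w ⟨S, hS⟩
  have hcont : ContinuousAt (fun z => S * Ring.inverse (1 + (z - w) • S)) w :=
    continuousAt_const.mul (analyticAt_inverse_one_add_smul S w).continuousAt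
  refine hcont.continuousWithinAt.congr_of_eventuallyEq_of_mem ?_ ⟨S, hS⟩
  filter_upwards [nhdsWithin_le_nhds (eventually_isUnit_one_add_smul S w), self_mem_nhdsWithin]
    with z hunit ⟨R, hR⟩
  rw [hR.resolvent_eq]
  calc R = R * (1 + (z - w) • S) * Ring.inverse (1 + (z - w) • S) :=
        (Ring.mul_inverse_cancel_right _ R hunit).symm
    _ = S * Ring.inverse (1 + (z - w) • S) :=
        congrArg (· * Ring.inverse (1 + (z - w) • S)) (hR.comp_one_add hS)

/-- `A` is the part in `E` of the operator in `Y` with graph `Γ`, where `J` embeds `E` into `Y`,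
and `E` contains the domain of that operator. -/
structure IsPartOf (A : E →ₗ.[ℂ] E) (Γ : Submodule ℂ (Y × Y)) (J : E →L[ℂ] Y) : Prop where
  inj : Function.Injective J
  mem_graph : ∀ x f, (x, f) ∈ A.graph ↔ (J x, J f) ∈ Γ
  exists_eq : ∀ x f, (x, f) ∈ Γ → ∃ e, J e = x

/-- The resolvent of the part is bounded by the closed graph theorem. -/
theorem IsPartOf.exists_isResolventAt [CompleteSpace E] (h : IsPartOf A Γ J) {R : Y →L[ℂ] Y}
    (hR : IsGraphResolvent Γ z R) :
    ∃ S : E →L[ℂ] E, IsResolventAt A z S ∧ J ∘L S = R ∘L J := by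
  choose S hS using fun e : E => h.exists_eq _ _ (hR.1 (J e))
  let S' : E →ₗ[ℂ] E :=
    { toFun := S
      map_add' := fun a b => h.inj (by simp [hS])
      map_smul' := fun a b => h.inj (by simp [hS]) }
  have hclosed : IsClosed (S'.graph : Set (E × E)) := by
    have hgraph : (S'.graph : Set (E × E)) = {x | J x.2 = R (J x.1)} := by
      ext x
      rw [SetLike.mem_coe, LinearMap.mem_graph_iff, Set.mem_ofPred_eq, ← hS, h.inj.eq_iff]
      rfl
    rw [hgraph]
    exact isClosed_eq (by fun_prop) (by fun_prop)
  refine ⟨.ofIsClosedGraph hclosed, ⟨fun e => ?_, fun x => h.inj ?_⟩, ContinuousLinearMap.ext hS⟩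
  · have hgraph : (S e, z • S e - e) ∈ A.graph := by
      rw [h.mem_graph, map_sub, map_smul, hS]
      exact hR.1 (J e)
    obtain ⟨⟨_, hdom⟩, rfl, hA⟩ := (LinearPMap.mem_graph_iff A).1 hgraph
    exact ⟨hdom, (congrArg (z • S e - ·) hA).trans (sub_sub_cancel _ _)⟩
  · change J (S _) = _
    rw [hS, map_sub, map_smul]
    exact hR.2 _ _ ((h.mem_graph _ _).1 (A.mem_graph x))

theorem IsPartOf.exists_eigenvector (h : IsPartOf A Γ J) {x : Y} (hx : x ≠ 0)
    (hxΓ : (x, z • x) ∈ Γ) : ∃ e : A.domain, (e : E) ≠ 0 ∧ A e = z • (e : E) := by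
  obtain ⟨e, rfl⟩ := h.exists_eq _ _ hxΓ
  rw [← map_smul, ← h.mem_graph, LinearPMap.mem_graph_iff] at hxΓ
  obtain ⟨y, rfl, hy⟩ := hxΓ
  exact ⟨y, fun h0 => hx (by simp [h0]), hy⟩

theorem IsPartOf.isDiscreteEigenvalue [CompleteSpace E] [CompleteSpace Y] (h : IsPartOf A Γ J)
    {z₀ : ℂ} {x : Y} (hx : x ≠ 0) (hxΓ : (x, z₀ • x) ∈ Γ) {R : ℂ → Y →L[ℂ] Y}
    (hmer : IsFinitelyMeromorphicAt R z₀) (hR : ∀ᶠ z in 𝓝[≠] z₀, IsGraphResolvent Γ z (R z)) :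
    IsDiscreteEigenvalue A z₀ := by
  obtain ⟨ε, hε, hball⟩ := Metric.eventually_nhds_iff_ball.1 (eventually_nhdsWithin_iff.1 hR)
  obtain ⟨r, ⟨hRc, hfin⟩, hr, hrε⟩ := (hmer.eventually_circleIntegral_mem_finiteRank.and
    (Ioo_mem_nhdsGT hε)).exists
  have hres : ∀ z, z ≠ z₀ → dist z z₀ ≤ r →
      z ∈ resolventSet A ∧ J ∘L resolvent A z = R z ∘L J := by
    intro z hz hzr
    obtain ⟨S, hS, hSJ⟩ := h.exists_isResolventAt (hball z (hzr.trans_lt hrε) hz)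
    exact ⟨⟨S, hS⟩, by rw [hS.resolvent_eq, hSJ]⟩
  have hsphere : ∀ z ∈ Metric.sphere z₀ r,
      z ∈ resolventSet A ∧ J ∘L resolvent A z = R z ∘L J :=
    fun z hz => hres z (Metric.ne_of_mem_sphere hz hr.ne') (Metric.mem_sphere.1 hz).le
  have hint : CircleIntegrable (resolvent A) z₀ r := ((continuousOn_resolvent A).mono
    fun z hz => (hsphere z hz).1).circleIntegrable hr.le
  have hcomp : J ∘L (∮ z in C(z₀, r), resolvent A z) = (∮ z in C(z₀, r), R z) ∘L J := by
    have hleft := circleIntegral_comp_comm (ContinuousLinearMap.compL ℂ E E Y J) hint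
    have hright := circleIntegral_comp_comm ((ContinuousLinearMap.compL ℂ E Y Y).flip J)
      (hRc.circleIntegrable hr.le)
    simp only [ContinuousLinearMap.flip_apply, ContinuousLinearMap.compL_apply] at hleft hright
    rw [← hleft, ← hright]
    exact circleIntegral.integral_congr hr.le fun z hz => (hsphere z hz).2
  have hfin' : (∮ z in C(z₀, r), resolvent A z) ∈ finiteRank E E :=
    mem_finiteRank_of_comp_eq (I := J.toLinearMap) (J := J.toLinearMap) h.inj
      (T := ∮ z in C(z₀, r), R z) (DFunLike.congr_fun hcomp) hfin
  exact ⟨h.exists_eigenvector hx hxΓ, r, hr, fun z hz hzr => (hres z hz hzr).1,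
    mem_finiteRank.1 (Submodule.smul_mem _ _ hfin')⟩

theorem IsPartOf.notMem_essentialSpectrum [CompleteSpace E] [CompleteSpace Y] (h : IsPartOf A Γ J)
    (hΓ : ∀ f, ((0 : Y), f) ∈ Γ → f = 0) {Ω : Set ℂ} (hΩ : IsPreconnected Ω)
    (hpar : ∀ z₀ ∈ Ω, ∃ (n : ℕ) (W : Y →L[ℂ] Y) (π : Fin n → Y →L[ℂ] ℂ) (e : Fin n → Y),
      IsParametrix Γ z₀ W π e)
    (hne : ∃ z ∈ Ω, ∀ x, (x, z • x) ∈ Γ → x = 0) {z₀ : ℂ} (hz₀ : z₀ ∈ Ω) :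
    z₀ ∉ essentialSpectrum A := by
  rintro ⟨hspec, hdisc⟩
  have hres : ∀ z ∈ Ω, (∀ x, (x, z • x) ∈ Γ → x = 0) → z ∈ graphResolventSet Γ := by
    intro z hz hker
    obtain ⟨n, W, π, e, hP⟩ := hpar z hz
    exact hP.mem_graphResolventSet hΓ hker
  by_cases hker : ∀ x, (x, z₀ • x) ∈ Γ → x = 0
  · obtain ⟨R, hR⟩ := hres z₀ hz₀ hker
    obtain ⟨S, hS, -⟩ := h.exists_isResolventAt hR
    exact hspec ⟨S, hS⟩
  · push Not at hker
    obtain ⟨x, hxΓ, hx⟩ := hker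
    obtain ⟨z₁, hz₁, hker₁⟩ := hne
    obtain ⟨R, hmer, hR⟩ := exists_isFinitelyMeromorphicAt_isGraphResolvent hΓ hΩ hpar
      ⟨z₁, hz₁, hres z₁ hz₁ hker₁⟩ hz₀
    exact hdisc (h.isDiscreteEigenvalue hx hxΓ hmer hR)

end Part

section Primitive

theorem intervalIntegrable_of_locallyIntegrable {E : Type*} [NormedAddCommGroup E] {f : ℝ → E}
    (hf : LocallyIntegrable f volume) (a b : ℝ) :
    IntervalIntegrable f volume a b :=
  intervalIntegrable_iff.mpr <|
    (hf.integrableOn_isCompact isCompact_uIcc).mono_set Set.uIoc_subset_uIcc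

section Banach

variable {E : Type*} [NormedAddCommGroup E] [NormedSpace ℝ E] {u v f g : ℝ → E}

/-- `u` is a primitive of the locally integrable function `f`; in contrast to `LocAC`, the
derivative is an arbitrary representative of its class. -/
def IsPrimitive (u f : ℝ → E) : Prop :=
  LocallyIntegrable f volume ∧ ∀ a b : ℝ, ∫ x in a..b, f x = u b - u a

theorem isPrimitive_intervalIntegral (hf : LocallyIntegrable f volume) (x₀ : ℝ) :
    IsPrimitive (fun x => ∫ t in x₀..x, f t) f :=
  ⟨hf, fun a b => (intervalIntegral.integral_interval_sub_left
    (intervalIntegrable_of_locallyIntegrable hf x₀ b)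
    (intervalIntegrable_of_locallyIntegrable hf x₀ a)).symm⟩

theorem isPrimitive_zero : IsPrimitive (fun _ => (0 : E)) (fun _ => 0) :=
  ⟨locallyIntegrable_zero, fun a b => by simp⟩

namespace IsPrimitive

theorem intervalIntegrable (hu : IsPrimitive u f) (a b : ℝ) : IntervalIntegrable f volume a b :=
  intervalIntegrable_of_locallyIntegrable hu.1 a b

theorem eq_integral_add (hu : IsPrimitive u f) (a : ℝ) :
    u = fun x => (∫ t in a..x, f t) + u a := by
  funext x
  rw [hu.2, sub_add_cancel]

theorem continuous (hu : IsPrimitive u f) : Continuous u := by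
  rw [hu.eq_integral_add 0]
  exact (intervalIntegral.continuous_primitive hu.intervalIntegrable 0).add continuous_const

theorem congr (hu : IsPrimitive u f) (hfg : f =ᵐ[volume] g) : IsPrimitive u g :=
  ⟨hu.1.congr hfg, fun a b => by
    rw [← hu.2 a b]
    exact intervalIntegral.integral_congr_ae (hfg.mono fun x hx _ => hx.symm)⟩

theorem add (hu : IsPrimitive u f) (hv : IsPrimitive v g) :
    IsPrimitive (fun x => u x + v x) (fun x => f x + g x) :=
  ⟨hu.1.add hv.1, fun a b => by
    rw [intervalIntegral.integral_add (hu.intervalIntegrable a b) (hv.intervalIntegrable a b),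
      hu.2, hv.2, add_sub_add_comm]⟩

theorem sub (hu : IsPrimitive u f) (hv : IsPrimitive v g) :
    IsPrimitive (fun x => u x - v x) (fun x => f x - g x) :=
  ⟨hu.1.sub hv.1, fun a b => by
    rw [intervalIntegral.integral_sub (hu.intervalIntegrable a b) (hv.intervalIntegrable a b),
      hu.2, hv.2, sub_sub_sub_comm]⟩

theorem comp_neg (hu : IsPrimitive u f) : IsPrimitive (fun x => u (-x)) (fun x => -f (-x)) := by
  refine ⟨?_, fun a b => ?_⟩
  · refine LocallyIntegrable.neg
      ((locallyIntegrable_map_homeomorph (Homeomorph.neg ℝ) (f := f) (μ := volume)).1 ?_)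
    rw [show Measure.map (Homeomorph.neg ℝ) (volume : Measure ℝ) = volume from
      Measure.map_neg_eq_self volume]
    exact hu.1
  · rw [intervalIntegral.integral_neg, intervalIntegral.integral_comp_neg, hu.2]
    abel

theorem const_of_ae_eq_zero (hu : IsPrimitive u f) (hf : f =ᵐ[volume] 0) (x y : ℝ) :
    u x = u y := by
  have h := (hu.congr hf).2 y x
  simp only [Pi.zero_apply, intervalIntegral.integral_zero] at h
  exact sub_eq_zero.1 h.symm

variable [CompleteSpace E]

theorem ae_hasDerivAt (hu : IsPrimitive u f) : ∀ᵐ x, HasDerivAt u (f x) x := by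
  filter_upwards [_root_.LocallyIntegrable.ae_hasDerivAt_integral hu.1] with x hx
  rw [hu.eq_integral_add 0]
  exact (hx 0).add_const (u 0)

theorem hasDerivAt (hu : IsPrimitive u f) (hf : Continuous f) (x : ℝ) : HasDerivAt u (f x) x := by
  rw [hu.eq_integral_add 0]
  exact (intervalIntegral.integral_hasDerivAt_right (hf.intervalIntegrable 0 x)
    (hf.stronglyMeasurableAtFilter _ _) hf.continuousAt).add_const (u 0)

theorem deriv_ae_eq (hu : IsPrimitive u f) : deriv u =ᵐ[volume] f :=
  hu.ae_hasDerivAt.mono fun _ hx => hx.deriv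

theorem ae_eq (hu : IsPrimitive u f) (hv : IsPrimitive u g) : f =ᵐ[volume] g :=
  hu.deriv_ae_eq.symm.trans hv.deriv_ae_eq

end IsPrimitive

theorem isPrimitive_of_hasDerivAt [CompleteSpace E] (h : ∀ x, HasDerivAt u (f x) x)
    (hf : Continuous f) : IsPrimitive u f :=
  ⟨hf.locallyIntegrable, fun a b =>
    intervalIntegral.integral_eq_sub_of_hasDerivAt (fun x _ => h x) (hf.intervalIntegrable a b)⟩

end Banach

variable {u v f g : ℝ → ℂ}

theorem LocAC.isPrimitive (hu : LocAC u) : IsPrimitive u (deriv u) := hu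

namespace IsPrimitive

theorem locAC (hu : IsPrimitive u f) : LocAC u :=
  hu.congr hu.deriv_ae_eq.symm

theorem const_mul (k : ℂ) (hu : IsPrimitive u f) :
    IsPrimitive (fun x => k * u x) (fun x => k * f x) :=
  ⟨hu.1.smul k, fun a b => by
    rw [intervalIntegral.integral_const_mul, hu.2, mul_sub]⟩

theorem absolutelyContinuousOnInterval (hu : IsPrimitive u f) (a b : ℝ) :
    AbsolutelyContinuousOnInterval u a b := by
  have hf := hu.intervalIntegrable a
  have hconst : ∀ k : ℂ, AbsolutelyContinuousOnInterval (fun _ : ℝ => k) a b := fun k =>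
    (contDiff_const.contDiffOn).absolutelyContinuousOnInterval
  have hre : IntervalIntegrable (fun x => (f x).re) volume a b := ⟨(hf b).1.re, (hf b).2.re⟩
  have him : IntervalIntegrable (fun x => (f x).im) volume a b := ⟨(hf b).1.im, (hf b).2.im⟩
  have hsplit : u = fun x => u a + (∫ t in a..x, (f t).re) • (1 : ℂ) +
      (∫ t in a..x, (f t).im) • Complex.I := by
    funext x
    have hint_re : ∫ t in a..x, (f t).re = (u x - u a).re := by
      rw [← hu.2]; exact intervalIntegral.intervalIntegral_re (hf x)
    have hint_im : ∫ t in a..x, (f t).im = (u x - u a).im := by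
      rw [← hu.2]; exact intervalIntegral.intervalIntegral_im (hf x)
    rw [hint_re, hint_im]
    apply Complex.ext <;> simp
  rw [hsplit]
  exact ((hconst (u a)).fun_add ((hre.absolutelyContinuousOnInterval_intervalIntegral
    Set.left_mem_uIcc).fun_smul (hconst 1))).fun_add
    ((him.absolutelyContinuousOnInterval_intervalIntegral Set.left_mem_uIcc).fun_smul
      (hconst Complex.I))

end IsPrimitive

theorem isPrimitive_of_absolutelyContinuousOnInterval
    (hu : ∀ a b, AbsolutelyContinuousOnInterval u a b) (hf : LocallyIntegrable f volume)
    (huf : ∀ᵐ x, HasDerivAt u (f x) x) : IsPrimitive u f := by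
  refine ⟨hf, fun a b => ?_⟩
  have hint := isPrimitive_intervalIntegral hf a
  obtain ⟨C, hC⟩ := ((hu a b).fun_sub
    (hint.absolutelyContinuousOnInterval a b)).const_of_ae_hasDerivAt_zero (by
      filter_upwards [huf, hint.ae_hasDerivAt] with x hux hx _
      simpa using hux.fun_sub hx)
  have ha := hC a Set.left_mem_uIcc
  have hb := hC b Set.right_mem_uIcc
  rw [intervalIntegral.integral_same] at ha
  linear_combination ha - hb

theorem IsPrimitive.mul (hu : IsPrimitive u f) (hv : IsPrimitive v g) :
    IsPrimitive (fun x => u x * v x) (fun x => f x * v x + u x * g x) := by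
  refine isPrimitive_of_absolutelyContinuousOnInterval
    (fun a b => (hu.absolutelyContinuousOnInterval a b).fun_smul
      (hv.absolutelyContinuousOnInterval a b)) ?_ ?_
  · exact (hu.1.smul_continuous hv.continuous).add (hv.1.continuous_smul hu.continuous)
  · filter_upwards [hu.ae_hasDerivAt, hv.ae_hasDerivAt] with x hux hvx using hux.fun_mul hvx

end Primitive

section Translates

open ENNReal

variable {G : Type*} [AddGroup G] [MeasurableSpace G] [MeasurableAdd₂ G] {ν μ : Measure G}
  [SFinite ν] [ν.IsAddRightInvariant]

theorem quasiMeasurePreserving_add_of_isAddRightInvariant [SFinite μ] :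
    Measure.QuasiMeasurePreserving (fun z : G × G => z.1 + z.2) (ν.prod μ) ν :=
  QuasiMeasurePreserving.prod_of_left measurable_add
    (ae_of_all μ fun s => (measurePreserving_add_right ν s).quasiMeasurePreserving)

theorem lintegral_lintegral_add_right [SFinite μ] {f : G → ℝ≥0∞} (hf : AEMeasurable f ν) :
    ∫⁻ x, ∫⁻ s, f (x + s) ∂μ ∂ν = μ Set.univ * ∫⁻ x, f x ∂ν := by
  rw [lintegral_lintegral_swap (f := fun x s => f (x + s))
    (hf.comp_quasiMeasurePreserving quasiMeasurePreserving_add_of_isAddRightInvariant)]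
  simp only [lintegral_add_right_eq_self f, lintegral_const, mul_comm]

theorem lintegral_rpow_le_measure_univ_mul {α : Type*} [MeasurableSpace α] {μ : Measure α}
    [IsFiniteMeasure μ] {f : α → ℝ≥0∞} (hf : AEMeasurable f μ) {r : ℝ} (hr : 1 ≤ r) :
    (∫⁻ s, f s ∂μ) ^ r ≤ μ Set.univ ^ (r - 1) * ∫⁻ s, f s ^ r ∂μ := by
  have hr0 : 0 < r := by linarith
  have h := eLpNorm'_le_eLpNorm'_mul_rpow_measure_univ one_pos hr hf.aestronglyMeasurable
  simp only [eLpNorm', enorm_eq_self, ENNReal.rpow_one, div_one] at h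
  calc (∫⁻ s, f s ∂μ) ^ r
      ≤ ((∫⁻ s, f s ^ r ∂μ) ^ (1 / r) * μ Set.univ ^ (1 - 1 / r)) ^ r :=
        ENNReal.rpow_le_rpow h hr0.le
    _ = μ Set.univ ^ (r - 1) * ∫⁻ s, f s ^ r ∂μ := by
        rw [ENNReal.mul_rpow_of_nonneg _ _ hr0.le, ← ENNReal.rpow_mul, ← ENNReal.rpow_mul,
          one_div_mul_cancel hr0.ne', ENNReal.rpow_one, mul_comm, sub_mul,
          one_div_mul_cancel hr0.ne', one_mul]

/-- Minkowski's inequality for averages of translates. -/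
theorem eLpNorm_lintegral_translate_le [IsFiniteMeasure μ] {p : ℝ≥0∞} (hp : 1 ≤ p)
    {f : G → ℝ≥0∞} (hf : AEMeasurable f ν) :
    eLpNorm (fun x => ∫⁻ s, f (x + s) ∂μ) p ν ≤ μ Set.univ * eLpNorm f p ν := by
  have hadd := quasiMeasurePreserving_add_of_isAddRightInvariant (ν := ν) (μ := μ)
  rcases eq_or_ne p ∞ with rfl | hp_top
  · rw [eLpNorm_exponent_top, eLpNorm_exponent_top]
    refine eLpNormEssSup_le_of_ae_enorm_bound ?_
    filter_upwards [Measure.ae_ae_of_ae_prod (hadd.ae (ae_le_eLpNormEssSup (f := f)))] with x hx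
    calc ∫⁻ s, f (x + s) ∂μ ≤ ∫⁻ _, eLpNormEssSup f ν ∂μ := lintegral_mono_ae hx
      _ = μ Set.univ * eLpNormEssSup f ν := by rw [lintegral_const, mul_comm]
  have hp0 : p ≠ 0 := (zero_lt_one.trans_le hp).ne'
  have hr : 1 ≤ p.toReal := by simpa using ENNReal.toReal_mono hp_top hp
  have hr0 : 0 < p.toReal := by linarith
  simp only [eLpNorm_eq_lintegral_rpow_enorm_toReal hp0 hp_top, enorm_eq_self]
  rw [← ENNReal.rpow_le_rpow_iff hr0, ENNReal.mul_rpow_of_nonneg _ _ hr0.le,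
    ← ENNReal.rpow_mul, ← ENNReal.rpow_mul, one_div_mul_cancel hr0.ne', ENNReal.rpow_one,
    ENNReal.rpow_one]
  have hfib : ∀ᵐ x ∂ν, AEMeasurable (fun s => f (x + s)) μ :=
    (hf.comp_quasiMeasurePreserving hadd).aestronglyMeasurable.prodMk_left.mono
      fun _ hx => hx.aemeasurable
  calc ∫⁻ x, (∫⁻ s, f (x + s) ∂μ) ^ p.toReal ∂ν
      ≤ ∫⁻ x, μ Set.univ ^ (p.toReal - 1) * ∫⁻ s, f (x + s) ^ p.toReal ∂μ ∂ν :=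
        lintegral_mono_ae (hfib.mono fun x hx => lintegral_rpow_le_measure_univ_mul hx hr)
    _ = μ Set.univ ^ (p.toReal - 1) * (μ Set.univ * ∫⁻ x, f x ^ p.toReal ∂ν) := by
        rw [lintegral_const_mul' _ _ (ENNReal.rpow_ne_top_of_nonneg (by linarith)
          (measure_ne_top μ _)), lintegral_lintegral_add_right (hf.pow_const _)]
    _ = μ Set.univ ^ p.toReal * ∫⁻ x, f x ^ p.toReal ∂ν := by
        have hpow := ENNReal.rpow_add_of_nonneg (x := μ Set.univ) (p.toReal - 1) 1 (by linarith)
          zero_le_one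
        rw [sub_add_cancel, ENNReal.rpow_one] at hpow
        rw [hpow, mul_assoc]

end Translates

section FirstOrder

open ENNReal

/-- The measure `e^{-κ s} ds` on `(0, ∞)`: solutions of `v' = κ v - g` with `0 < Re κ` are dominated
by averages of translates of `|g|` against it. -/
def expDecay (κ : ℝ) : Measure ℝ :=
  (volume.restrict (Set.Ioi 0)).withDensity fun s => ENNReal.ofReal (Real.exp (-κ * s))

theorem expDecay_univ {κ : ℝ} (hκ : 0 < κ) : expDecay κ Set.univ = ENNReal.ofReal κ⁻¹ := by
  rw [expDecay, withDensity_apply _ MeasurableSet.univ, Measure.restrict_univ,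
    ← ofReal_integral_eq_lintegral_ofReal (integrableOn_exp_mul_Ioi (by linarith) 0)
      (Eventually.of_forall fun t => (Real.exp_pos _).le), integral_exp_mul_Ioi (by linarith)]
  simp [neg_div_neg_eq]

theorem isFiniteMeasure_expDecay {κ : ℝ} (hκ : 0 < κ) : IsFiniteMeasure (expDecay κ) :=
  ⟨by rw [expDecay_univ hκ]; exact ofReal_lt_top⟩

theorem expDecay_le_volume {κ : ℝ} (hκ : 0 ≤ κ) : expDecay κ ≤ volume := by
  refine (withDensity_mono ?_).trans
    (withDensity_one (μ := volume.restrict (Set.Ioi (0 : ℝ))) ▸ Measure.restrict_le_self)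
  filter_upwards [ae_restrict_mem measurableSet_Ioi] with s hs
  rw [Pi.one_apply, ENNReal.ofReal_le_one, Real.exp_le_one_iff, neg_mul, neg_nonpos]
  exact mul_nonneg hκ (Set.mem_Ioi.1 hs).le

theorem exists_primitive_of_le_re {κ : ℝ → ℂ} (hκ : Continuous κ) {κ₀ : ℝ}
    (hre : ∀ x, κ₀ ≤ (κ x).re) :
    ∃ θ : ℝ → ℂ, (∀ x, HasDerivAt θ (κ x) x) ∧
      ∀ x s, x ≤ s → κ₀ * (s - x) ≤ (θ s - θ x).re := by
  refine ⟨fun x => ∫ t in (0 : ℝ)..x, κ t, fun x =>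
    intervalIntegral.integral_hasDerivAt_right (hκ.intervalIntegrable 0 x)
      (hκ.stronglyMeasurableAtFilter _ _) hκ.continuousAt, fun x s hxs => ?_⟩
  have hre_int : ∫ t in x..s, (κ t).re = (∫ t in x..s, κ t).re :=
    intervalIntegral.intervalIntegral_re (hκ.intervalIntegrable x s)
  have hmono : ∫ _ in x..s, κ₀ ≤ ∫ t in x..s, (κ t).re :=
    intervalIntegral.integral_mono_on hxs (by simp)
      ((Complex.continuous_re.comp hκ).intervalIntegrable x s) fun t _ => hre t
  rw [intervalIntegral.integral_interval_sub_left (hκ.intervalIntegrable 0 s)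
    (hκ.intervalIntegrable 0 x), ← hre_int]
  simpa [mul_comm] using hmono

theorem isPrimitive_integral_Ioi {E : Type*} [NormedAddCommGroup E] [NormedSpace ℝ E] {f : ℝ → E}
    (hf : ∀ x, IntegrableOn f (Set.Ioi x)) :
    IsPrimitive (fun x => ∫ s in Set.Ioi x, f s) (fun s => -f s) :=
  ⟨LocallyIntegrable.neg fun x => ⟨Set.Ioi (x - 1), Ioi_mem_nhds (by linarith), hf (x - 1)⟩,
    fun a b => by
      rw [intervalIntegral.integral_neg, ← intervalIntegral.integral_Ioi_sub_Ioi' (hf a) (hf b),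
        neg_sub]⟩

variable {p : ℝ≥0∞} {κ₀ : ℝ} {g : ℝ → ℂ}

theorem integrable_translate_expDecay (hp : 1 ≤ p) (hκ₀ : 0 < κ₀) (hg : MemLp g p) (x : ℝ) :
    Integrable (fun s => g (x + s)) (expDecay κ₀) := by
  have := isFiniteMeasure_expDecay hκ₀
  exact ((hg.comp_measurePreserving (measurePreserving_add_left volume x)).mono_measure
    (expDecay_le_volume hκ₀.le)).integrable hp

theorem eLpNorm_le_of_enorm_le_translate (hp : 1 ≤ p) (hκ₀ : 0 < κ₀)
    (hg : AEStronglyMeasurable g) {v : ℝ → ℂ}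
    (hv : ∀ x, ‖v x‖ₑ ≤ ∫⁻ s, ‖g (x + s)‖ₑ ∂expDecay κ₀) :
    eLpNorm v p ≤ ENNReal.ofReal κ₀⁻¹ * eLpNorm g p := by
  have := isFiniteMeasure_expDecay hκ₀
  rw [← expDecay_univ hκ₀, ← eLpNorm_enorm g]
  exact (eLpNorm_mono_enorm hv).trans (eLpNorm_lintegral_translate_le hp hg.enorm)

theorem lintegral_exp_sub_mul_le {θ : ℝ → ℂ} (hθ : ∀ x s, x ≤ s → κ₀ * (s - x) ≤ (θ s - θ x).re)
    (hg : AEStronglyMeasurable g) (x : ℝ) :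
    ∫⁻ s in Set.Ioi x, ‖Complex.exp (θ x - θ s) * g s‖ₑ ≤
      ∫⁻ s, ‖g (x + s)‖ₑ ∂expDecay κ₀ := by
  have hg_translate : AEMeasurable (fun s => ‖g (x + s)‖ₑ) :=
    (hg.comp_measurePreserving (measurePreserving_add_left volume x)).enorm
  rw [expDecay, lintegral_withDensity_eq_lintegral_mul₀ (by fun_prop) hg_translate.restrict,
    ← (measurePreserving_add_left volume x).setLIntegral_comp_preimage_emb
      (measurableEmbedding_addLeft x), Set.preimage_const_add_Ioi, sub_self]
  refine setLIntegral_mono' measurableSet_Ioi fun s hs => ?_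
  rw [Pi.mul_apply, enorm_mul, ← ofReal_norm, Complex.norm_exp]
  gcongr
  have := hθ x (x + s) (by linarith [Set.mem_Ioi.1 hs])
  simp only [Complex.sub_re, add_sub_cancel_left] at this ⊢
  linarith

/-- The solution is `v x = ∫_x^∞ e^{θ x - θ s} g s ds` with `θ' = κ`. -/
theorem exists_solution_growing (hp : 1 ≤ p) {κ : ℝ → ℂ} (hκ : Continuous κ) (hκ₀ : 0 < κ₀)
    (hre : ∀ x, κ₀ ≤ (κ x).re) (hg : MemLp g p) :
    ∃ v : ℝ → ℂ, IsPrimitive v (fun x => κ x * v x - g x) ∧ MemLp v p ∧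
      eLpNorm v p ≤ ENNReal.ofReal κ₀⁻¹ * eLpNorm g p := by
  obtain ⟨θ, hθ, hθre⟩ := exists_primitive_of_le_re hκ hre
  have hθc : Continuous θ := continuous_iff_continuousAt.2 fun x => (hθ x).continuousAt
  have hmul : ∀ x s, Complex.exp (θ x - θ s) * g s =
      Complex.exp (θ x) * (Complex.exp (-θ s) * g s) := fun x s => by
    rw [sub_eq_add_neg, Complex.exp_add, mul_assoc]
  have hint : ∀ x, IntegrableOn (fun s => Complex.exp (θ x - θ s) * g s) (Set.Ioi x) := fun x =>
    ⟨((by fun_prop : Continuous fun s => Complex.exp (θ x - θ s)).aestronglyMeasurable.mul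
      hg.1).restrict, (lintegral_exp_sub_mul_le hθre hg.1 x).trans_lt
      (integrable_translate_expDecay hp hκ₀ hg x).2⟩
  have hint_exp_neg : ∀ x, IntegrableOn (fun s => Complex.exp (-θ s) * g s) (Set.Ioi x) :=
    fun x => ((hint x).const_mul (Complex.exp (θ x))⁻¹).congr
      (Eventually.of_forall fun s => by simp [hmul])
  have hprim := (isPrimitive_of_hasDerivAt (fun x => (hθ x).cexp) (by fun_prop)).mul
    (isPrimitive_integral_Ioi hint_exp_neg)
  have hnorm : eLpNorm (fun x => Complex.exp (θ x) * ∫ s in Set.Ioi x, Complex.exp (-θ s) * g s) p ≤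
      ENNReal.ofReal κ₀⁻¹ * eLpNorm g p := by
    refine eLpNorm_le_of_enorm_le_translate hp hκ₀ hg.1 fun x => ?_
    simp only [← integral_const_mul, ← hmul]
    exact (enorm_integral_le_lintegral_enorm _).trans (lintegral_exp_sub_mul_le hθre hg.1 x)
  refine ⟨_, ?_, ⟨hprim.continuous.aestronglyMeasurable,
    hnorm.trans_lt (ENNReal.mul_lt_top ofReal_lt_top hg.2)⟩, hnorm⟩
  convert hprim using 2 with x
  have hexp : Complex.exp (θ x) * Complex.exp (-θ x) = 1 := by
    rw [← Complex.exp_add, add_neg_cancel, Complex.exp_zero]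
  linear_combination g x * hexp

theorem norm_le_exp_mul_of_growing {κ : ℝ → ℂ} (hκ : Continuous κ) (hre : ∀ x, κ₀ ≤ (κ x).re)
    {v : ℝ → ℂ} (hv : IsPrimitive v fun x => κ x * v x) {s : ℝ} (hs : 0 ≤ s) (x : ℝ) :
    ‖v x‖ ≤ Real.exp (-κ₀ * s) * ‖v (x + s)‖ := by
  obtain ⟨θ, hθ, hθre⟩ := exists_primitive_of_le_re hκ hre
  have hθc : Continuous θ := continuous_iff_continuousAt.2 fun x => (hθ x).continuousAt
  have hconst := ((isPrimitive_of_hasDerivAt (fun x => (hθ x).neg.cexp) (by fun_prop)).mul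
    hv).const_of_ae_eq_zero (Eventually.of_forall fun x => by simp; ring) x (x + s)
  simp only [Pi.neg_apply] at hconst
  have hv_eq : v x = Complex.exp (θ x - θ (x + s)) * v (x + s) := by
    rw [sub_eq_add_neg, Complex.exp_add, mul_assoc, ← hconst, ← mul_assoc, ← Complex.exp_add,
      add_neg_cancel, Complex.exp_zero, one_mul]
  rw [hv_eq, norm_mul, Complex.norm_exp]
  gcongr
  have := hθre x (x + s) (by linarith)
  simp only [Complex.sub_re, add_sub_cancel_left] at this ⊢
  linarith

/-- By translation invariance, `‖v x‖ ≤ e^{-κ₀} ‖v (x + 1)‖` gives `‖v‖ₚ ≤ e^{-κ₀} ‖v‖ₚ`. -/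
theorem eq_zero_of_growing (hp : 1 ≤ p) {κ : ℝ → ℂ} (hκ : Continuous κ) (hκ₀ : 0 < κ₀)
    (hre : ∀ x, κ₀ ≤ (κ x).re) {v : ℝ → ℂ} (hv : IsPrimitive v fun x => κ x * v x)
    (hvp : MemLp v p) : v = 0 := by
  have hle : eLpNorm v p ≤ ENNReal.ofReal (Real.exp (-κ₀)) * eLpNorm v p := by
    refine (eLpNorm_le_mul_eLpNorm_of_ae_le_mul (c := Real.exp (-κ₀)) (g := fun x => v (x + 1))
      (Eventually.of_forall fun x => ?_) p).trans_eq ?_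
    · simpa using norm_le_exp_mul_of_growing hκ hre hv zero_le_one x
    · rw [← eLpNorm_comp_measurePreserving hvp.1 (measurePreserving_add_right volume 1)]
      rfl
  have hlt : ENNReal.ofReal (Real.exp (-κ₀)) < 1 := by
    rw [ENNReal.ofReal_lt_one, Real.exp_lt_one_iff]
    linarith
  have hzero : eLpNorm v p = 0 := by
    by_contra hne
    exact hle.not_gt ((ENNReal.mul_lt_mul_left hne hvp.2.ne hlt).trans_eq (one_mul _))
  exact (hv.continuous.ae_eq_iff_eq volume continuous_const).1
    ((eLpNorm_eq_zero_iff hvp.1 (zero_lt_one.trans_le hp).ne').1 hzero)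

theorem eLpNorm_le_of_growing (hp : 1 ≤ p) {κ : ℝ → ℂ} (hκ : Continuous κ) (hκ₀ : 0 < κ₀)
    (hre : ∀ x, κ₀ ≤ (κ x).re) {v : ℝ → ℂ} (hv : IsPrimitive v fun x => κ x * v x - g x)
    (hvp : MemLp v p) (hg : MemLp g p) :
    eLpNorm v p ≤ ENNReal.ofReal κ₀⁻¹ * eLpNorm g p := by
  obtain ⟨v', hv', hvp', hle⟩ := exists_solution_growing hp hκ hκ₀ hre hg
  have hdiff : IsPrimitive (fun x => v x - v' x) fun x => κ x * (v x - v' x) := by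
    convert hv.sub hv' using 2
    ring
  have hzero := eq_zero_of_growing hp hκ hκ₀ hre hdiff (hvp.sub hvp')
  rwa [show v = v' from funext fun x => sub_eq_zero.1 (congrFun hzero x)]

theorem memLp_comp_neg (hg : MemLp g p) : MemLp (fun x => g (-x)) p :=
  hg.comp_measurePreserving (Measure.measurePreserving_neg volume)

theorem eLpNorm_comp_neg (hg : AEStronglyMeasurable g) :
    eLpNorm (fun x => g (-x)) p = eLpNorm g p :=
  eLpNorm_comp_measurePreserving hg (Measure.measurePreserving_neg volume)

theorem exists_solution_decaying (hp : 1 ≤ p) {κ : ℂ} (hκ : 0 < κ.re) (hg : MemLp g p) :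
    ∃ v : ℝ → ℂ, IsPrimitive v (fun x => -κ * v x + g x) ∧ MemLp v p := by
  obtain ⟨v, hv, hvp, -⟩ := exists_solution_growing hp (κ := fun _ => κ) continuous_const hκ
    (fun _ => le_rfl) (memLp_comp_neg hg)
  refine ⟨fun x => v (-x), ?_, memLp_comp_neg hvp⟩
  convert hv.comp_neg using 2 with x
  rw [neg_neg]
  ring

theorem eLpNorm_le_of_decaying (hp : 1 ≤ p) {κ : ℂ} (hκ : 0 < κ.re) {v : ℝ → ℂ}
    (hv : IsPrimitive v fun x => -κ * v x + g x) (hvp : MemLp v p) (hg : MemLp g p) :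
    eLpNorm v p ≤ ENNReal.ofReal κ.re⁻¹ * eLpNorm g p := by
  have hreflect : IsPrimitive (fun x => v (-x)) fun x => κ * v (-x) - g (-x) := by
    convert hv.comp_neg using 2
    ring
  have h := eLpNorm_le_of_growing hp continuous_const hκ (fun _ => le_rfl) hreflect
    (memLp_comp_neg hvp) (memLp_comp_neg hg)
  rwa [eLpNorm_comp_neg hvp.1, eLpNorm_comp_neg hg.1] at h

end FirstOrder

/-! ### The system over an abstract space with a derivative -/

section System

/-- The coefficients of the linearized system in the weighted variables: the wave speed `c`, the
exponent `α` of the weight and the heat release parameter `h`. -/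
structure SystemCoeffs where
  c : ℝ
  α : ℝ
  h : ℝ
  α_pos : 0 < α
  α_lt : α < c / 2

namespace SystemCoeffs

variable (k : SystemCoeffs)

/-- The drift of the first equation after conjugation with the weight. -/
def drift : ℝ := k.c - 2 * k.α

/-- The damping of the first equation after conjugation with the weight, which is the spectral gap
of the theorem. -/
def damping : ℝ := k.α * (k.c - k.α)

theorem c_pos : 0 < k.c := by linarith [k.α_pos, k.α_lt]

theorem drift_pos : 0 < k.drift := by
  unfold drift
  linarith [k.α_lt]

theorem damping_pos : 0 < k.damping := mul_pos k.α_pos (by linarith [k.α_pos, k.α_lt])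

theorem damping_le : k.damping ≤ k.c * k.α := by
  unfold damping
  nlinarith [k.α_pos]

end SystemCoeffs

variable {X : Type*} [NormedAddCommGroup X] [NormedSpace ℂ X]

/-- `𝓓` is the graph of an operator `∂` on `X` such that `∂ - κ - t B` and `∂ + κ` have bounded
inverses, of norm at most `1 / Re κ`, whenever `0 < Re κ` and `0 ≤ t`. For the derivative on a space
of functions this holds if `B` is multiplication by a nonnegative function. -/
structure IsSolvableDerivative (𝓓 : Submodule ℂ (X × X)) (B : X →L[ℂ] X) : Prop where
  eq_zero : ∀ V, ((0 : X), V) ∈ 𝓓 → V = 0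
  exists_growing : ∀ (κ : ℂ) (t : ℝ), 0 < κ.re → 0 ≤ t → ∀ G,
    ∃ V, (V, κ • V + (t : ℂ) • B V - G) ∈ 𝓓
  norm_growing : ∀ (κ : ℂ) (t : ℝ), 0 < κ.re → 0 ≤ t → ∀ V G,
    (V, κ • V + (t : ℂ) • B V - G) ∈ 𝓓 → ‖V‖ ≤ κ.re⁻¹ * ‖G‖
  exists_decaying : ∀ κ : ℂ, 0 < κ.re → ∀ G, ∃ V, (V, -κ • V + G) ∈ 𝓓
  norm_decaying : ∀ κ : ℂ, 0 < κ.re → ∀ V G, (V, -κ • V + G) ∈ 𝓓 → ‖V‖ ≤ κ.re⁻¹ * ‖G‖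

variable {𝓓 : Submodule ℂ (X × X)} {A B : X →L[ℂ] X}

namespace IsSolvableDerivative

variable (h𝓓 : IsSolvableDerivative 𝓓 B)
include h𝓓

theorem exists_advection {c : ℝ} (hc : 0 < c) {ζ : ℂ} (hζ : 0 < ζ.re) (G : X) :
    ∃ V T, (V, T) ∈ 𝓓 ∧ ζ • V + B V - (c : ℂ) • T = G := by
  have hc0 : (c : ℂ) ≠ 0 := by exact_mod_cast hc.ne'
  obtain ⟨V, hV⟩ := h𝓓.exists_growing (ζ / c) c⁻¹ (by rw [Complex.div_ofReal_re]; positivity)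
    (by positivity) ((c : ℂ)⁻¹ • G)
  refine ⟨V, _, hV, ?_⟩
  simp only [smul_add, smul_sub, smul_smul, Complex.ofReal_inv, mul_div_cancel₀ _ hc0,
    mul_inv_cancel₀ hc0, one_smul, sub_sub_cancel]

theorem norm_le_of_advection {c : ℝ} (hc : 0 < c) {ζ : ℂ} (hζ : 0 < ζ.re) {V T : X}
    (hV : (V, T) ∈ 𝓓) : ‖V‖ ≤ ζ.re⁻¹ * ‖ζ • V + B V - (c : ℂ) • T‖ := by
  have hc0 : (c : ℂ) ≠ 0 := by exact_mod_cast hc.ne'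
  set G := ζ • V + B V - (c : ℂ) • T with hG
  have hT : T = (ζ / c) • V + ((c⁻¹ : ℝ) : ℂ) • B V - (c : ℂ)⁻¹ • G := by
    simp only [hG, smul_add, smul_sub, smul_smul, Complex.ofReal_inv, inv_mul_cancel₀ hc0,
      one_smul, div_eq_inv_mul, sub_sub_cancel]
  have h := h𝓓.norm_growing (ζ / c) c⁻¹ (by rw [Complex.div_ofReal_re]; positivity)
    (by positivity) V ((c : ℂ)⁻¹ • G) (hT ▸ hV)
  rwa [norm_smul, norm_inv, Complex.norm_real, Real.norm_of_nonneg hc.le, Complex.div_ofReal_re,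
    inv_div, ← mul_assoc, div_mul_eq_mul_div, mul_inv_cancel₀ hc.ne', one_div] at h

theorem exists_second_order {μ η : ℂ} (hμ : 0 < μ.re) (hη : 0 < η.re) (G : X) :
    ∃ P R S, (P, R) ∈ 𝓓 ∧ (R, S) ∈ 𝓓 ∧ (μ * η) • P - (η - μ) • R - S = G := by
  obtain ⟨V, hV⟩ := h𝓓.exists_growing μ 0 hμ le_rfl G
  obtain ⟨P, hP⟩ := h𝓓.exists_decaying η hη V
  refine ⟨P, -η • P + V, -η • (-η • P + V) + (μ • V + ((0 : ℝ) : ℂ) • B V - G), hP,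
    𝓓.add_mem (𝓓.smul_mem (-η) hP) hV, ?_⟩
  simp only [Complex.ofReal_zero]
  module

/-- `μ η - (η - μ) ∂ - ∂² = (μ - ∂) (∂ + η)`. -/
theorem norm_le_of_second_order {μ η : ℂ} (hμ : 0 < μ.re) (hη : 0 < η.re) {P R S : X}
    (hP : (P, R) ∈ 𝓓) (hR : (R, S) ∈ 𝓓) :
    ‖R + η • P‖ ≤ μ.re⁻¹ * ‖(μ * η) • P - (η - μ) • R - S‖ ∧
      ‖P‖ ≤ η.re⁻¹ * (μ.re⁻¹ * ‖(μ * η) • P - (η - μ) • R - S‖) := by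
  set G := (μ * η) • P - (η - μ) • R - S with hG
  have hV : ‖R + η • P‖ ≤ μ.re⁻¹ * ‖G‖ := by
    refine h𝓓.norm_growing μ 0 hμ le_rfl _ _ ?_
    convert 𝓓.add_mem hR (𝓓.smul_mem η hP) using 1
    refine Prod.ext rfl ?_
    simp only [Prod.snd_add, Prod.smul_snd, hG, Complex.ofReal_zero]
    module
  refine ⟨hV, (h𝓓.norm_decaying η hη P (R + η • P) ?_).trans (by gcongr)⟩
  rwa [neg_smul, neg_add_cancel_comm_assoc]

theorem exists_norm_le_of_advection {c : ℝ} (hc : 0 < c) {ζ : ℂ} (hζ : 0 < ζ.re) :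
    ∃ C, 0 ≤ C ∧ ∀ V T, (V, T) ∈ 𝓓 → ‖V‖ ≤ C * ‖ζ • V + B V - (c : ℂ) • T‖ ∧
      ‖T‖ ≤ C * ‖ζ • V + B V - (c : ℂ) • T‖ := by
  refine ⟨max ζ.re⁻¹ (c⁻¹ * ((‖ζ‖ + ‖B‖) * ζ.re⁻¹ + 1)), by positivity, fun V T hV => ?_⟩
  have hle := h𝓓.norm_le_of_advection hc hζ hV
  set G := ζ • V + B V - (c : ℂ) • T with hG
  refine ⟨hle.trans (by gcongr; exact le_max_left _ _), ?_⟩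
  have hT : T = (c : ℂ)⁻¹ • (ζ • V + B V - G) := by
    rw [hG, sub_sub_cancel, inv_smul_smul₀ (by exact_mod_cast hc.ne')]
  calc ‖T‖ = c⁻¹ * ‖ζ • V + B V - G‖ := by
        rw [hT, norm_smul, norm_inv, Complex.norm_real, Real.norm_of_nonneg hc.le]
    _ ≤ c⁻¹ * (‖ζ‖ * ‖V‖ + ‖B‖ * ‖V‖ + ‖G‖) := by
        gcongr
        refine (norm_sub_le _ _).trans ?_
        gcongr
        refine (norm_add_le _ _).trans ?_
        rw [norm_smul]
        gcongr
        exact B.le_opNorm V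
    _ ≤ c⁻¹ * ((‖ζ‖ + ‖B‖) * (ζ.re⁻¹ * ‖G‖) + ‖G‖) := by
        rw [← add_mul]
        gcongr
    _ = c⁻¹ * ((‖ζ‖ + ‖B‖) * ζ.re⁻¹ + 1) * ‖G‖ := by ring
    _ ≤ _ := by
        gcongr
        exact le_max_right _ _

theorem exists_norm_le_of_second_order {μ η : ℂ} (hμ : 0 < μ.re) (hη : 0 < η.re) :
    ∃ C, 0 ≤ C ∧ ∀ P R S, (P, R) ∈ 𝓓 → (R, S) ∈ 𝓓 →
      ‖P‖ ≤ C * ‖(μ * η) • P - (η - μ) • R - S‖ ∧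
        ‖R‖ ≤ C * ‖(μ * η) • P - (η - μ) • R - S‖ := by
  refine ⟨max (η.re⁻¹ * μ.re⁻¹) (μ.re⁻¹ + ‖η‖ * (η.re⁻¹ * μ.re⁻¹)), by positivity,
    fun P R S hP hR => ?_⟩
  obtain ⟨hV, hle⟩ := h𝓓.norm_le_of_second_order hμ hη hP hR
  set G := (μ * η) • P - (η - μ) • R - S
  rw [← mul_assoc] at hle
  refine ⟨hle.trans (by gcongr; exact le_max_left _ _), ?_⟩
  calc ‖R‖ ≤ ‖R + η • P‖ + ‖η‖ * ‖P‖ := by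
        rw [← norm_smul]
        simpa only [add_sub_cancel_right] using norm_sub_le (R + η • P) (η • P)
    _ ≤ μ.re⁻¹ * ‖G‖ + ‖η‖ * (η.re⁻¹ * μ.re⁻¹ * ‖G‖) := by gcongr
    _ = (μ.re⁻¹ + ‖η‖ * (η.re⁻¹ * μ.re⁻¹)) * ‖G‖ := by ring
    _ ≤ _ := by
        gcongr
        exact le_max_right _ _

end IsSolvableDerivative

/-- The factorization `X² + d X - ζ = (X - μ) (X + η)`, with roots on both sides of the imaginary
axis. -/
theorem exists_roots {d : ℝ} (hd : 0 < d) {ζ : ℂ} (hζ : 0 < ζ.re) :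
    ∃ μ η : ℂ, 0 < μ.re ∧ 0 < η.re ∧ η - μ = d ∧ μ * η = ζ := by
  obtain ⟨s, hs, hs0⟩ : ∃ s : ℂ, s * s = ((d / 2) ^ 2 : ℝ) + ζ ∧ 0 ≤ s.re := by
    obtain ⟨s, hs⟩ := IsAlgClosed.exists_pow_nat_eq (((d / 2) ^ 2 : ℝ) + ζ) zero_lt_two
    rcases le_total 0 s.re with h | h
    · exact ⟨s, by rw [← hs, sq], h⟩
    · exact ⟨-s, by rw [← hs, neg_mul_neg, sq], by simpa using h⟩
  have hre : s.re * s.re - s.im * s.im = (d / 2) ^ 2 + ζ.re := by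
    simpa only [Complex.mul_re, Complex.add_re, Complex.ofReal_re] using congrArg Complex.re hs
  have hlt : d / 2 < s.re := by
    by_contra! hle
    nlinarith [mul_self_nonneg s.im]
  refine ⟨s - (d / 2 : ℝ), s + (d / 2 : ℝ), ?_, ?_, ?_, ?_⟩
  · rw [Complex.sub_re, Complex.ofReal_re]
    linarith
  · rw [Complex.add_re, Complex.ofReal_re]
    linarith
  · push_cast
    ring
  · push_cast at hs ⊢
    linear_combination hs

theorem exists_real_roots {d ζ : ℝ} (hd : 0 < d) (hζ : 0 < ζ) :
    ∃ μ η : ℝ, 0 < μ ∧ 0 < η ∧ η - μ = d ∧ μ * η = ζ := by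
  have hs := Real.mul_self_sqrt (by positivity : 0 ≤ (d / 2) ^ 2 + ζ)
  set s := √((d / 2) ^ 2 + ζ)
  have hs0 : 0 ≤ s := Real.sqrt_nonneg _
  have hlt : d / 2 < s := by nlinarith
  exact ⟨s - d / 2, s + d / 2, by linarith, by linarith, by ring, by linear_combination hs⟩

/-- The weighted temperature perturbation `h P - (1 - h) Q`. -/
def tempPart (h : ℝ) : X × X →L[ℂ] X :=
  (h : ℂ) • ContinuousLinearMap.fst ℂ X X - (1 - (h : ℂ)) • ContinuousLinearMap.snd ℂ X X

theorem tempPart_apply (h : ℝ) (x : X × X) :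
    tempPart h x = (h : ℂ) • x.1 - (1 - (h : ℂ)) • x.2 := rfl

theorem tempPart_mem {x V : X × X} (h₁ : (x.1, V.1) ∈ 𝓓) (h₂ : (x.2, V.2) ∈ 𝓓) (h : ℝ) :
    (tempPart h x, tempPart h V) ∈ 𝓓 :=
  𝓓.sub_mem (𝓓.smul_mem _ h₁) (𝓓.smul_mem _ h₂)

/-- `v ↦ (v, -v)`: what the reaction adds to the first equation it removes from the second. -/
def antidiag : X →L[ℂ] X × X :=
  ContinuousLinearMap.inl ℂ X X - ContinuousLinearMap.inr ℂ X X

theorem antidiag_apply (v : X) : antidiag v = (v, -v) := by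
  simp [antidiag]

theorem norm_antidiag (v : X) : ‖antidiag v‖ = ‖v‖ := by
  simp [antidiag_apply, Prod.norm_def]

/-- The graph of the operator
`(P, Q) ↦ (P'' + d P' - m P + A N + B Q, c Q' - c α Q - A N - B Q)`, `N = h P - (1 - h) Q`, with
`d` the drift and `m` the damping. -/
def systemGraph (k : SystemCoeffs) (𝓓 : Submodule ℂ (X × X)) (A B : X →L[ℂ] X) :
    Submodule ℂ ((X × X) × (X × X)) where
  carrier := {z | ∃ R S T : X, (z.1.1, R) ∈ 𝓓 ∧ (R, S) ∈ 𝓓 ∧ (z.1.2, T) ∈ 𝓓 ∧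
    z.2.1 = S + (k.drift : ℂ) • R - (k.damping : ℂ) • z.1.1 + A (tempPart k.h z.1) + B z.1.2 ∧
    z.2.2 = (k.c : ℂ) • T - ((k.c : ℂ) * k.α) • z.1.2 - A (tempPart k.h z.1) - B z.1.2}
  add_mem' := by
    rintro z w ⟨R, S, T, hR, hS, hT, hz₁, hz₂⟩ ⟨R', S', T', hR', hS', hT', hw₁, hw₂⟩
    refine ⟨R + R', S + S', T + T', 𝓓.add_mem hR hR', 𝓓.add_mem hS hS', 𝓓.add_mem hT hT', ?_, ?_⟩
    · simp only [Prod.fst_add, Prod.snd_add, hz₁, hw₁, map_add, smul_add]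
      abel
    · simp only [Prod.fst_add, Prod.snd_add, hz₂, hw₂, map_add, smul_add]
      abel
  zero_mem' := ⟨0, 0, 0, 𝓓.zero_mem, 𝓓.zero_mem, 𝓓.zero_mem, by simp, by simp⟩
  smul_mem' := by
    rintro a z ⟨R, S, T, hR, hS, hT, hz₁, hz₂⟩
    refine ⟨a • R, a • S, a • T, 𝓓.smul_mem a hR, 𝓓.smul_mem a hS, 𝓓.smul_mem a hT, ?_, ?_⟩
    · simp only [Prod.smul_fst, Prod.smul_snd, hz₁, map_smul, smul_add, smul_sub, smul_comm a]
    · simp only [Prod.smul_fst, Prod.smul_snd, hz₂, map_smul, smul_sub, smul_comm a]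

theorem mem_systemGraph {k : SystemCoeffs} {x f : X × X} : (x, f) ∈ systemGraph k 𝓓 A B ↔
    ∃ R S T : X, (x.1, R) ∈ 𝓓 ∧ (R, S) ∈ 𝓓 ∧ (x.2, T) ∈ 𝓓 ∧
      f.1 = S + (k.drift : ℂ) • R - (k.damping : ℂ) • x.1 + A (tempPart k.h x) + B x.2 ∧
      f.2 = (k.c : ℂ) • T - ((k.c : ℂ) * k.α) • x.2 - A (tempPart k.h x) - B x.2 := Iff.rfl

variable {k : SystemCoeffs}

theorem eq_zero_of_zero_mem_systemGraph (h𝓓 : IsSolvableDerivative 𝓓 B) (f : X × X)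
    (hf : ((0 : X × X), f) ∈ systemGraph k 𝓓 A B) : f = 0 := by
  obtain ⟨R, S, T, hR, hS, hT, hf₁, hf₂⟩ := mem_systemGraph.1 hf
  obtain rfl := h𝓓.eq_zero R hR
  obtain rfl := h𝓓.eq_zero S hS
  obtain rfl := h𝓓.eq_zero T hT
  exact Prod.ext (by simpa using hf₁) (by simpa using hf₂)

theorem mem_systemGraph_iff_sub (x f : X × X) : (x, f) ∈ systemGraph k 𝓓 A B ↔
    (x, f - (antidiag ∘L A ∘L tempPart k.h) x) ∈ systemGraph k 𝓓 0 B := by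
  simp only [mem_systemGraph, ContinuousLinearMap.comp_apply, antidiag_apply, Prod.fst_sub,
    Prod.snd_sub, zero_apply, add_zero, sub_zero, sub_neg_eq_add]
  refine exists_congr fun R => exists_congr fun S => exists_congr fun T => ?_
  rw [sub_eq_iff_eq_add, add_right_comm, sub_right_comm, eq_sub_iff_add_eq]

theorem mem_systemGraph_zero_iff {z : ℂ} {x y : X × X} :
    (x, z • x - y) ∈ systemGraph k 𝓓 0 B ↔ ∃ R S T : X, (x.1, R) ∈ 𝓓 ∧ (R, S) ∈ 𝓓 ∧
      (x.2, T) ∈ 𝓓 ∧ (k.damping + z) • x.1 - (k.drift : ℂ) • R - S = y.1 + B x.2 ∧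
      (z + k.c * k.α) • x.2 + B x.2 - (k.c : ℂ) • T = y.2 := by
  simp only [mem_systemGraph, Prod.fst_sub, Prod.snd_sub, Prod.smul_fst, Prod.smul_snd, zero_apply,
    add_zero, sub_zero]
  refine exists_congr fun R => exists_congr fun S => exists_congr fun T => ?_
  refine and_congr_right' (and_congr_right' (and_congr_right' (and_congr ?_ ?_)))
  · rw [← sub_eq_zero, ← sub_eq_zero (b := y.1 + _)]
    exact Eq.congr_left (by module)
  · rw [← sub_eq_zero, ← sub_eq_zero (b := y.2)]
    exact Eq.congr_left (by module)

section Resolvent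

variable (h𝓓 : IsSolvableDerivative 𝓓 B) {z : ℂ} (hz : -k.damping < z.re)
include hz

theorem SystemCoeffs.re_damping_add_pos : 0 < (k.damping + z : ℂ).re := by
  rw [Complex.add_re, Complex.ofReal_re]
  linarith

theorem SystemCoeffs.re_add_mul_pos : 0 < (z + k.c * k.α).re := by
  rw [Complex.add_re, ← Complex.ofReal_mul, Complex.ofReal_re]
  linarith [k.damping_le]

include h𝓓

theorem exists_mem_systemGraph (y : X × X) : ∃ x, (x, z • x - y) ∈ systemGraph k 𝓓 0 B := by
  obtain ⟨Q, T, hT, hQ⟩ := h𝓓.exists_advection k.c_pos (k.re_add_mul_pos hz) y.2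
  obtain ⟨μ, η, hμ, hη, hsub, hmul⟩ := exists_roots k.drift_pos (k.re_damping_add_pos hz)
  obtain ⟨P, R, S, hR, hS, hP⟩ := h𝓓.exists_second_order hμ hη (y.1 + B Q)
  rw [hsub, hmul] at hP
  exact ⟨(P, Q), mem_systemGraph_zero_iff.2 ⟨R, S, T, hR, hS, hT, hP, hQ⟩⟩

theorem exists_norm_le_of_mem_systemGraph : ∃ C, 0 ≤ C ∧ ∀ x y,
    (x, z • x - y) ∈ systemGraph k 𝓓 0 B → ‖x‖ ≤ C * ‖y‖ ∧
      ∃ V : X × X, (x.1, V.1) ∈ 𝓓 ∧ (x.2, V.2) ∈ 𝓓 ∧ ‖V‖ ≤ C * ‖y‖ := by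
  obtain ⟨C₁, hC₁, h₁⟩ := h𝓓.exists_norm_le_of_advection k.c_pos (k.re_add_mul_pos hz)
  obtain ⟨μ, η, hμ, hη, hsub, hmul⟩ := exists_roots k.drift_pos (k.re_damping_add_pos hz)
  obtain ⟨C₂, hC₂, h₂⟩ := h𝓓.exists_norm_le_of_second_order hμ hη
  rw [hsub, hmul] at h₂
  refine ⟨max (C₂ * (1 + ‖B‖ * C₁)) C₁, by positivity, fun x y hxy => ?_⟩
  obtain ⟨R, S, T, hR, hS, hT, hP, hQ⟩ := mem_systemGraph_zero_iff.1 hxy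
  obtain ⟨hxQ, hTQ⟩ := h₁ _ _ hT
  obtain ⟨hxP, hRP⟩ := h₂ _ _ _ hR hS
  rw [hQ] at hxQ hTQ
  rw [hP] at hxP hRP
  have hy₂ : C₁ * ‖y.2‖ ≤ max (C₂ * (1 + ‖B‖ * C₁)) C₁ * ‖y‖ := by
    gcongr
    exacts [le_max_right _ _, norm_snd_le y]
  have hy₁ : C₂ * ‖y.1 + B x.2‖ ≤ max (C₂ * (1 + ‖B‖ * C₁)) C₁ * ‖y‖ := calc
    C₂ * ‖y.1 + B x.2‖ ≤ C₂ * (‖y.1‖ + ‖B‖ * (C₁ * ‖y.2‖)) := by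
        gcongr
        refine (norm_add_le _ _).trans ?_
        gcongr
        exact (B.le_opNorm _).trans (by gcongr)
    _ ≤ C₂ * (‖y‖ + ‖B‖ * (C₁ * ‖y‖)) := by
        gcongr
        exacts [norm_fst_le y, norm_snd_le y]
    _ = C₂ * (1 + ‖B‖ * C₁) * ‖y‖ := by ring
    _ ≤ _ := by
        gcongr
        exact le_max_left _ _
  exact ⟨norm_prod_le_iff.2 ⟨hxP.trans hy₁, hxQ.trans hy₂⟩, (R, T), hR, hT,
    norm_prod_le_iff.2 ⟨hRP.trans hy₁, hTQ.trans hy₂⟩⟩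

theorem exists_systemGraph_resolvent : ∃ S, IsGraphResolvent (systemGraph k 𝓓 0 B) z S := by
  obtain ⟨C, -, hle⟩ := exists_norm_le_of_mem_systemGraph h𝓓 hz
  exact exists_isGraphResolvent_of_norm_le (exists_mem_systemGraph h𝓓 hz)
    fun x y hxy => (hle x y hxy).1

end Resolvent

/-- `A` is compact relative to the operator with graph `𝓓`, in the form that it is approximated by
finite rank operators in the norm of bounded operators from the domain, with its graph norm. -/
def IsApproximable (𝓓 : Submodule ℂ (X × X)) (A : X →L[ℂ] X) : Prop :=
  ∀ ε > 0, ∃ (n : ℕ) (π : Fin n → X →L[ℂ] ℂ) (e : Fin n → X),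
    ∀ U V, (U, V) ∈ 𝓓 → ‖A U - ∑ i, π i U • e i‖ ≤ ε * (‖U‖ + ‖V‖)

theorem norm_antidiag_comp_sub_sum {n : ℕ} (π : Fin n → X →L[ℂ] ℂ) (e : Fin n → X) (h : ℝ)
    (x : X × X) :
    ‖(antidiag ∘L A ∘L tempPart h -
        ∑ i, (π i ∘L tempPart h).smulRight (antidiag (e i))) x‖ =
      ‖A (tempPart h x) - ∑ i, π i (tempPart h x) • e i‖ := by
  rw [← norm_antidiag (A _ - _), map_sub, map_sum]
  simp only [sub_apply, sum_apply, ContinuousLinearMap.comp_apply,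
    ContinuousLinearMap.smulRight_apply, map_smul]

theorem exists_systemGraph_parametrix [CompleteSpace X] (h𝓓 : IsSolvableDerivative 𝓓 B)
    (hA : IsApproximable 𝓓 A) {z : ℂ} (hz : -k.damping < z.re) :
    ∃ (n : ℕ) (W : X × X →L[ℂ] X × X) (π : Fin n → X × X →L[ℂ] ℂ) (e : Fin n → X × X),
      IsParametrix (systemGraph k 𝓓 A B) z W π e := by
  obtain ⟨C, hC, hle⟩ := exists_norm_le_of_mem_systemGraph (k := k) h𝓓 hz
  obtain ⟨S, hS⟩ := exists_systemGraph_resolvent (k := k) h𝓓 hz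
  obtain ⟨n, π, e, hπ⟩ := hA (1 / (4 * (‖tempPart (X := X) k.h‖ * C + 1))) (by positivity)
  have hsmall : ‖(antidiag ∘L A ∘L tempPart k.h -
      ∑ i, (π i ∘L tempPart k.h).smulRight (antidiag (e i))) ∘L S‖ ≤ 1 / 2 := by
    refine ContinuousLinearMap.opNorm_le_bound _ (by norm_num) fun y => ?_
    obtain ⟨hSy, V, hV₁, hV₂, hVy⟩ := hle _ _ (hS.1 y)
    rw [ContinuousLinearMap.comp_apply, norm_antidiag_comp_sub_sum]
    calc _ ≤ 1 / (4 * (‖tempPart (X := X) k.h‖ * C + 1)) *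
          (‖tempPart k.h (S y)‖ + ‖tempPart k.h V‖) := hπ _ _ (tempPart_mem hV₁ hV₂ k.h)
      _ ≤ 1 / (4 * (‖tempPart (X := X) k.h‖ * C + 1)) *
          (‖tempPart (X := X) k.h‖ * (C * ‖y‖) + ‖tempPart (X := X) k.h‖ * (C * ‖y‖)) := by
          gcongr
          · exact (ContinuousLinearMap.le_opNorm _ _).trans (by gcongr)
          · exact (ContinuousLinearMap.le_opNorm _ _).trans (by gcongr)
      _ = ‖tempPart (X := X) k.h‖ * C / (‖tempPart (X := X) k.h‖ * C + 1) * (1 / 2 * ‖y‖) := by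
          field_simp
          ring
      _ ≤ 1 / 2 * ‖y‖ := mul_le_of_le_one_left (by positivity)
          (div_le_one_of_le₀ (by linarith) (by positivity))
  obtain ⟨W, π', hW⟩ := hS.exists_isParametrix (eq_zero_of_zero_mem_systemGraph h𝓓)
    mem_systemGraph_iff_sub (hsmall.trans_lt (by norm_num))
  exact ⟨n, W, π', _, hW⟩

theorem norm_le_of_mem_systemGraph_of_real (h𝓓 : IsSolvableDerivative 𝓓 B) {l : ℝ} (hl : 1 ≤ l)
    {x y : X × X} (hxy : (x, (l : ℂ) • x - y) ∈ systemGraph k 𝓓 0 B) :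
    ‖x‖ ≤ l⁻¹ * ((1 + ‖B‖) * ‖y‖) := by
  have hm := k.damping_pos
  have hm' := k.damping_le
  have : (0 : ℝ) < l := by linarith
  obtain ⟨R, S, T, hR, hS, hT, hP, hQ⟩ := mem_systemGraph_zero_iff.1 hxy
  obtain ⟨μ, η, hμ, hη, hsub, hmul⟩ := exists_real_roots k.drift_pos
    (show 0 < k.damping + l by linarith)
  have hxQ : ‖x.2‖ ≤ l⁻¹ * ‖y.2‖ := by
    have hre : (l + k.c * k.α : ℂ).re = l + k.c * k.α := by norm_cast
    have hle := h𝓓.norm_le_of_advection k.c_pos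
      (ζ := l + k.c * k.α) (by rw [hre]; linarith) hT
    rw [hQ, hre] at hle
    exact hle.trans (by gcongr; linarith)
  have hxP : ‖x.1‖ ≤ l⁻¹ * ‖y.1 + B x.2‖ := by
    obtain ⟨-, hle⟩ := h𝓓.norm_le_of_second_order (μ := μ) (η := η) hμ hη hR hS
    rw [← Complex.ofReal_mul, ← Complex.ofReal_sub, hsub, hmul, Complex.ofReal_add, hP,
      Complex.ofReal_re, Complex.ofReal_re, ← mul_assoc, ← mul_inv, mul_comm η, hmul] at hle
    exact hle.trans (by gcongr; linarith)
  have hBx : ‖B x.2‖ ≤ ‖B‖ * ‖y‖ := (B.le_opNorm _).trans <| by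
    gcongr
    exact hxQ.trans ((mul_le_of_le_one_left (norm_nonneg _) (inv_le_one_of_one_le₀ hl)).trans
      (norm_snd_le y))
  refine norm_prod_le_iff.2 ⟨hxP.trans ?_, hxQ.trans ?_⟩
  · gcongr
    rw [one_add_mul]
    exact (norm_add_le _ _).trans (add_le_add (norm_fst_le y) hBx)
  · gcongr
    exact (norm_snd_le y).trans (le_mul_of_one_le_left (norm_nonneg _) (by simp))

theorem exists_systemGraph_injective (h𝓓 : IsSolvableDerivative 𝓓 B) :
    ∃ l : ℝ, 0 < l ∧ ∀ x, (x, (l : ℂ) • x) ∈ systemGraph k 𝓓 A B → x = 0 := by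
  set N := antidiag ∘L A ∘L tempPart (X := X) k.h
  set l := (1 + ‖B‖) * ‖N‖ + 1 with hl
  have hl1 : 1 ≤ l := le_add_of_nonneg_left (by positivity)
  refine ⟨l, by linarith, fun x hx => norm_le_zero_iff.1 ?_⟩
  have hle := norm_le_of_mem_systemGraph_of_real h𝓓 hl1 ((mem_systemGraph_iff_sub _ _).1 hx)
  have hlt : l * ‖x‖ ≤ (1 + ‖B‖) * ‖N‖ * ‖x‖ := calc
    l * ‖x‖ ≤ (1 + ‖B‖) * ‖N x‖ := (le_inv_mul_iff₀ (by linarith)).1 hle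
    _ ≤ (1 + ‖B‖) * ‖N‖ * ‖x‖ := by
        rw [mul_assoc]
        gcongr
        exact N.le_opNorm x
  rw [hl, add_mul, one_mul] at hlt
  linarith

end System

/-! ### The weak derivative in `Lᵖ` -/

section WeakDeriv

open ENNReal

variable {p : ℝ≥0∞}

theorem norm_le_of_eLpNorm_le {U V : Lp ℂ p (volume : Measure ℝ)} {u : ℝ → ℂ} {K : ℝ} (hK : 0 ≤ K)
    (hu : U =ᵐ[volume] u) (h : eLpNorm u p ≤ ENNReal.ofReal K * eLpNorm V p) :
    ‖U‖ ≤ K * ‖V‖ := by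
  rw [Lp.norm_def, Lp.norm_def, eLpNorm_congr_ae hu]
  simpa only [ENNReal.toReal_mul, ENNReal.toReal_ofReal hK] using
    ENNReal.toReal_mono (ENNReal.mul_ne_top ofReal_ne_top (Lp.eLpNorm_ne_top V)) h

theorem coeFn_decaying (κ : ℂ) (V G : Lp ℂ p (volume : Measure ℝ)) {v : ℝ → ℂ}
    (hv : V =ᵐ[volume] v) :
    (-κ • V + G : Lp ℂ p (volume : Measure ℝ)) =ᵐ[volume] fun x => -κ * v x + G x := by
  filter_upwards [Lp.coeFn_add (-κ • V) G, Lp.coeFn_smul (-κ) V, hv] with x h₁ h₂ h₃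
  rw [h₁, Pi.add_apply, h₂, Pi.smul_apply, h₃, smul_eq_mul]

variable [Fact (1 ≤ p)]

/-- The graph of the weak derivative in `Lᵖ(ℝ; ℂ)`. -/
def weakDeriv (p : ℝ≥0∞) [Fact (1 ≤ p)] :
    Submodule ℂ (Lp ℂ p (volume : Measure ℝ) × Lp ℂ p (volume : Measure ℝ)) where
  carrier := {z | ∃ u, z.1 =ᵐ[volume] u ∧ IsPrimitive u z.2}
  add_mem' := by
    rintro z w ⟨u, hu, hu'⟩ ⟨v, hv, hv'⟩
    exact ⟨_, (Lp.coeFn_add z.1 w.1).trans (hu.add hv), (hu'.add hv').congr (Lp.coeFn_add _ _).symm⟩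
  zero_mem' := ⟨fun _ => 0, Lp.coeFn_zero _ _ _, isPrimitive_zero.congr (Lp.coeFn_zero _ _ _).symm⟩
  smul_mem' := by
    rintro a z ⟨u, hu, hu'⟩
    exact ⟨_, (Lp.coeFn_smul a z.1).trans (hu.const_smul a),
      (hu'.const_mul a).congr (Lp.coeFn_smul a z.2).symm⟩

theorem mem_weakDeriv {U V : Lp ℂ p (volume : Measure ℝ)} :
    (U, V) ∈ weakDeriv p ↔ ∃ u, U =ᵐ[volume] u ∧ IsPrimitive u V := Iff.rfl

theorem toLp_mem_weakDeriv {u v : ℝ → ℂ} (hu : MemLp u p volume) (hv : MemLp v p volume)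
    (h : IsPrimitive u v) : (hu.toLp u, hv.toLp v) ∈ weakDeriv p :=
  mem_weakDeriv.2 ⟨u, hu.coeFn_toLp, h.congr hv.coeFn_toLp.symm⟩

theorem eq_zero_of_zero_mem_weakDeriv (V : Lp ℂ p (volume : Measure ℝ))
    (hV : (0, V) ∈ weakDeriv p) : V = 0 := by
  obtain ⟨u, hu, huV⟩ := mem_weakDeriv.1 hV
  obtain rfl : u = fun _ => 0 := (huV.continuous.ae_eq_iff_eq volume continuous_zero).1
    (hu.symm.trans (Lp.coeFn_zero _ _ _))
  exact Lp.ext ((huV.ae_eq isPrimitive_zero).trans (Lp.coeFn_zero _ _ _).symm)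

/-- Multiplication by an essentially bounded function, on `Lᵖ(ℝ; ℂ)`. -/
def mulOp {b : ℝ → ℂ} (hb : MemLp b ∞) :
    Lp ℂ p (volume : Measure ℝ) →L[ℂ] Lp ℂ p (volume : Measure ℝ) :=
  (ContinuousLinearMap.mul ℂ ℂ).holderL volume ∞ p p (hb.toLp b)

theorem coeFn_mulOp {b : ℝ → ℂ} (hb : MemLp b ∞) (U : Lp ℂ p (volume : Measure ℝ)) :
    mulOp hb U =ᵐ[volume] fun x => b x * U x := by
  filter_upwards [(ContinuousLinearMap.mul ℂ ℂ).coeFn_holder (r := p) (hb.toLp b) U,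
    hb.coeFn_toLp] with x hx hbx
  rw [mulOp, ContinuousLinearMap.holderL_apply_apply, hx, hbx, ContinuousLinearMap.mul_apply']

variable {β : ℝ → ℝ} {hβ : MemLp (fun x => (β x : ℂ)) ∞}

theorem coeFn_growing (κ : ℂ) (t : ℝ) (V G : Lp ℂ p (volume : Measure ℝ)) {v : ℝ → ℂ}
    (hv : V =ᵐ[volume] v) :
    (κ • V + (t : ℂ) • mulOp hβ V - G : Lp ℂ p (volume : Measure ℝ)) =ᵐ[volume]
      fun x => (κ + t * β x) * v x - G x := by
  filter_upwards [Lp.coeFn_sub (κ • V + (t : ℂ) • mulOp hβ V) G,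
    Lp.coeFn_add (κ • V) ((t : ℂ) • mulOp hβ V), Lp.coeFn_smul κ V,
    Lp.coeFn_smul (t : ℂ) (mulOp hβ V), coeFn_mulOp hβ V, hv] with x h₁ h₂ h₃ h₄ h₅ h₆
  rw [h₁, Pi.sub_apply, h₂, Pi.add_apply, h₃, h₄, Pi.smul_apply, Pi.smul_apply, h₅, h₆,
    smul_eq_mul, smul_eq_mul, add_mul, mul_assoc]

theorem isSolvableDerivative_weakDeriv (hβc : Continuous β) (hβ₀ : ∀ x, 0 ≤ β x) :
    IsSolvableDerivative (weakDeriv p) (mulOp hβ) := by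
  have hp := Fact.out (p := 1 ≤ p)
  have hκ : ∀ (κ : ℂ) (t : ℝ), Continuous fun x => κ + t * β x := fun κ t => by fun_prop
  have hre : ∀ (κ : ℂ) (t : ℝ), 0 ≤ t → ∀ x, κ.re ≤ (κ + t * β x).re := fun κ t ht x => by
    rw [← Complex.ofReal_mul, Complex.add_re, Complex.ofReal_re]
    exact le_add_of_nonneg_right (mul_nonneg ht (hβ₀ x))
  refine ⟨eq_zero_of_zero_mem_weakDeriv, fun κ t h₀ ht G => ?_, fun κ t h₀ ht V G hV => ?_,
    fun κ h₀ G => ?_, fun κ h₀ V G hV => ?_⟩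
  · obtain ⟨v, hv, hvp, -⟩ := exists_solution_growing hp (hκ κ t) h₀ (hre κ t ht) (Lp.memLp G)
    exact ⟨hvp.toLp v, v, hvp.coeFn_toLp,
      hv.congr (coeFn_growing κ t _ G hvp.coeFn_toLp).symm⟩
  · obtain ⟨v, hv, hvV⟩ := mem_weakDeriv.1 hV
    exact norm_le_of_eLpNorm_le (inv_nonneg.2 h₀.le) hv (eLpNorm_le_of_growing hp (hκ κ t) h₀
      (hre κ t ht) (hvV.congr (coeFn_growing κ t V G hv)) ((memLp_congr_ae hv).1 (Lp.memLp V))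
      (Lp.memLp G))
  · obtain ⟨v, hv, hvp⟩ := exists_solution_decaying hp h₀ (Lp.memLp G)
    exact ⟨hvp.toLp v, v, hvp.coeFn_toLp, hv.congr (coeFn_decaying κ _ G hvp.coeFn_toLp).symm⟩
  · obtain ⟨v, hv, hvV⟩ := mem_weakDeriv.1 hV
    exact norm_le_of_eLpNorm_le (inv_nonneg.2 h₀.le) hv (eLpNorm_le_of_decaying hp h₀
      (hvV.congr (coeFn_decaying κ V G hv)) ((memLp_congr_ae hv).1 (Lp.memLp V)) (Lp.memLp G))

end WeakDeriv

/-! ### Multiplication operators vanishing at infinity are relatively compact -/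

section Approximable

variable {X : Type*} [NormedAddCommGroup X] [NormedSpace ℂ X] {𝓓 : Submodule ℂ (X × X)}
  {A : X →L[ℂ] X}

theorem IsApproximable.comp_left (hA : IsApproximable 𝓓 A) (L : X →L[ℂ] X) :
    IsApproximable 𝓓 (L ∘L A) := by
  intro ε hε
  obtain ⟨n, π, e, h⟩ := hA (ε / (‖L‖ + 1)) (by positivity)
  refine ⟨n, π, fun i => L (e i), fun U V hUV => ?_⟩
  calc ‖L (A U) - ∑ i, π i U • L (e i)‖
      = ‖L (A U - ∑ i, π i U • e i)‖ := by simp only [map_sub, map_sum, map_smul]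
    _ ≤ (‖L‖ + 1) * (ε / (‖L‖ + 1) * (‖U‖ + ‖V‖)) :=
        (L.le_opNorm _).trans (mul_le_mul (le_add_of_nonneg_right zero_le_one) (h U V hUV)
          (norm_nonneg _) (by positivity))
    _ = ε * (‖U‖ + ‖V‖) := by field_simp

theorem isApproximable_of_forall_exists_norm_sub_le
    (h : ∀ ε > 0, ∃ A', IsApproximable 𝓓 A' ∧ ‖A - A'‖ ≤ ε) : IsApproximable 𝓓 A := by
  intro ε hε
  obtain ⟨A', hA', hle⟩ := h (ε / 2) (half_pos hε)
  obtain ⟨n, π, e, hπ⟩ := hA' (ε / 2) (half_pos hε)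
  refine ⟨n, π, e, fun U V hUV => ?_⟩
  calc ‖A U - ∑ i, π i U • e i‖ = ‖(A - A') U + (A' U - ∑ i, π i U • e i)‖ := by
        rw [sub_apply, sub_add_sub_cancel]
    _ ≤ ε / 2 * ‖U‖ + ε / 2 * (‖U‖ + ‖V‖) :=
        norm_add_le_of_le ((A - A').le_of_opNorm_le hle U) (hπ U V hUV)
    _ ≤ ε * (‖U‖ + ‖V‖) := by nlinarith [norm_nonneg V]

end Approximable

section StepFunctions

open ENNReal

variable {p : ℝ≥0∞} {u v : ℝ → ℂ} {a b δ : ℝ}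

theorem IsPrimitive.enorm_sub_le (hu : IsPrimitive u v) {x y : ℝ} (hxy : |y - x| ≤ δ) :
    ‖u y - u x‖ₑ ≤ ∫⁻ s in Set.Icc (-δ) δ, ‖v (x + s)‖ₑ := by
  have hsub : Set.uIoc 0 (y - x) ⊆ Set.Icc (-δ) δ := fun s hs => by
    have h := Set.abs_sub_left_of_mem_uIcc (Set.uIoc_subset_uIcc hs)
    rw [sub_zero, sub_zero] at h
    exact abs_le.1 (h.trans hxy)
  calc ‖u y - u x‖ₑ = ‖∫ s in 0..y - x, v (x + s)‖ₑ := by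
        rw [intervalIntegral.integral_comp_add_left, add_zero, add_sub_cancel, hu.2]
    _ = ‖∫ s in Set.uIoc 0 (y - x), v (x + s)‖ₑ :=
        enorm_eq_iff_norm_eq.2 (intervalIntegral.norm_intervalIntegral_eq _ _ _ _)
    _ ≤ ∫⁻ s in Set.uIoc 0 (y - x), ‖v (x + s)‖ₑ := enorm_integral_le_lintegral_enorm _
    _ ≤ ∫⁻ s in Set.Icc (-δ) δ, ‖v (x + s)‖ₑ := lintegral_mono_set hsub

theorem enorm_sub_setAverage_le (hu : IsPrimitive u v) {x : ℝ} (hx : x ∈ Set.Ioc a b)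
    (hδ : b - a ≤ δ) :
    ‖u x - ⨍ t in Set.Ioc a b, u t‖ₑ ≤ ∫⁻ s in Set.Icc (-δ) δ, ‖v (x + s)‖ₑ := by
  have hvol : volume (Set.Ioc a b) ≠ 0 := by
    simpa only [Real.volume_Ioc, ne_eq, ENNReal.ofReal_eq_zero, not_le, sub_pos] using
      hx.1.trans_le hx.2
  have hmem : ∀ᵐ t ∂volume.restrict (Set.Ioc a b),
      u t ∈ Metric.closedEBall (u x) (∫⁻ s in Set.Icc (-δ) δ, ‖v (x + s)‖ₑ) := by
    filter_upwards [ae_restrict_mem measurableSet_Ioc] with t ht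
    rw [Metric.mem_closedEBall, edist_eq_enorm_sub]
    exact hu.enorm_sub_le
      ((Real.dist_le_of_mem_Icc (Set.Ioc_subset_Icc_self ht) (Set.Ioc_subset_Icc_self hx)).trans hδ)
  have h := (convex_closedEBall (u x) _).set_average_mem Metric.isClosed_closedEBall hvol
    measure_Ioc_lt_top.ne hmem (hu.continuous.integrableOn_Ioc)
  rwa [Metric.mem_closedEBall, edist_comm, edist_eq_enorm_sub] at h

theorem exists_clm_eq_setAverage [Fact (1 ≤ p)] {α : Type*} [MeasurableSpace α] {μ : Measure α}
    {I : Set α} (hI : MeasurableSet I) (hμI : μ I ≠ ∞) :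
    ∃ π : Lp ℂ p μ →L[ℂ] ℂ, ∀ U, π U = ⨍ t in I, U t ∂μ := by
  have : Fact (1 ≤ conjExponent p) := ⟨le_self_add⟩
  refine ⟨(μ.real I : ℂ)⁻¹ • (ContinuousLinearMap.mul ℂ ℂ).lpPairing μ (conjExponent p) p
    (indicatorConstLp _ hI hμI 1), fun U => ?_⟩
  have hU : (fun x => ContinuousLinearMap.mul ℂ ℂ (indicatorConstLp (conjExponent p) hI hμI 1 x)
      (U x)) =ᵐ[μ] I.indicator U := by
    filter_upwards [indicatorConstLp_coeFn (p := conjExponent p) (hs := hI) (hμs := hμI)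
      (c := (1 : ℂ))] with x hx
    rw [hx, ContinuousLinearMap.mul_apply', ← Set.indicator_mul_left]
    simp only [one_mul]
  rw [smul_apply, ContinuousLinearMap.lpPairing_eq_integral, integral_congr_ae hU,
    integral_indicator hI, setAverage_eq, Complex.real_smul, Complex.ofReal_inv, smul_eq_mul]

theorem enorm_sum_indicator_le {ι α E : Type*} [NormedAddCommGroup E] {I : ι → Set α}
    (hI : Pairwise (Function.onFun Disjoint I)) {s : Finset ι} {f : ι → α → E} {x : α} {r : ℝ≥0∞}
    (hf : ∀ i, x ∈ I i → ‖f i x‖ₑ ≤ r) : ‖∑ i ∈ s, (I i).indicator (f i) x‖ₑ ≤ r := by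
  by_cases h : ∃ i ∈ s, x ∈ I i
  · obtain ⟨i, his, hi⟩ := h
    rw [Finset.sum_eq_single_of_mem i his fun j _ hji =>
      Set.indicator_of_notMem (Set.disjoint_right.1 (hI hji) hi) _, Set.indicator_of_mem hi]
    exact hf i hi
  · push Not at h
    rw [Finset.sum_eq_zero fun i hi => Set.indicator_of_notMem (h i hi) _, enorm_zero]
    exact zero_le

theorem eLpNorm_indicator_sub_step_le (hp : 1 ≤ p) (hu : IsPrimitive u v)
    (hv : AEStronglyMeasurable v) {t : ℕ → ℝ} (ht : Monotone t) (hδ : ∀ i, t (i + 1) - t i ≤ δ)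
    (n : ℕ) :
    eLpNorm (fun x => (Set.Ioc (t 0) (t n)).indicator u x - ∑ i ∈ Finset.range n,
      (Set.Ioc (t i) (t (i + 1))).indicator (fun _ => ⨍ s in Set.Ioc (t i) (t (i + 1)), u s) x) p ≤
      ENNReal.ofReal (2 * δ) * eLpNorm v p := by
  have hdisj : Pairwise (Function.onFun Disjoint fun i => Set.Ioc (t i) (t (i + 1))) :=
    ht.pairwise_disjoint_on_Ioc_succ
  have hunion : ⋃ i ∈ Finset.range n, Set.Ioc (t i) (t (i + 1)) = Set.Ioc (t 0) (t n) := by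
    simpa only [Finset.range_eq_Ico, Finset.mem_Ico, Set.mem_Ico, Order.succ_eq_add_one] using
      ht.biUnion_Ico_Ioc_map_succ 0 n
  have hpoint : ∀ x, ‖(Set.Ioc (t 0) (t n)).indicator u x - ∑ i ∈ Finset.range n,
      (Set.Ioc (t i) (t (i + 1))).indicator (fun _ => ⨍ s in Set.Ioc (t i) (t (i + 1)), u s) x‖ₑ ≤
      ‖∫⁻ s in Set.Icc (-δ) δ, ‖v (x + s)‖ₑ‖ₑ := by
    intro x
    rw [← hunion, Finset.indicator_biUnion_apply _ _ (hdisj.set_pairwise _),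
      ← Finset.sum_sub_distrib]
    refine (congrArg _ (Finset.sum_congr rfl fun i _ => ?_)).trans_le (enorm_sum_indicator_le hdisj
      (f := fun i y => u y - ⨍ s in Set.Ioc (t i) (t (i + 1)), u s)
      fun i hi => enorm_sub_setAverage_le hu hi (hδ i))
    exact (congrFun (Set.indicator_sub' _ u _) x).symm
  refine (eLpNorm_mono_enorm hpoint).trans
    ((eLpNorm_lintegral_translate_le hp hv.enorm).trans_eq ?_)
  rw [eLpNorm_enorm, Measure.restrict_apply_univ, Real.volume_Icc, sub_neg_eq_add, two_mul]

theorem coeFn_sum_smul_indicatorConstLp {ι α : Type*} [MeasurableSpace α] {μ : Measure α}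
    {I : ι → Set α} (hI : ∀ i, MeasurableSet (I i)) (hμI : ∀ i, μ (I i) ≠ ∞) (k : ι → ℂ)
    (s : Finset ι) :
    (∑ i ∈ s, k i • indicatorConstLp p (hI i) (hμI i) (1 : ℂ) : Lp ℂ p μ) =ᵐ[μ]
      fun x => ∑ i ∈ s, (I i).indicator (fun _ => k i) x := by
  have hterm : ∀ᵐ x ∂μ, ∀ i ∈ s, (k i • indicatorConstLp p (hI i) (hμI i) (1 : ℂ) : Lp ℂ p μ) x =
      (I i).indicator (fun _ => k i) x := by
    refine (eventually_all_finset s).2 fun i _ => ?_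
    filter_upwards [Lp.coeFn_smul (k i) (indicatorConstLp p (hI i) (hμI i) (1 : ℂ)),
      indicatorConstLp_coeFn (p := p) (hs := hI i) (hμs := hμI i) (c := (1 : ℂ))] with x h₁ h₂
    rw [h₁, Pi.smul_apply, h₂, ← Set.indicator_const_smul_apply, smul_eq_mul, mul_one]
  filter_upwards [Lp.coeFn_finsetSum s fun i => k i • indicatorConstLp p (hI i) (hμI i) (1 : ℂ),
    hterm] with x h₁ h₂
  rw [h₁, Finset.sum_apply]
  exact Finset.sum_congr rfl h₂

variable [Fact (1 ≤ p)]

theorem exists_norm_mulOp_indicator_sub_sum_le {t : ℕ → ℝ} (ht : Monotone t) (hδ₀ : 0 ≤ δ)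
    (hδ : ∀ i, t (i + 1) - t i ≤ δ) {n : ℕ} (ha : t 0 = a) (hb : t n = b)
    (hJ : MemLp ((Set.Ioc a b).indicator fun _ => (1 : ℂ)) ∞) :
    ∃ (π : Fin n → Lp ℂ p (volume : Measure ℝ) →L[ℂ] ℂ)
      (e : Fin n → Lp ℂ p (volume : Measure ℝ)), ∀ U V, (U, V) ∈ weakDeriv p →
        ‖mulOp hJ U - ∑ i, π i U • e i‖ ≤ 2 * δ * ‖V‖ := by
  subst ha hb
  have hI := fun i => measurableSet_Ioc (a := t i) (b := t (i + 1))
  have hμI := fun i => (measure_Ioc_lt_top (μ := volume) (a := t i) (b := t (i + 1))).ne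
  choose π hπ using fun i => exists_clm_eq_setAverage (p := p) (hI i) (hμI i)
  refine ⟨fun i => π i, fun i => indicatorConstLp p (hI i) (hμI i) 1, fun U V hUV => ?_⟩
  obtain ⟨u, hu, huV⟩ := mem_weakDeriv.1 hUV
  rw [Fin.sum_univ_eq_sum_range fun i => π i U • indicatorConstLp p (hI i) (hμI i) (1 : ℂ)]
  refine norm_le_of_eLpNorm_le (by positivity) ?_
    (eLpNorm_indicator_sub_step_le Fact.out huV (Lp.aestronglyMeasurable V) ht hδ n)
  filter_upwards [hu, coeFn_mulOp hJ U, Lp.coeFn_sub (mulOp hJ U) (∑ i ∈ Finset.range n,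
    π i U • indicatorConstLp p (hI i) (hμI i) 1), coeFn_sum_smul_indicatorConstLp hI hμI
    (fun i => π i U) (Finset.range n)] with x h₁ h₂ h₃ h₄
  have hmean : ∀ i, π i U = ⨍ s in Set.Ioc (t i) (t (i + 1)), u s := fun i =>
    (hπ i U).trans (average_congr (ae_restrict_of_ae hu))
  rw [h₃, Pi.sub_apply, h₂, h₄, h₁, ← Set.indicator_mul_left]
  simp only [one_mul, hmean, Set.indicator_apply]

theorem isApproximable_mulOp_indicator (hab : a ≤ b)
    (hJ : MemLp ((Set.Ioc a b).indicator fun _ => (1 : ℂ)) ∞) :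
    IsApproximable (weakDeriv p) (mulOp hJ) := by
  intro ε hε
  obtain ⟨n, hn⟩ := exists_nat_gt (2 * (b - a) / ε)
  have : 0 ≤ b - a := sub_nonneg.2 hab
  have hn₀ : (0 : ℝ) < n := lt_of_le_of_lt (by positivity) hn
  obtain ⟨π, e, hle⟩ := exists_norm_mulOp_indicator_sub_sum_le (p := p) (n := n)
    (t := fun i => a + i * ((b - a) / n)) (δ := (b - a) / n)
    (fun i j hij => by dsimp only; gcongr) (by positivity)
    (fun i => by push_cast; linarith) (by simp) (by field_simp; ring) hJ
  refine ⟨n, π, e, fun U V hUV => ?_⟩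
  calc _ ≤ 2 * ((b - a) / n) * ‖V‖ := hle U V hUV
    _ ≤ ε * ‖V‖ := by
        gcongr
        rw [← mul_div_assoc, div_le_iff₀ hn₀, ← div_le_iff₀' hε]
        exact hn.le
    _ ≤ ε * (‖U‖ + ‖V‖) := by gcongr; exact le_add_of_nonneg_left (norm_nonneg U)

theorem exists_forall_notMem_Ioc_norm_le {E : Type*} [NormedAddCommGroup E] {f : ℝ → E}
    (hbot : Tendsto f atBot (𝓝 0)) (htop : Tendsto f atTop (𝓝 0)) {ε : ℝ} (hε : 0 < ε) :
    ∃ a b, a ≤ b ∧ ∀ x ∉ Set.Ioc a b, ‖f x‖ ≤ ε := by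
  obtain ⟨a, ha⟩ := eventually_atBot.1 (hbot.norm.eventually_le_const (norm_zero.trans_lt hε))
  obtain ⟨b, hb⟩ := eventually_atTop.1 (htop.norm.eventually_le_const (norm_zero.trans_lt hε))
  refine ⟨a, max a b, le_max_left a b, fun x hx => ?_⟩
  rcases le_or_gt x a with hxa | hxa
  · exact ha x hxa
  · exact hb x ((le_max_right a b).trans (not_le.1 fun h => hx ⟨hxa, h⟩).le)

theorem isApproximable_mulOp {f : ℝ → ℂ} (hf : MemLp f ∞) (hbot : Tendsto f atBot (𝓝 0))
    (htop : Tendsto f atTop (𝓝 0)) : IsApproximable (weakDeriv p) (mulOp hf) := by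
  refine isApproximable_of_forall_exists_norm_sub_le fun ε hε => ?_
  obtain ⟨a, b, hab, hsmall⟩ := exists_forall_notMem_Ioc_norm_le hbot htop hε
  have hJ : MemLp ((Set.Ioc a b).indicator fun _ => (1 : ℂ)) ∞ volume :=
    memLp_indicator_const ∞ measurableSet_Ioc 1 (Or.inr measure_Ioc_lt_top.ne)
  refine ⟨mulOp hf ∘L mulOp hJ, (isApproximable_mulOp_indicator hab hJ).comp_left _,
    ContinuousLinearMap.opNorm_le_bound _ hε.le fun U => Lp.norm_le_mul_norm_of_ae_le_mul ?_⟩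
  filter_upwards [Lp.coeFn_sub (mulOp hf U) (mulOp hf (mulOp hJ U)), coeFn_mulOp hf U,
    coeFn_mulOp hf (mulOp hJ U), coeFn_mulOp hJ U] with x h₁ h₂ h₃ h₄
  rw [sub_apply, ContinuousLinearMap.comp_apply, h₁, Pi.sub_apply, h₂, h₃, h₄]
  by_cases hx : x ∈ Set.Ioc a b
  · rw [Set.indicator_of_mem hx, one_mul, sub_self, norm_zero]
    positivity
  · rw [Set.indicator_of_notMem hx, zero_mul, mul_zero, sub_zero, norm_mul]
    exact mul_le_mul_of_nonneg_right (hsmall x hx) (norm_nonneg _)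

end StepFunctions

/-! ### Weighted functions -/

section Weight

variable {α : ℝ} {v r s : ℝ → ℂ}

theorem weight_apply (α : ℝ) (v : ℝ → ℂ) (x : ℝ) :
    weight α v x = (Real.exp (α * x) : ℂ) * v x := rfl

theorem weight_neg_weight (α : ℝ) (v : ℝ → ℂ) : weight (-α) (weight α v) = v := by
  funext ξ
  simp [weight_apply, ← mul_assoc, ← Complex.exp_add]

theorem weight_weight_neg (α : ℝ) (v : ℝ → ℂ) : weight α (weight (-α) v) = v := by
  simpa using weight_neg_weight (-α) v

theorem continuous_weight (α : ℝ) (hv : Continuous v) : Continuous (weight α v) := by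
  have : Continuous fun ξ : ℝ => (Real.exp (α * ξ) : ℂ) := by fun_prop
  exact this.mul hv

/-- The derivative of `e^{α ξ} v` when `v' = r`. -/
def weightedDeriv (α : ℝ) (v r : ℝ → ℂ) (x : ℝ) : ℂ := weight α r x + α * weight α v x

theorem isPrimitive_weight (α : ℝ) (hv : IsPrimitive v r) :
    IsPrimitive (weight α v) (weightedDeriv α v r) := by
  have hexp : IsPrimitive (fun x : ℝ => (Real.exp (α * x) : ℂ))
      (fun x : ℝ => (α : ℂ) * (Real.exp (α * x) : ℂ)) := by
    refine isPrimitive_of_hasDerivAt (fun x => ?_) (by fun_prop)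
    have hreal : HasDerivAt (fun x : ℝ => Real.exp (α * x)) (α * Real.exp (α * x)) x := by
      simpa [mul_comm] using ((hasDerivAt_id x).const_mul α).exp
    exact_mod_cast hreal.ofReal_comp
  refine (hexp.mul hv).congr (Eventually.of_forall fun x => ?_)
  simp only [weightedDeriv, weight_apply]
  ring

theorem isPrimitive_weightedDeriv_deriv (α : ℝ) (hv : Differentiable ℝ v)
    (hv' : LocAC (deriv v)) : IsPrimitive (weight α v) (weightedDeriv α v (deriv v)) :=
  isPrimitive_weight α (isPrimitive_of_hasDerivAt (fun x => (hv x).hasDerivAt) hv'.continuous)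

theorem isPrimitive_weightedDeriv_deriv_deriv (α : ℝ) (hv : Differentiable ℝ v)
    (hv' : LocAC (deriv v)) : IsPrimitive (weightedDeriv α v (deriv v))
      (fun x => weightedDeriv α (deriv v) (deriv (deriv v)) x
        + α * weightedDeriv α v (deriv v) x) :=
  (isPrimitive_weight α hv'.isPrimitive).add
    ((isPrimitive_weightedDeriv_deriv α hv hv').const_mul α)

theorem isPrimitive_of_weight (hv : IsPrimitive (weight α v) r) :
    IsPrimitive v (weightedDeriv (-α) (weight α v) r) := by
  simpa only [weight_neg_weight] using isPrimitive_weight (-α) hv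

theorem differentiable_of_weight (hv : IsPrimitive (weight α v) r) (hr : IsPrimitive r s) :
    Differentiable ℝ v ∧ LocAC (deriv v) := by
  have hv₁ := isPrimitive_of_weight hv
  have hv₂ := (isPrimitive_weight (-α) hr).add
    ((isPrimitive_weight (-α) hv).const_mul ((-α : ℝ) : ℂ))
  have hderiv := hv₁.hasDerivAt hv₂.continuous
  refine ⟨fun x => (hderiv x).differentiableAt, ?_⟩
  rw [funext fun x => (hderiv x).deriv]
  exact hv₂.locAC

end Weight

/-! ### From the weighted spaces to `Lᵖ` -/

section Transfer

open ENNReal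

variable {p : ℝ≥0∞} [Fact (1 ≤ p)] {E : Type} [NormedAddCommGroup E] [NormedSpace ℂ E]

/-- `ι` and `j` read the elements of `E` as functions and, after multiplication with the weight, as
elements of `Lᵖ`; the image of `j` contains the functions with a weak derivative in `Lᵖ`. The last
field makes the first derivative of the temperature component, which the maximal domain leaves
uncontrolled, an element of `Lᵖ`. -/
structure IsWeightedSpace (p : ℝ≥0∞) [Fact (1 ≤ p)] (α : ℝ) (ι : E →ₗ[ℂ] (ℝ → ℂ))
    (j : E →L[ℂ] Lp ℂ p (volume : Measure ℝ)) : Prop where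
  coe : ∀ e, j e =ᵐ[volume] weight α (ι e)
  inj : Function.Injective ι
  cont : ∀ e, Continuous (ι e)
  lift : ∀ U V, (U, V) ∈ weakDeriv p → ∃ e, j e = U
  memLp_deriv : ∀ (e : E) (r s : ℝ → ℂ) (t : ℂ), IsPrimitive (weight α (ι e)) r →
    IsPrimitive r s → MemLp (fun x => s x + t * r x) p volume → MemLp r p volume

/-- The first component of the system, before and after conjugation with the weight. -/
theorem weighted_fst_iff (k : SystemCoeffs) (f P Q r s : ℝ → ℂ) (A B : ℂ) (ξ : ℝ) :
    weight k.α f ξ = (weightedDeriv k.α r s ξ + k.α * weightedDeriv k.α P r ξ)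
      + (k.drift : ℂ) * weightedDeriv k.α P r ξ - (k.damping : ℂ) * weight k.α P ξ
      + A * ((k.h : ℂ) * weight k.α P ξ - (1 - (k.h : ℂ)) * weight k.α Q ξ)
      + B * weight k.α Q ξ ↔
    f ξ = s ξ + (k.c : ℂ) * r ξ + A * ((k.h : ℂ) * P ξ - (1 - (k.h : ℂ)) * Q ξ) + B * Q ξ := by
  have hne : (Real.exp (k.α * ξ) : ℂ) ≠ 0 := by exact_mod_cast (Real.exp_pos _).ne'
  simp only [weightedDeriv, weight_apply, SystemCoeffs.drift, SystemCoeffs.damping]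
  push_cast at hne ⊢
  refine Iff.trans (Eq.congr rfl ?_) (mul_right_inj' hne)
  ring

theorem weighted_snd_iff (k : SystemCoeffs) (f P Q t : ℝ → ℂ) (A B : ℂ) (ξ : ℝ) :
    weight k.α f ξ = (k.c : ℂ) * weightedDeriv k.α Q t ξ
      - ((k.c : ℂ) * k.α) * weight k.α Q ξ
      - A * ((k.h : ℂ) * weight k.α P ξ - (1 - (k.h : ℂ)) * weight k.α Q ξ)
      - B * weight k.α Q ξ ↔
    f ξ = (k.c : ℂ) * t ξ - A * ((k.h : ℂ) * P ξ - (1 - (k.h : ℂ)) * Q ξ) - B * Q ξ := by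
  have hne : (Real.exp (k.α * ξ) : ℂ) ≠ 0 := by exact_mod_cast (Real.exp_pos _).ne'
  simp only [weightedDeriv, weight_apply]
  refine Iff.trans (Eq.congr rfl ?_) (mul_right_inj' hne)
  ring

namespace IsWeightedSpace

variable {α : ℝ} {ι : E →ₗ[ℂ] (ℝ → ℂ)} {j : E →L[ℂ] Lp ℂ p (volume : Measure ℝ)}

theorem injective (hE : IsWeightedSpace p α ι j) : Function.Injective j := by
  intro e e' he
  refine hE.inj (weight_injective α (((continuous_weight α (hE.cont e)).ae_eq_iff_eq volume
    (continuous_weight α (hE.cont e'))).1 ?_))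
  exact (hE.coe e).symm.trans (he ▸ hE.coe e')

theorem memLp (hE : IsWeightedSpace p α ι j) (e : E) : MemLp (weight α (ι e)) p volume :=
  (memLp_congr_ae (hE.coe e)).1 (Lp.memLp _)

theorem isPrimitive (hE : IsWeightedSpace p α ι j) {e : E} {V : Lp ℂ p (volume : Measure ℝ)}
    (hV : (j e, V) ∈ weakDeriv p) : IsPrimitive (weight α (ι e)) V := by
  obtain ⟨v, hv, hv'⟩ := mem_weakDeriv.1 hV
  obtain rfl : v = weight α (ι e) := (hv'.continuous.ae_eq_iff_eq volume
    (continuous_weight α (hE.cont e))).1 (hv.symm.trans (hE.coe e))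
  exact hv'

variable {a b : ℝ → ℂ}

theorem memLp_reaction (hE : IsWeightedSpace p α ι j) (ha : MemLp a ∞ volume)
    (hb : MemLp b ∞ volume) (h : ℂ) (P Q : E) :
    MemLp (fun ξ => a ξ * (h * weight α (ι P) ξ - (1 - h) * weight α (ι Q) ξ)
      + b ξ * weight α (ι Q) ξ) p volume :=
  ((((hE.memLp P).const_mul h).sub ((hE.memLp Q).const_mul (1 - h))).mul' ha).add
    ((hE.memLp Q).mul' hb)

theorem coeFn_mulOp_tempPart (hE : IsWeightedSpace p α ι j) (ha : MemLp a ∞ volume) (h : ℝ)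
    (P Q : E) : mulOp ha (tempPart h (j P, j Q)) =ᵐ[volume]
      fun ξ => a ξ * ((h : ℂ) * weight α (ι P) ξ - (1 - (h : ℂ)) * weight α (ι Q) ξ) := by
  filter_upwards [coeFn_mulOp ha (tempPart h (j P, j Q)),
    Lp.coeFn_sub ((h : ℂ) • j P) ((1 - (h : ℂ)) • j Q), Lp.coeFn_smul (h : ℂ) (j P),
    Lp.coeFn_smul (1 - (h : ℂ)) (j Q), hE.coe P, hE.coe Q] with ξ ha hsub hhP hhQ hP hQ
  rw [ha, tempPart_apply, hsub, Pi.sub_apply, hhP, hhQ, Pi.smul_apply, Pi.smul_apply, hP, hQ,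
    smul_eq_mul, smul_eq_mul]

theorem coeFn_mulOp_apply (hE : IsWeightedSpace p α ι j) (hb : MemLp b ∞ volume) (Q : E) :
    mulOp hb (j Q) =ᵐ[volume] fun ξ => b ξ * weight α (ι Q) ξ := by
  filter_upwards [coeFn_mulOp hb (j Q), hE.coe Q] with ξ hb hQ
  rw [hb, hQ]

variable {k : SystemCoeffs}

theorem system_fst_iff (hE : IsWeightedSpace p k.α ι j) (ha : MemLp a ∞ volume)
    (hb : MemLp b ∞ volume) {f P Q : E} {R S : Lp ℂ p (volume : Measure ℝ)} {r s : ℝ → ℂ}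
    (hR : R =ᵐ[volume] weightedDeriv k.α (ι P) r)
    (hS : S =ᵐ[volume] fun ξ => weightedDeriv k.α r s ξ + k.α * weightedDeriv k.α (ι P) r ξ) :
    j f = S + (k.drift : ℂ) • R - (k.damping : ℂ) • j P + mulOp ha (tempPart k.h (j P, j Q))
        + mulOp hb (j Q) ↔
      ∀ᵐ ξ, ι f ξ = s ξ + (k.c : ℂ) * r ξ
        + a ξ * ((k.h : ℂ) * ι P ξ - (1 - (k.h : ℂ)) * ι Q ξ) + b ξ * ι Q ξ := by
  rw [Lp.ext_iff]
  refine eventually_congr ?_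
  filter_upwards [hE.coe f, hE.coe P, hR, hS, hE.coeFn_mulOp_tempPart ha k.h P Q,
    hE.coeFn_mulOp_apply hb Q, Lp.coeFn_smul (k.drift : ℂ) R, Lp.coeFn_smul (k.damping : ℂ) (j P),
    Lp.coeFn_add S ((k.drift : ℂ) • R),
    Lp.coeFn_sub (S + (k.drift : ℂ) • R) ((k.damping : ℂ) • j P),
    Lp.coeFn_add (S + (k.drift : ℂ) • R - (k.damping : ℂ) • j P)
      (mulOp ha (tempPart k.h (j P, j Q))),
    Lp.coeFn_add (S + (k.drift : ℂ) • R - (k.damping : ℂ) • j P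
      + mulOp ha (tempPart k.h (j P, j Q))) (mulOp hb (j Q))]
    with ξ hf hP hR hS ha hb hdR hdP hadd hsub hadd' hadd''
  rw [hadd'', Pi.add_apply, hadd', Pi.add_apply, hsub, Pi.sub_apply, hadd, Pi.add_apply, hdR, hdP,
    Pi.smul_apply, Pi.smul_apply, hf, hP, hR, hS, ha, hb, smul_eq_mul, smul_eq_mul]
  exact weighted_fst_iff k _ _ _ _ _ _ _ ξ

theorem system_snd_iff (hE : IsWeightedSpace p k.α ι j) (ha : MemLp a ∞ volume)
    (hb : MemLp b ∞ volume) {g P Q : E} {T : Lp ℂ p (volume : Measure ℝ)} {t : ℝ → ℂ}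
    (hT : T =ᵐ[volume] weightedDeriv k.α (ι Q) t) :
    j g = (k.c : ℂ) • T - ((k.c : ℂ) * k.α) • j Q - mulOp ha (tempPart k.h (j P, j Q))
        - mulOp hb (j Q) ↔
      ∀ᵐ ξ, ι g ξ = (k.c : ℂ) * t ξ
        - a ξ * ((k.h : ℂ) * ι P ξ - (1 - (k.h : ℂ)) * ι Q ξ) - b ξ * ι Q ξ := by
  rw [Lp.ext_iff]
  refine eventually_congr ?_
  filter_upwards [hE.coe g, hE.coe Q, hT, hE.coeFn_mulOp_tempPart ha k.h P Q,
    hE.coeFn_mulOp_apply hb Q, Lp.coeFn_smul (k.c : ℂ) T,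
    Lp.coeFn_smul ((k.c : ℂ) * k.α) (j Q),
    Lp.coeFn_sub ((k.c : ℂ) • T) (((k.c : ℂ) * k.α) • j Q),
    Lp.coeFn_sub ((k.c : ℂ) • T - ((k.c : ℂ) * k.α) • j Q) (mulOp ha (tempPart k.h (j P, j Q))),
    Lp.coeFn_sub ((k.c : ℂ) • T - ((k.c : ℂ) * k.α) • j Q - mulOp ha (tempPart k.h (j P, j Q)))
      (mulOp hb (j Q))]
    with ξ hg hQ hT ha hb hcT hcQ hsub hsub' hsub''
  rw [hsub'', Pi.sub_apply, hsub', Pi.sub_apply, hsub, Pi.sub_apply, hcT, hcQ, Pi.smul_apply,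
    Pi.smul_apply, hg, hQ, hT, ha, hb, smul_eq_mul, smul_eq_mul]
  exact weighted_snd_iff k _ _ _ _ _ _ ξ

theorem memLp_weightedDeriv_fst (hE : IsWeightedSpace p k.α ι j) (ha : MemLp a ∞ volume)
    (hb : MemLp b ∞ volume) {f P Q : E} (hP : Differentiable ℝ (ι P))
    (hP' : LocAC (deriv (ι P)))
    (hf : ∀ᵐ ξ, ι f ξ = deriv (deriv (ι P)) ξ + (k.c : ℂ) * deriv (ι P) ξ
      + a ξ * ((k.h : ℂ) * ι P ξ - (1 - (k.h : ℂ)) * ι Q ξ) + b ξ * ι Q ξ) :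
    MemLp (weightedDeriv k.α (ι P) (deriv (ι P))) p volume ∧
      MemLp (fun x => weightedDeriv k.α (deriv (ι P)) (deriv (deriv (ι P))) x
        + k.α * weightedDeriv k.α (ι P) (deriv (ι P)) x) p volume := by
  set R := weightedDeriv k.α (ι P) (deriv (ι P))
  set S := fun x => weightedDeriv k.α (deriv (ι P)) (deriv (deriv (ι P))) x + k.α * R x
  have hSR : MemLp (fun x => S x + (k.drift : ℂ) * R x) p volume := by
    refine (((hE.memLp f).add ((hE.memLp P).const_mul (k.damping : ℂ))).sub
      (hE.memLp_reaction ha hb k.h P Q)).ae_eq ?_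
    filter_upwards [hf] with ξ hξ
    simp only [Pi.add_apply, Pi.sub_apply, (weighted_fst_iff k _ _ _ _ _ _ _ ξ).2 hξ, S, R]
    ring
  have hR : MemLp R p volume := hE.memLp_deriv P _ _ k.drift
    (isPrimitive_weightedDeriv_deriv k.α hP hP') (isPrimitive_weightedDeriv_deriv_deriv k.α hP hP')
    hSR
  refine ⟨hR, (hSR.sub (hR.const_mul (k.drift : ℂ))).ae_eq (Eventually.of_forall fun ξ => ?_)⟩
  simp only [Pi.sub_apply, add_sub_cancel_right]

theorem memLp_weightedDeriv_snd (hE : IsWeightedSpace p k.α ι j) (ha : MemLp a ∞ volume)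
    (hb : MemLp b ∞ volume) {g P Q : E} {t : ℝ → ℂ}
    (hg : ∀ᵐ ξ, ι g ξ = (k.c : ℂ) * t ξ
      - a ξ * ((k.h : ℂ) * ι P ξ - (1 - (k.h : ℂ)) * ι Q ξ) - b ξ * ι Q ξ) :
    MemLp (weightedDeriv k.α (ι Q) t) p volume := by
  have hc : (k.c : ℂ) ≠ 0 := by exact_mod_cast k.c_pos.ne'
  refine ((((hE.memLp g).add ((hE.memLp Q).const_mul ((k.c : ℂ) * k.α))).add
    (hE.memLp_reaction ha hb k.h P Q)).const_mul (k.c : ℂ)⁻¹).ae_eq ?_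
  filter_upwards [hg] with ξ hξ
  simp only [Pi.add_apply, (weighted_snd_iff k _ _ _ _ _ _ ξ).2 hξ]
  field_simp
  ring

section Linearization

variable {F u y : ℝ → ℝ}
  {ha : MemLp (fun ξ => ((deriv F (temperature k.h u y ξ) * y ξ : ℝ) : ℂ)) ∞ volume}
  {hb : MemLp (fun ξ => (F (temperature k.h u y ξ) : ℂ)) ∞ volume}

theorem mem_systemGraph_of_mem_linearizationGraph (hE : IsWeightedSpace p k.α ι j)
    {x f : E × E} (hxf : (x, f) ∈ linearizationGraph ι F k.h k.c u y) :
    (j.prodMap j x, j.prodMap j f) ∈ systemGraph k (weakDeriv p) (mulOp ha) (mulOp hb) := by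
  obtain ⟨P, Q⟩ := x
  obtain ⟨f, g⟩ := f
  obtain ⟨hP, hP', hQ, hf, hg⟩ := hxf
  obtain ⟨hR, hS⟩ := hE.memLp_weightedDeriv_fst ha hb hP hP' hf
  have hT := hE.memLp_weightedDeriv_snd ha hb hg
  refine mem_systemGraph.2 ⟨hR.toLp _, hS.toLp _, hT.toLp _, ?_, ?_, ?_, ?_, ?_⟩
  · exact mem_weakDeriv.2 ⟨_, hE.coe P,
      (isPrimitive_weightedDeriv_deriv k.α hP hP').congr hR.coeFn_toLp.symm⟩
  · exact toLp_mem_weakDeriv hR hS (isPrimitive_weightedDeriv_deriv_deriv k.α hP hP')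
  · exact mem_weakDeriv.2 ⟨_, hE.coe Q,
      (isPrimitive_weight k.α hQ.isPrimitive).congr hT.coeFn_toLp.symm⟩
  · exact (hE.system_fst_iff ha hb hR.coeFn_toLp hS.coeFn_toLp).2 hf
  · exact (hE.system_snd_iff ha hb hT.coeFn_toLp).2 hg

theorem mem_linearizationGraph_of_mem_systemGraph (hE : IsWeightedSpace p k.α ι j)
    {x f : E × E}
    (hxf : (j.prodMap j x, j.prodMap j f) ∈
      systemGraph k (weakDeriv p) (mulOp ha) (mulOp hb)) :
    (x, f) ∈ linearizationGraph ι F k.h k.c u y := by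
  obtain ⟨P, Q⟩ := x
  obtain ⟨f, g⟩ := f
  obtain ⟨R, S, T, hPR, hRS, hQT, hf, hg⟩ := mem_systemGraph.1 hxf
  have hR := hE.isPrimitive (e := P) hPR
  have hT := hE.isPrimitive (e := Q) hQT
  obtain ⟨r, hr, hrS⟩ := mem_weakDeriv.1 hRS
  obtain ⟨hP, hP'⟩ := differentiable_of_weight (hR.congr hr) hrS
  have hQ : LocAC (ι Q) := (isPrimitive_of_weight hT).locAC
  have hSR := isPrimitive_weightedDeriv_deriv_deriv k.α hP hP'
  have hRr : R =ᵐ[volume] weightedDeriv k.α (ι P) (deriv (ι P)) :=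
    hR.ae_eq (isPrimitive_weightedDeriv_deriv k.α hP hP')
  obtain rfl : r = weightedDeriv k.α (ι P) (deriv (ι P)) :=
    (hrS.continuous.ae_eq_iff_eq volume hSR.continuous).1 (hr.symm.trans hRr)
  exact ⟨hP, hP', hQ, (hE.system_fst_iff ha hb hRr (hrS.ae_eq hSR)).1 hf,
    (hE.system_snd_iff ha hb (hT.ae_eq (isPrimitive_weight k.α hQ.isPrimitive))).1 hg⟩

theorem isPartOf_linearization (hE : IsWeightedSpace p k.α ι j) :
    IsPartOf (linearization ι F k.h k.c u y)
      (systemGraph k (weakDeriv p) (mulOp ha) (mulOp hb)) (j.prodMap j) where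
  inj := hE.injective.prodMap hE.injective
  mem_graph x f := by
    rw [linearization_graph ι hE.inj hE.cont]
    exact ⟨hE.mem_systemGraph_of_mem_linearizationGraph,
      hE.mem_linearizationGraph_of_mem_systemGraph⟩
  exists_eq x f hxf := by
    obtain ⟨R, S, T, hR, -, hT, -⟩ := mem_systemGraph.1 hxf
    obtain ⟨P, hP⟩ := hE.lift _ _ hR
    obtain ⟨Q, hQ⟩ := hE.lift _ _ hT
    exact ⟨(P, Q), Prod.ext hP hQ⟩

end Linearization

end IsWeightedSpace

end Transfer

/-! ### The weighted spaces over `H¹` and `BUC` -/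

section Spaces

open ENNReal

/-- With the decaying equation solvable, `w ∈ 𝓓` means that `w.1` is the solution for the right-hand
side `w.1 + w.2`; the a priori bound makes this a closed condition. -/
theorem IsSolvableDerivative.isClosed {X : Type*} [NormedAddCommGroup X] [NormedSpace ℂ X]
    {𝓓 : Submodule ℂ (X × X)} {B : X →L[ℂ] X} (h𝓓 : IsSolvableDerivative 𝓓 B) :
    IsClosed (𝓓 : Set (X × X)) := by
  refine isClosed_of_closure_subset fun w hw => ?_
  obtain ⟨V, hV⟩ := h𝓓.exists_decaying 1 one_pos (w.1 + w.2)
  have hle : ∀ z ∈ 𝓓, ‖z.1 - V‖ ≤ ‖z.1 + z.2 - (w.1 + w.2)‖ := fun z hz => by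
    have hsub : (z.1 - V, -(1 : ℂ) • (z.1 - V) + (z.1 + z.2 - (w.1 + w.2))) ∈ 𝓓 := by
      convert 𝓓.sub_mem hz hV using 1
      exact Prod.ext rfl (by simp only [Prod.snd_sub]; module)
    simpa using h𝓓.norm_decaying 1 one_pos _ _ hsub
  have hclosed : IsClosed {z : X × X | ‖z.1 - V‖ ≤ ‖z.1 + z.2 - (w.1 + w.2)‖} :=
    isClosed_le (by fun_prop) (by fun_prop)
  have hwV : ‖w.1 - V‖ ≤ ‖w.1 + w.2 - (w.1 + w.2)‖ := closure_minimal hle hclosed hw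
  rw [sub_self, norm_zero, norm_le_zero_iff, sub_eq_zero] at hwV
  have hw_eq : w = (V, -(1 : ℂ) • V + (w.1 + w.2)) := Prod.ext hwV (by rw [← hwV]; module)
  rwa [hw_eq]

theorem isClosed_weakDeriv {p : ℝ≥0∞} [Fact (1 ≤ p)] :
    IsClosed (weakDeriv p : Set (Lp ℂ p (volume : Measure ℝ) × Lp ℂ p (volume : Measure ℝ))) :=
  (isSolvableDerivative_weakDeriv (β := fun _ => 0) (hβ := by simp)
    continuous_const fun _ => le_rfl).isClosed

namespace H1

variable {α : ℝ} {v : ℝ → ℂ}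

/-- The element `e^{-α ξ} v` of `H1 α`. -/
def mk (hv : v ∈ h1Submodule) : H1 α :=
  ⟨weight (-α) v, by rwa [Submodule.mem_comap, weight_weight_neg]⟩

theorem weight_mk (hv : v ∈ h1Submodule) : weight α (toFun α (mk hv)) = v :=
  weight_weight_neg α v

theorem jet_mk (hv : v ∈ h1Submodule) {U V : Lp ℂ 2 (volume : Measure ℝ)}
    (hU : U =ᵐ[volume] v) (hV : V =ᵐ[volume] deriv v) :
    jet α (mk hv) = WithLp.toLp 2 (U, V) := by
  refine congrArg (WithLp.toLp 2) (Prod.ext (Lp.ext ?_) (Lp.ext ?_))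
  · refine (weight_mem (mk hv)).2.1.coeFn_toLp.trans ?_
    rw [weight_mk]
    exact hU.symm
  · refine (weight_mem (mk hv)).2.2.coeFn_toLp.trans ?_
    rw [weight_mk]
    exact hV.symm

theorem exists_jet_eq (α : ℝ) {U V : Lp ℂ 2 (volume : Measure ℝ)} (h : (U, V) ∈ weakDeriv 2) :
    ∃ e, jet α e = WithLp.toLp 2 (U, V) := by
  obtain ⟨v, hU, hv⟩ := h
  have hmem : v ∈ h1Submodule := ⟨hv.locAC, (memLp_congr_ae hU).1 (Lp.memLp U),
    (memLp_congr_ae hv.deriv_ae_eq).2 (Lp.memLp V)⟩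
  exact ⟨mk hmem, jet_mk hmem hU hv.deriv_ae_eq.symm⟩

theorem range_jet (α : ℝ) :
    Set.range (jet α) = WithLp.ofLp ⁻¹' (weakDeriv 2 : Set (_ × _)) := by
  ext z
  refine ⟨?_, fun hz => exists_jet_eq α hz⟩
  rintro ⟨e, rfl⟩
  have he := weight_mem e
  exact toLp_mem_weakDeriv he.2.1 he.2.2 he.1.isPrimitive

/-- The jet of a function, as an isometry. -/
def jetₗᵢ (α : ℝ) :
    H1 α →ₗᵢ[ℂ] WithLp 2 (Lp ℂ 2 (volume : Measure ℝ) × Lp ℂ 2 (volume : Measure ℝ)) :=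
  ⟨jet α, fun _ => rfl⟩

instance (α : ℝ) : CompleteSpace (H1 α) := by
  rw [completeSpace_iff_isComplete_range (jetₗᵢ α).isometry.isUniformInducing]
  change IsComplete (Set.range (jet α))
  rw [range_jet]
  exact (isClosed_weakDeriv.preimage (WithLp.prod_continuous_ofLp 2 _ _)).isComplete

/-- The map `u ↦ e^{α ξ} u` into `L²`. -/
def toL2 (α : ℝ) : H1 α →L[ℂ] Lp ℂ 2 (volume : Measure ℝ) :=
  WithLp.fstL 2 ℂ _ _ ∘L (jetₗᵢ α).toContinuousLinearMap

theorem isWeightedSpace (α : ℝ) : IsWeightedSpace 2 α (toFun α) (toL2 α) where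
  coe e := (weight_mem e).2.1.coeFn_toLp
  inj := toFun_injective α
  cont := continuous
  lift _ _ h := (exists_jet_eq α h).imp fun _ he => congrArg (fun z => (WithLp.ofLp z).1) he
  memLp_deriv e _ _ _ hr _ _ := (memLp_congr_ae hr.deriv_ae_eq).1 (weight_mem e).2.2

end H1

theorem norm_le_of_ae_norm_le {v : ℝ → ℂ} (hv : Continuous v) {C : ℝ}
    (h : ∀ᵐ x, ‖v x‖ ≤ C) (x : ℝ) : ‖v x‖ ≤ C :=
  (isClosed_le hv.norm continuous_const).closure_subset (Measure.dense_of_ae h x)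

theorem ae_norm_le_norm (V : Lp ℂ ∞ (volume : Measure ℝ)) : ∀ᵐ x, ‖V x‖ ≤ ‖V‖ := by
  have hne : eLpNormEssSup V volume ≠ ∞ := by
    simpa only [eLpNorm_exponent_top] using Lp.eLpNorm_ne_top V
  filter_upwards [ae_le_eLpNormEssSup (f := V) (μ := (volume : Measure ℝ))] with x hx
  simpa only [toReal_enorm, Lp.norm_def, eLpNorm_exponent_top] using ENNReal.toReal_mono hne hx

theorem IsPrimitive.norm_sub_le {v r : ℝ → ℂ} (hv : IsPrimitive v r) {C : ℝ}
    (h : ∀ᵐ x, ‖r x‖ ≤ C) (x y : ℝ) : ‖v y - v x‖ ≤ C * |y - x| := by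
  rw [← hv.2 x y]
  exact intervalIntegral.norm_integral_le_of_norm_le_const_ae (h.mono fun x hx _ => hx)

/-- `r + t v` is Lipschitz, so on `[x, x + 1]` the function `r` stays close to `r x`, while its mean
there is `v (x + 1) - v x`. -/
theorem IsPrimitive.norm_le_of_norm_add_le {v r s : ℝ → ℂ} {t : ℂ} (hv : IsPrimitive v r)
    (hr : IsPrimitive r s) {M K : ℝ} (hM : ∀ x, ‖v x‖ ≤ M)
    (hK : ∀ᵐ x, ‖s x + t * r x‖ ≤ K) (x : ℝ) : ‖r x‖ ≤ K + 2 * ‖t‖ * M + 2 * M := by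
  have hK₀ : 0 ≤ K := hK.exists.elim fun _ h => (norm_nonneg _).trans h
  have htv : ∀ z, ‖t * v z‖ ≤ ‖t‖ * M := fun z => by
    rw [norm_mul]
    exact mul_le_mul_of_nonneg_left (hM z) (norm_nonneg t)
  have hosc : ∀ z ∈ Set.uIoc x (x + 1), ‖r z - r x‖ ≤ K + 2 * ‖t‖ * M := fun z hz => by
    rw [Set.uIoc_of_le (by linarith)] at hz
    have hlip : ‖r z + t * v z - (r x + t * v x)‖ ≤ K := by
      refine ((hr.add (hv.const_mul t)).norm_sub_le hK x z).trans ?_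
      exact mul_le_of_le_one_right hK₀ (abs_le.2 ⟨by linarith [hz.1], by linarith [hz.2]⟩)
    calc ‖r z - r x‖ = ‖(r z + t * v z - (r x + t * v x)) - t * v z + t * v x‖ := by ring_nf
      _ ≤ K + ‖t‖ * M + ‖t‖ * M :=
        norm_add_le_of_le (norm_sub_le_of_le hlip (htv z)) (htv x)
      _ = K + 2 * ‖t‖ * M := by ring
  have hmean := intervalIntegral.norm_integral_le_of_norm_le_const hosc
  rw [intervalIntegral.integral_sub (hr.continuous.intervalIntegrable _ _) (by simp), hv.2,
    intervalIntegral.integral_const, add_sub_cancel_left, abs_one, mul_one, one_smul] at hmean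
  calc ‖r x‖ = ‖(v (x + 1) - v x) - (v (x + 1) - v x - r x)‖ := by ring_nf
    _ ≤ (M + M) + (K + 2 * ‖t‖ * M) :=
      norm_sub_le_of_le (norm_sub_le_of_le (hM _) (hM _)) hmean
    _ = K + 2 * ‖t‖ * M + 2 * M := by ring

namespace BUC

variable {α : ℝ} {v : ℝ → ℂ}

theorem norm_weight_le (e : BUC α) (x : ℝ) : ‖weight α (toFun α e) x‖ ≤ ‖e‖ :=
  (weighted α e).norm_coe_le_norm x

/-- The element `e^{-α ξ} v` of `BUC α`. -/
def mk (hv : v ∈ bucSubmodule) : BUC α :=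
  ⟨weight (-α) v, by rwa [Submodule.mem_comap, weight_weight_neg]⟩

theorem weight_mk (hv : v ∈ bucSubmodule) : weight α (toFun α (mk hv)) = v :=
  weight_weight_neg α v

theorem range_weighted (α : ℝ) :
    Set.range (weighted α) = {f : BoundedContinuousFunction ℝ ℂ | UniformContinuous f} := by
  ext f
  constructor
  · rintro ⟨e, rfl⟩
    exact (weight_mem e).1
  · intro hf
    have hmem : (f : ℝ → ℂ) ∈ bucSubmodule := ⟨hf, ‖f‖, f.norm_coe_le_norm⟩
    exact ⟨mk hmem, DFunLike.coe_injective (weight_mk hmem)⟩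

instance (α : ℝ) : CompleteSpace (BUC α) := by
  have hisom : Isometry (weighted α) := AddMonoidHomClass.isometry_of_norm _ fun _ => rfl
  rw [completeSpace_iff_isComplete_range hisom.isUniformInducing, range_weighted]
  refine (IsSeqClosed.isClosed fun f g hf hfg => ?_).isComplete
  exact (BoundedContinuousFunction.tendsto_iff_tendstoUniformly.1 hfg).uniformContinuous
    (Frequently.of_forall hf)

theorem memLp (e : BUC α) : MemLp (weight α (toFun α e)) ∞ volume :=
  memLp_top_of_bound (weight_mem e).1.continuous.aestronglyMeasurable ‖e‖
    (Eventually.of_forall (norm_weight_le e))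

/-- The map `u ↦ e^{α ξ} u` into `L^∞`. -/
def toLinfty (α : ℝ) : BUC α →L[ℂ] Lp ℂ ∞ (volume : Measure ℝ) :=
  LinearMap.mkContinuous
    { toFun := fun e => (memLp e).toLp _
      map_add' := fun e e' => by
        rw [← MemLp.toLp_add]
        exact MemLp.toLp_congr _ _ (by rw [map_add, map_add])
      map_smul' := fun a e => by
        rw [RingHom.id_apply, ← MemLp.toLp_const_smul]
        exact MemLp.toLp_congr _ _ (by rw [map_smul, map_smul]) } 1 fun e => by
    rw [one_mul]
    refine (Lp.norm_toLp _ (memLp e)).trans_le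
      (ENNReal.toReal_le_of_le_ofReal (norm_nonneg e) ?_)
    rw [eLpNorm_exponent_top]
    exact eLpNormEssSup_le_of_ae_bound (Eventually.of_forall (norm_weight_le e))

theorem mem_bucSubmodule_of_weakDeriv {U V : Lp ℂ ∞ (volume : Measure ℝ)}
    (hU : U =ᵐ[volume] v) (hv : IsPrimitive v V) : v ∈ bucSubmodule := by
  have hlip : LipschitzWith ‖V‖₊ v := LipschitzWith.of_dist_le_mul fun x y => by
    rw [dist_eq_norm, Real.dist_eq]
    exact hv.norm_sub_le (ae_norm_le_norm V) y x
  refine ⟨hlip.uniformContinuous, ‖U‖, norm_le_of_ae_norm_le hv.continuous ?_⟩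
  filter_upwards [hU, ae_norm_le_norm U] with x hx hle
  rwa [← hx]

theorem isWeightedSpace (α : ℝ) : IsWeightedSpace ∞ α (toFun α) (toLinfty α) where
  coe e := (memLp e).coeFn_toLp
  inj := toFun_injective α
  cont := continuous
  lift U V := by
    rintro ⟨v, hU, hv⟩
    refine ⟨mk (mem_bucSubmodule_of_weakDeriv hU hv), Lp.ext ?_⟩
    refine (memLp (mk (mem_bucSubmodule_of_weakDeriv hU hv))).coeFn_toLp.trans ?_
    rw [weight_mk]
    exact hU.symm
  memLp_deriv e r s t hr hs hg := by
    have hbound : ∀ᵐ x, ‖s x + t * r x‖ ≤ ‖hg.toLp _‖ := by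
      filter_upwards [ae_norm_le_norm (hg.toLp _), hg.coeFn_toLp] with x hle hx
      rwa [← hx]
    exact memLp_top_of_bound hs.continuous.aestronglyMeasurable _
      (Eventually.of_forall (hr.norm_le_of_norm_add_le hs (norm_weight_le e) hbound))

end BUC

end Spaces

/-! ### The coefficients along the front -/

section Front

theorem isBounded_range_of_tendsto {X : Type*} [PseudoMetricSpace X] {f : ℝ → X} {l₁ l₂ : X}
    (hf : Continuous f) (hbot : Tendsto f atBot (𝓝 l₁)) (htop : Tendsto f atTop (𝓝 l₂)) :
    Bornology.IsBounded (Set.range f) := by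
  obtain ⟨s, hs, hfs⟩ := Metric.exists_isBounded_image_of_tendsto hbot
  obtain ⟨t, ht, hft⟩ := Metric.exists_isBounded_image_of_tendsto htop
  have hst : s ∪ t ∈ cocompact ℝ := by
    rw [cocompact_eq_atBot_atTop]
    exact union_mem_sup hs ht
  obtain ⟨K, hK, hKst⟩ := mem_cocompact.1 hst
  refine ((hfs.union hft).union (hK.image hf).isBounded).subset ?_
  rw [← Set.image_union, ← Set.image_union, ← Set.image_univ]
  exact Set.image_mono fun x _ => (em (x ∈ K)).elim Or.inr fun hx => Or.inl (hKst hx)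

theorem exists_norm_deriv_le_of_locallyLipschitz {F : ℝ → ℝ} (hF : LocallyLipschitz F) {s : Set ℝ}
    (hs : Bornology.IsBounded s) : ∃ K, 0 ≤ K ∧ ∀ T ∈ s, ‖deriv F T‖ ≤ K := by
  have hcompact : IsCompact (Metric.cthickening 1 s) :=
    Metric.isCompact_of_isClosed_isBounded Metric.isClosed_cthickening hs.cthickening
  obtain ⟨K, hK⟩ := hF.locallyLipschitzOn.exists_lipschitzOnWith_of_compact hcompact
  refine ⟨K, K.coe_nonneg, fun T hT => norm_deriv_le_of_lipschitzOn ?_ hK⟩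
  exact mem_of_superset (Metric.isOpen_thickening.mem_nhds
    (Metric.self_subset_thickening one_pos s hT)) (Metric.thickening_subset_cthickening 1 s)

namespace IsFront

variable {F : ℝ → ℝ} {h c : ℝ} {u y : ℝ → ℝ}

theorem continuous_temperature (hf : IsFront F h c u y) : Continuous (temperature h u y) := by
  have hu := hf.contDiff_u.continuous
  have hy := hf.contDiff_y.continuous
  unfold temperature
  fun_prop

theorem temperature_atBot (hf : IsFront F h c u y) : Tendsto (temperature h u y) atBot (𝓝 1) := by
  unfold temperature
  simpa using (hf.u_atBot.const_mul h).add ((hf.y_atBot.const_sub 1).const_mul (1 - h))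

theorem temperature_atTop (hf : IsFront F h c u y) : Tendsto (temperature h u y) atTop (𝓝 0) := by
  unfold temperature
  simpa using (hf.u_atTop.const_mul h).add ((hf.y_atTop.const_sub 1).const_mul (1 - h))

theorem isBounded_range_temperature (hf : IsFront F h c u y) :
    Bornology.IsBounded (Set.range (temperature h u y)) :=
  isBounded_range_of_tendsto hf.continuous_temperature hf.temperature_atBot hf.temperature_atTop

theorem memLp_rate (hf : IsFront F h c u y) (hF : Continuous F) :
    MemLp (fun ξ => (F (temperature h u y ξ) : ℂ)) ⊤ volume := by
  have hcont := hF.comp hf.continuous_temperature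
  obtain ⟨C, hC⟩ := (isBounded_range_of_tendsto hcont ((hF.tendsto 1).comp hf.temperature_atBot)
    ((hF.tendsto 0).comp hf.temperature_atTop)).exists_norm_le
  refine memLp_top_of_bound (Complex.continuous_ofReal.comp hcont).aestronglyMeasurable C
    (Eventually.of_forall fun ξ => ?_)
  rw [Complex.norm_real]
  exact hC _ ⟨ξ, rfl⟩

theorem exists_norm_deriv_rate_le (hf : IsFront F h c u y) (hF : LocallyLipschitz F) :
    ∃ K, 0 ≤ K ∧ ∀ ξ, ‖((deriv F (temperature h u y ξ) * y ξ : ℝ) : ℂ)‖ ≤ K * ‖y ξ‖ := by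
  obtain ⟨K, hK₀, hK⟩ := exists_norm_deriv_le_of_locallyLipschitz hF hf.isBounded_range_temperature
  refine ⟨K, hK₀, fun ξ => ?_⟩
  rw [Complex.norm_real, norm_mul]
  exact mul_le_mul_of_nonneg_right (hK _ ⟨ξ, rfl⟩) (norm_nonneg _)

theorem memLp_deriv_rate (hf : IsFront F h c u y) (hF : LocallyLipschitz F) :
    MemLp (fun ξ => ((deriv F (temperature h u y ξ) * y ξ : ℝ) : ℂ)) ⊤ volume := by
  have hmeas : Measurable fun ξ => deriv F (temperature h u y ξ) :=
    (measurable_deriv F).comp hf.continuous_temperature.measurable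
  obtain ⟨K, hK₀, hK⟩ := hf.exists_norm_deriv_rate_le hF
  obtain ⟨Y, hY⟩ := (isBounded_range_of_tendsto hf.contDiff_y.continuous hf.y_atBot
    hf.y_atTop).exists_norm_le
  exact memLp_top_of_bound (Complex.measurable_ofReal.comp
      (hmeas.mul hf.contDiff_y.continuous.measurable)).aestronglyMeasurable (K * Y)
    (Eventually.of_forall fun ξ => (hK ξ).trans (mul_le_mul_of_nonneg_left (hY _ ⟨ξ, rfl⟩) hK₀))

theorem deriv_rate_atBot (hf : IsFront F h c u y) (hF : LocallyLipschitz F) :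
    Tendsto (fun ξ => ((deriv F (temperature h u y ξ) * y ξ : ℝ) : ℂ)) atBot (𝓝 0) := by
  obtain ⟨K, -, hK⟩ := hf.exists_norm_deriv_rate_le hF
  exact squeeze_zero_norm hK (by simpa using hf.y_atBot.norm.const_mul K)

theorem deriv_rate_atTop (hf : IsFront F h c u y) (hF : Tendsto (deriv F) (𝓝 0) (𝓝 0)) :
    Tendsto (fun ξ => ((deriv F (temperature h u y ξ) * y ξ : ℝ) : ℂ)) atTop (𝓝 0) := by
  have hlim := (hF.comp hf.temperature_atTop).mul hf.y_atTop
  rw [zero_mul] at hlim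
  exact_mod_cast (Complex.continuous_ofReal.tendsto 0).comp hlim

end IsFront

open ENNReal in
theorem IsWeightedSpace.re_le_of_mem_essentialSpectrum {F : ℝ → ℝ} {u y : ℝ → ℝ} {p : ℝ≥0∞}
    [Fact (1 ≤ p)] {k : SystemCoeffs} {E : Type} [NormedAddCommGroup E] [NormedSpace ℂ E]
    [CompleteSpace E] {ι : E →ₗ[ℂ] (ℝ → ℂ)} {j : E →L[ℂ] Lp ℂ p (volume : Measure ℝ)}
    (hE : IsWeightedSpace p k.α ι j) (hF : LocallyLipschitz F) (hF₀ : ∀ T, 0 ≤ F T)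
    (hF' : Tendsto (deriv F) (𝓝 0) (𝓝 0)) (hf : IsFront F k.h k.c u y) {z : ℂ}
    (hz : z ∈ essentialSpectrum (linearization ι F k.h k.c u y)) : z.re ≤ -k.damping := by
  have ha := hf.memLp_deriv_rate hF
  have hb := hf.memLp_rate hF.continuous
  have h𝓓 : IsSolvableDerivative (weakDeriv p) (mulOp hb) :=
    isSolvableDerivative_weakDeriv (hF.continuous.comp hf.continuous_temperature) fun _ => hF₀ _
  have hA : IsApproximable (weakDeriv p) (mulOp ha) :=
    isApproximable_mulOp ha (hf.deriv_rate_atBot hF) (hf.deriv_rate_atTop hF')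
  have hpart : IsPartOf (linearization ι F k.h k.c u y)
      (systemGraph k (weakDeriv p) (mulOp ha) (mulOp hb)) (j.prodMap j) :=
    hE.isPartOf_linearization
  obtain ⟨l, hl, hinj⟩ := exists_systemGraph_injective (k := k) (A := mulOp ha) h𝓓
  by_contra! hlt
  refine hpart.notMem_essentialSpectrum (Ω := {z : ℂ | -k.damping < z.re})
    (eq_zero_of_zero_mem_systemGraph h𝓓) (convex_halfSpace_re_gt _).isPreconnected
    (fun z₀ hz₀ => exists_systemGraph_parametrix h𝓓 hA hz₀) ⟨l, ?_, hinj⟩ hlt hz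
  exact (neg_lt_zero.2 k.damping_pos).trans (by simpa using hl)

end Front

/-! ### The smoothed Arrhenius rate -/

section Arrhenius

theorem locallyLipschitz_comp_of_forall_mem {X Y W : Type*} [PseudoEMetricSpace X]
    [PseudoEMetricSpace Y] [PseudoEMetricSpace W] {s : Set Y} {f : Y → W} {g : X → Y}
    (hf : LocallyLipschitzOn s f) (hg : LocallyLipschitz g) (hgs : ∀ x, g x ∈ s) :
    LocallyLipschitz (f ∘ g) := fun x => by
  obtain ⟨Kf, t, ht, hft⟩ := hf (hgs x)
  obtain ⟨Kg, t', ht', hgt⟩ := hg x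
  have hgx : Tendsto g (𝓝 x) (𝓝[s] (g x)) :=
    tendsto_nhdsWithin_iff.2 ⟨hg.continuous.tendsto x, Eventually.of_forall hgs⟩
  exact ⟨Kf * Kg, _, inter_mem (hgx ht) ht',
    hft.comp (hgt.mono Set.inter_subset_right) Set.inter_subset_left⟩

theorem locallyLipschitz_of_Iic_of_Ici {f : ℝ → ℝ} {a : ℝ} (hle : LocallyLipschitzOn (Set.Iic a) f)
    (hge : LocallyLipschitzOn (Set.Ici a) f) : LocallyLipschitz f := by
  have hsplit : f = f ∘ (min · a) + f ∘ (max · a) - fun _ => f a := by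
    ext x
    rcases le_total x a with hx | hx <;> simp [hx]
  have hmin : LocallyLipschitz (f ∘ (min · a)) :=
    locallyLipschitz_comp_of_forall_mem hle (LocallyLipschitz.id.min_const a)
      fun x => min_le_right x a
  have hmax : LocallyLipschitz (f ∘ (max · a)) :=
    locallyLipschitz_comp_of_forall_mem hge (LocallyLipschitz.id.max_const a)
      fun x => le_max_right x a
  rw [hsplit]
  exact (hmin.add hmax).sub (LocallyLipschitz.const _)

theorem locallyLipschitzOn_of_contDiffOn {s : Set ℝ} {f : ℝ → ℝ} (hf : ContDiffOn ℝ 1 f s)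
    (hs : Convex ℝ s) : LocallyLipschitzOn s f :=
  fun x hx => (hf x hx).exists_lipschitzOnWith hs

theorem contDiffOn_arrhenius (Z : ℝ) {σ : ℝ} (h : ℝ) (hσ : 0 < σ) (hσ1 : σ < 1) :
    ContDiffOn ℝ 1 (arrhenius Z σ h) (Set.Ici 0) := by
  have hne : ∀ T ∈ Set.Ici (0 : ℝ), σ + (1 - σ) * T ≠ 0 := fun T hT =>
    (add_pos_of_pos_of_nonneg hσ (mul_nonneg (sub_nonneg.2 hσ1.le) hT)).ne'
  unfold arrhenius
  fun_prop (disch := exact hne)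

namespace IsSmoothedArrhenius

variable {Z σ h Tign δ : ℝ} {F : ℝ → ℝ}

theorem locallyLipschitz (hF : IsSmoothedArrhenius Z σ h Tign δ F) (hσ : 0 < σ) (hσ1 : σ < 1)
    (hT : 0 < Tign) (hδ : 0 < δ) : LocallyLipschitz F := by
  have hsmooth : ContDiffOn ℝ 1 F (Set.Iic (Tign + 2 * δ)) :=
    hF.smooth.of_le (by exact_mod_cast le_top)
  have harrhenius : ContDiffOn ℝ 1 F (Set.Ici (Tign + 2 * δ)) :=
    ((contDiffOn_arrhenius Z h hσ hσ1).mono (Set.Ici_subset_Ici.2 (by positivity))).congr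
      hF.eq_arrhenius
  exact locallyLipschitz_of_Iic_of_Ici (locallyLipschitzOn_of_contDiffOn hsmooth (convex_Iic _))
    (locallyLipschitzOn_of_contDiffOn harrhenius (convex_Ici _))

theorem nonneg (hF : IsSmoothedArrhenius Z σ h Tign δ F) (hδ : 0 < δ) (T : ℝ) : 0 ≤ F T := by
  rcases le_total T Tign with hle | hge
  · exact (hF.eq_zero T hle).ge
  rcases le_total T (Tign + 2 * δ) with hle' | hge'
  · rw [← hF.eq_zero Tign le_rfl]
    exact hF.monotone ⟨le_rfl, by linarith⟩ ⟨hge, hle'⟩ hge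
  · rw [hF.eq_arrhenius T hge']
    exact (Real.exp_pos _).le

theorem tendsto_deriv (hF : IsSmoothedArrhenius Z σ h Tign δ F) (hT : 0 < Tign) :
    Tendsto (deriv F) (𝓝 0) (𝓝 0) := by
  have hzero : F =ᶠ[𝓝 0] fun _ => 0 := (eventually_le_nhds hT).mono hF.eq_zero
  exact tendsto_const_nhds.congr' (hzero.deriv.mono fun T hT' => by rw [hT', deriv_const])

end IsSmoothedArrhenius

end Arrhenius

end CombustionFront

end

theorem mainTheorem2_general {F : ℝ → ℝ} (hF : LocallyLipschitz F) (hF₀ : ∀ T, 0 ≤ F T)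
    (hF' : Tendsto (deriv F) (𝓝 0) (𝓝 0)) {h c : ℝ} {u y : ℝ → ℝ}
    (hfront : CombustionFront.IsFront F h c u y) {α : ℝ} (hα : 0 < α) (hαc : α < c / 2) :
    (∀ z ∈ CombustionFront.essentialSpectrum
        (CombustionFront.linearizationH1 α F h c u y), z.re ≤ -(α * (c - α))) ∧
      (∀ z ∈ CombustionFront.essentialSpectrum
        (CombustionFront.linearizationBUC α F h c u y), z.re ≤ -(α * (c - α))) := by
  let k : CombustionFront.SystemCoeffs := ⟨c, α, h, hα, hαc⟩
  exact ⟨fun z hz => (CombustionFront.H1.isWeightedSpace α).re_le_of_mem_essentialSpectrum (k := k)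
      hF hF₀ hF' hfront hz,
    fun z hz => (CombustionFront.BUC.isWeightedSpace α).re_le_of_mem_essentialSpectrum (k := k)
      hF hF₀ hF' hfront hz⟩

theorem mainTheorem2 (Z σ h Tign δ : ℝ) (hZ : 0 < Z) (hσ : 0 < σ) (hσ1 : σ < 1)
    (hh : 0 < h) (hh1 : h < 1) (hT : 0 < Tign) (hT1 : Tign < 1) (hδ : 0 < δ)
    (F : ℝ → ℝ) (hF : CombustionFront.IsSmoothedArrhenius Z σ h Tign δ F)
    (c : ℝ) (u y : ℝ → ℝ) (hfront : CombustionFront.IsFront F h c u y)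
    (α : ℝ) (hα : 0 < α) (hαc : α < c / 2) :
    ∃ ν : ℝ, 0 < ν ∧
      (∀ z ∈ CombustionFront.essentialSpectrum
        (CombustionFront.linearizationH1 α F h c u y), z.re ≤ -ν) ∧
      (∀ z ∈ CombustionFront.essentialSpectrum
        (CombustionFront.linearizationBUC α F h c u y), z.re ≤ -ν) :=
  ⟨α * (c - α), mul_pos hα (by linarith), mainTheorem2_general
    (hF.locallyLipschitz hσ hσ1 hT hδ) (hF.nonneg hδ) (hF.tendsto_deriv hT) hfront hα hαc⟩
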